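/- Let $d\ge 2$ and let $(\mathbb Z^d,E_d)$ be the nearest-neighbour lattice with graph distance $d(\cdot,\cdot)$ and closed balls $B(x,R)=\{y: d(x,y)\le R\}$. For an environment $\omega\in\Omega=[0,\infty)^{E_d}$ (with the product Borel $\sigma$-algebra) put $\mu^\omega(x)=\sum_{y\sim x}\omega(x,y)$, $\nu^\omega(x)=\sum_{y\sim x}1/\omega(x,y)$ and $(\tau_z\omega)(x,y)=\omega(x+z,y+z)$. Let $\mathbb P$ be a probability measure on $\Omega$ and let $\theta^\omega:\mathbb Z^d\to(0,\infty)$ be a speed measure depending on $\omega$, with generator $\mathcal L^\omega_\theta f(x)=\theta^\omega(x)^{-1}\sum_{y\sim x}\omega(x,y)(f(y)-f(x))$. Assume: 1. $\mathbb P[0<\omega(e)<\infty]=1$ and $\mathbb E[\omega(e)]<\infty$ for all $e\in E_d$; $\mathbb P$ is invariant under all $\tau_z$, and $\mathbb P(A)\in\{0,1\}$ for every event $A$ invariant under all $\tau_z$; $\theta^\omega(x+y)=\theta^{\tau_y\omega}(x)$ for all $x,y\in\mathbb Z^d$ and $\mathbb P$-a.e. $\omega$; $\mathbb E[\theta^\omega(0)]<\infty$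 and $\mathbb E[\theta^\omega(0)/\mu^\omega(0)]\in(0,\infty)$. 2. $p,q,r\in(1,\infty]$ satisfy $\frac1r+\frac1p\frac{r-1}r+\frac1q<\frac2d$ and $$\mathbb E\Big[\Big(\tfrac{\mu^\omega(0)}{\theta^\omega(0)}\Big)^p\theta^\omega(0)\Big]+\mathbb E[\nu^\omega(0)^q]+\mathbb E[\theta^\omega(0)^{-1}]+\mathbb E[\theta^\omega(0)^r]<\infty$$ (with the usual conventions, a moment of order $\infty$ being an essential supremum). Then for every $\epsilon>0$ there is a constant $\gamma=\gamma(\epsilon)>0$, depending only on $\epsilon,p,q,r,d$ and the law of $(\omega,\theta^\omega)$, such that the following holds. For every $x_0\in\mathbb Z^d$ and $\mathbb P$-a.e. $\omega$ there is $N_7=N_7(\omega,x_0)$, depending neither on $\epsilon$ nor on $t_0$ and $u$ below, such that for all real $n\ge N_7$, all $t_0\in\mathbb R$, all $\epsilon>0$ and every $u$ which is positive on $Q(n)=[t_0-n^2,t_0]\times B(x_0,n)$ and satisfies $\partial_tu-\mathcal L^\omega_\theta u=0$ on $Q(n)$: if, with $\eta(x)=[1-2d(x_0,x)/n]_+$,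 $$\frac1{n^2}\int_{t_0-n^2}^{t_0}\frac{\sum_{x\in B(x_0,n)}\mathbf 1_{\{u(t,x)\ge\epsilon\}}\,\eta(x)^2\theta^\omega(x)}{\sum_{x\in B(x_0,n)}\eta(x)^2\theta^\omega(x)}\,dt\;\ge\;\frac12 ,$$ then $$u(t,x)\ge\gamma(\epsilon)\qquad\text{for all }(t,x)\in[t_0-n^2/8,\,t_0]\times B(x_0,n/4).$$ -/

import Mathlib

open MeasureTheory Set
open scoped NNReal ENNReal

noncomputable section

namespace RCM

/-- The vertex set `ℤ^d`. -/
abbrev Lattice (d : ℕ) : Type := Fin d → ℤ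

/-- The nearest-neighbour graph on `ℤ^d`. -/
def latticeGraph (d : ℕ) : SimpleGraph (Lattice d) where
  Adj x y := ∑ i, |x i - y i| = 1
  symm := ⟨fun x y h => by
    simpa only [abs_sub_comm] using h⟩
  loopless := ⟨fun x h => by simp at h⟩

theorem latticeGraph_adj {d : ℕ} {x y : Lattice d} :
    (latticeGraph d).Adj x y ↔ ∑ i, |x i - y i| = 1 := Iff.rfl

theorem le_walk_length {d : ℕ} {x y : Lattice d} (w : (latticeGraph d).Walk x y) :
    ∑ i, |x i - y i| ≤ (w.length : ℤ) := by
  induction w with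
  | nil => simp
  | @cons a b c hab w ih =>
    have h1 : ∑ i, |a i - c i| ≤ ∑ i, |a i - b i| + ∑ i, |b i - c i| := by
      rw [← Finset.sum_add_distrib]
      exact Finset.sum_le_sum fun i _ => abs_sub_le _ _ _
    rw [latticeGraph_adj.1 hab] at h1
    simp only [SimpleGraph.Walk.length_cons]
    push_cast
    linarith

theorem exists_walk {d : ℕ} (k : ℕ) :
    ∀ x y : Lattice d, ∑ i, |x i - y i| = (k : ℤ) →
      ∃ w : (latticeGraph d).Walk x y, w.length = k := by
  induction k with
  | zero =>
    intro x y h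
    have h0 : ∀ i ∈ Finset.univ, |x i - y i| = 0 :=
      (Finset.sum_eq_zero_iff_of_nonneg fun i _ => abs_nonneg _).1 (by simpa using h)
    have hxy : x = y := by
      funext i
      exact sub_eq_zero.1 (abs_eq_zero.1 (h0 i (Finset.mem_univ i)))
    subst hxy
    exact ⟨.nil, rfl⟩
  | succ k ih =>
    intro x y h
    have hne : ∃ i, x i ≠ y i := by
      by_contra! hc
      simp only [hc, sub_self, abs_zero, Finset.sum_const_zero] at h
      push_cast at h
      omega
    obtain ⟨i, hi⟩ := hne
    obtain ⟨s, hs, hs'⟩ : ∃ s : ℤ, |s| = 1 ∧ |x i + s - y i| = |x i - y i| - 1 := by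
      rcases lt_or_gt_of_ne hi with hlt | hlt
      · refine ⟨1, by simp, ?_⟩
        rw [abs_of_nonpos (by omega), abs_of_nonpos (by omega)]
        ring
      · refine ⟨-1, by simp, ?_⟩
        rw [abs_of_nonneg (by omega), abs_of_nonneg (by omega)]
        ring
    let x' : Lattice d := Function.update x i (x i + s)
    have hadj : (latticeGraph d).Adj x x' := by
      rw [latticeGraph_adj, Finset.sum_eq_single i]
      · simp [x', hs]
      · intro j _ hj
        simp [x', hj]
      · simp
    have hk : ∑ j, |x' j - y j| = (k : ℤ) := by
      have e1 := Finset.add_sum_erase Finset.univ (fun j => |x j - y j|) (Finset.mem_univ i)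
      have e2 := Finset.add_sum_erase Finset.univ (fun j => |x' j - y j|) (Finset.mem_univ i)
      have e3 : ∑ j ∈ Finset.univ.erase i, |x' j - y j|
          = ∑ j ∈ Finset.univ.erase i, |x j - y j| :=
        Finset.sum_congr rfl fun j hj => by simp [x', Finset.ne_of_mem_erase hj]
      have e4 : |x' i - y i| = |x i - y i| - 1 := by simp [x', hs']
      push_cast at h
      rw [e3, e4] at e2
      linarith
    obtain ⟨w, hw⟩ := ih x' y hk
    exact ⟨.cons hadj w, by simp [hw]⟩

/-- The graph distance is the `ℓ¹`-distance. -/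
theorem latticeGraph_dist {d : ℕ} (x y : Lattice d) :
    (((latticeGraph d).dist x y : ℕ) : ℤ) = ∑ i, |x i - y i| := by
  obtain ⟨k, hk⟩ := Int.eq_ofNat_of_zero_le
    (Finset.sum_nonneg fun i (_ : i ∈ Finset.univ) => abs_nonneg (x i - y i))
  obtain ⟨w, hw⟩ := exists_walk k x y hk
  apply le_antisymm
  · rw [hk, ← hw]
    exact_mod_cast SimpleGraph.dist_le w
  · obtain ⟨w', hw'⟩ := (SimpleGraph.Walk.reachable w).exists_walk_length_eq_dist
    rw [← hw']
    exact le_walk_length w'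

/-- The closed ball `B(x, R) = {y : d(x, y) ≤ R}` for the graph distance, with real radius. -/
def ball {d : ℕ} (x : Lattice d) (R : ℝ) : Set (Lattice d) :=
  {y | ((latticeGraph d).dist x y : ℝ) ≤ R}

theorem ball_finite {d : ℕ} (x : Lattice d) (R : ℝ) : (ball x R).Finite := by
  refine (Set.Finite.pi' fun i => Set.finite_Icc (x i - ⌈R⌉) (x i + ⌈R⌉)).subset ?_
  intro y hy i
  have h1 : ((latticeGraph d).dist x y : ℝ) ≤ (⌈R⌉ : ℝ) := le_trans hy (Int.le_ceil R)
  have h2 : (((latticeGraph d).dist x y : ℕ) : ℤ) ≤ ⌈R⌉ := by exact_mod_cast h1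
  rw [latticeGraph_dist] at h2
  have h3 : |x i - y i| ≤ ∑ j, |x j - y j| :=
    Finset.single_le_sum (f := fun j => |x j - y j|) (fun j _ => abs_nonneg _)
      (Finset.mem_univ i)
  have h4 := abs_le.1 (h3.trans h2)
  exact ⟨by linarith [h4.2], by linarith [h4.1]⟩

/-- The ball as a finite set of vertices. -/
def ballFinset {d : ℕ} (x : Lattice d) (R : ℝ) : Finset (Lattice d) :=
  (ball_finite x R).toFinset

theorem neighborSet_finite {d : ℕ} (x : Lattice d) :
    ((latticeGraph d).neighborSet x).Finite := by
  refine (ball_finite x 1).subset fun y hy => ?_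
  have h := latticeGraph_dist x y
  rw [latticeGraph_adj.1 hy] at h
  have h' : (latticeGraph d).dist x y = 1 := by exact_mod_cast h
  simp [ball, h']

instance instFintypeNeighborSet {d : ℕ} (x : Lattice d) :
    Fintype ((latticeGraph d).neighborSet x) :=
  (neighborSet_finite x).fintype

/-- The set `E_d` of unoriented nearest-neighbour edges. -/
abbrev Edge (d : ℕ) : Type := (latticeGraph d).edgeSet

/-- The space of environments `[0,∞)^{E_d}`; it carries the product Borel `σ`-algebra. -/
abbrev Environment (d : ℕ) : Type := Edge d → ℝ≥0

/-- The conductance `ω(x, y)` of the edge joining `x` to its neighbour `y`. -/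
def conductance {d : ℕ} (ω : Environment d) (x : Lattice d)
    (y : (latticeGraph d).neighborSet x) : ℝ :=
  ω ⟨s(x, (y : Lattice d)), y.2⟩

/-- `μ^ω(x) = ∑_{y ∼ x} ω(x, y)`. -/
def muMeasure {d : ℕ} (ω : Environment d) (x : Lattice d) : ℝ :=
  ∑ y : (latticeGraph d).neighborSet x, conductance ω x y

/-- `ν^ω(x) = ∑_{y ∼ x} 1 / ω(x, y)`. -/
def nuMeasure {d : ℕ} (ω : Environment d) (x : Lattice d) : ℝ :=
  ∑ y : (latticeGraph d).neighborSet x, 1 / conductance ω x y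

/-- Translation of edges, `{x, y} ↦ {x + z, y + z}`. -/
def shiftEdge {d : ℕ} (z : Lattice d) (e : Edge d) : Edge d :=
  ⟨e.1.map (fun x => x + z), by
    obtain ⟨e, he⟩ := e
    induction e using Sym2.ind with
    | _ x y =>
      rw [SimpleGraph.mem_edgeSet, latticeGraph_adj] at he
      rw [Sym2.map_mk, SimpleGraph.mem_edgeSet, latticeGraph_adj]
      simpa using he⟩

/-- The space shift `(τ_z ω)(x, y) = ω(x + z, y + z)`. -/
def shift {d : ℕ} (z : Lattice d) (ω : Environment d) : Environment d :=
  fun e => ω (shiftEdge z e)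

/-- The ergodicity assumption on the law `P` of the environment and on the speed measure
`θ^ω : ℤ^d → (0,∞)`. -/
structure ErgodicityAssumption {d : ℕ} (P : Measure (Environment d))
    (θ : Environment d → Lattice d → ℝ) : Prop where
  conductance_pos : ∀ e : Edge d, ∀ᵐ ω ∂P, 0 < ω e
  conductance_integrable : ∀ e : Edge d, Integrable (fun ω => (ω e : ℝ)) P
  stationary : ∀ z : Lattice d, MeasurePreserving (shift z) P P
  ergodic : ∀ A : Set (Environment d), MeasurableSet A →
    (∀ z : Lattice d, shift z ⁻¹' A = A) → P A = 0 ∨ P A = 1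
  speed_pos : ∀ᵐ ω ∂P, ∀ x : Lattice d, 0 < θ ω x
  speed_stationary : ∀ x y : Lattice d, ∀ᵐ ω ∂P, θ ω (x + y) = θ (shift y ω) x
  speed_integrable : Integrable (fun ω => θ ω 0) P
  speed_div_mu_integrable : Integrable (fun ω => θ ω 0 / muMeasure ω 0) P
  speed_div_mu_pos : 0 < ∫ ω, θ ω 0 / muMeasure ω 0 ∂P

/-- The moment assumption with exponents `p, q, r ∈ (1,∞]`. With `1/∞ = 0`, and moments of order
`∞` read as essential suprema, it says `1/r + (1/p) (r-1)/r + 1/q < 2/d` and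
`E[(μ(0)/θ(0))^p θ(0)] + E[ν(0)^q] + E[1/θ(0)] + E[θ(0)^r] < ∞`. -/
structure MomentAssumption {d : ℕ} (P : Measure (Environment d))
    (θ : Environment d → Lattice d → ℝ) (p q r : ℝ≥0∞) : Prop where
  one_lt_p : 1 < p
  one_lt_q : 1 < q
  one_lt_r : 1 < r
  exponents : r⁻¹ + p⁻¹ * (1 - r⁻¹) + q⁻¹ < 2 / (d : ℝ≥0∞)
  mu_div_speed : MemLp (fun ω => muMeasure ω 0 / θ ω 0) p
    (P.withDensity fun ω => ENNReal.ofReal (θ ω 0))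
  nu : MemLp (fun ω => nuMeasure ω 0) q P
  inv_speed : Integrable (fun ω => (θ ω 0)⁻¹) P
  speed : MemLp (fun ω => θ ω 0) r P

/-- The generator
`(L f)(x) = (1/ϑ(x)) ∑_{y ∼ x} ω(x, y) (f(y) - f(x))` with speed measure `ϑ`. -/
def generator {d : ℕ} (ω : Environment d) (ϑ : Lattice d → ℝ) (f : Lattice d → ℝ)
    (x : Lattice d) : ℝ :=
  1 / ϑ x * ∑ y : (latticeGraph d).neighborSet x, conductance ω x y * (f y - f x)

/-- `∂_t u - L u = 0` on `I × B`; at an end point of the time interval `I` the derivative is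
one-sided. -/
def IsCaloricOn {d : ℕ} (ω : Environment d) (ϑ : Lattice d → ℝ) (I : Set ℝ)
    (B : Set (Lattice d)) (u : ℝ → Lattice d → ℝ) : Prop :=
  ∀ t ∈ I, ∀ x ∈ B, HasDerivWithinAt (fun s => u s x) (generator ω ϑ (u t) x) I t

/-- The weighted averaged norm
`‖f‖_{1,B,φ} = (1/φ(B)) ∑_{x ∈ B} |f(x)| φ(x)`. -/
def weightedNorm {d : ℕ} (B : Finset (Lattice d)) (φ f : Lattice d → ℝ) : ℝ :=
  1 / (∑ x ∈ B, φ x) * ∑ x ∈ B, |f x| * φ x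

/-- The cut-off function `η(x) = [1 - 2 d(x₀, x) / n]₊`. -/
def cutoff {d : ℕ} (x₀ : Lattice d) (n : ℝ) (x : Lattice d) : ℝ :=
  max (1 - 2 * ((latticeGraph d).dist x₀ x : ℝ) / n) 0

end RCM

end

/-! Dividing `u` by `ε` reduces everything to level one, so the constant is linear in `ε`. Fix a
large height `H`, put `c = 1 / (exp H - 1)`, `z = u + c` and `w = log (1 + 1 / z)`. This function of
`z` is convex and decreasing, so `w` is a positive subsolution with `w ≤ H` everywhere and `w ≤ 1`
where `u ≥ 1`. Moreover `w ≤ H / 2` forces `z ≥ 2 c`, hence `u ≥ c`. It remains to prove `w ≤ H / 2`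
on the smaller cylinder.

Moser iteration (`moser_step`, `maximal_inequality`) bounds `w ^ 2` there by an average of `w ^ 2`,
taken in `L^P` in space, with `P` conjugate to `p`, and in `L¹` in time. Since `w ≤ H`, this average
is at most of order `H ^ (2 - 1 / P) * m ^ (1 / P)`, where `m` bounds the mass `∑ ϑ η² w` divided by
`n ^ d`. So it is enough to have `m ≤ δ H` for one small `δ` that does not depend on `H`
(`exists_lower_bound`). The assumption on the exponents is what makes the gain of integrability in
each step larger than one.

The mass is controlled in `exists_mass_bound`. Because `exp (-log (1 + 1 / z)) = z / (1 + z)` is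
concave, there is a logarithmic energy estimate: the mass increases by at most a multiple of `n ^
d`, and the Dirichlet energy of `w` integrated over time is of order `n ^ d * (H + 4)`. By
Chebyshev, at some time before the last quarter of the interval the set `{u ≥ 1}` carries a quarter
of the mass of `η²` while the energy is of order `n ^ d / n ^ 2 * (H + 4)`. A weighted Poincaré
inequality in `L¹` (`cutoff_poincare`) then bounds the mass at that time by `n ^ d` times a sum of
three terms, of order `1`, `T² √(H + 4)` and `T ^ (1 - r) H`. Here `T` truncates the speed measure,
since the Poincaré inequality is for counting measure. First `T` and then `H` are taken large
(`exists_height`).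

The environment enters only through `VolumeBounds`: a few sums over `B(x₀, n)` are at most `A n ^ d`
with deterministic `A`. As only upper bounds are needed, a weak-type maximal inequality from a
Vitali covering replaces the ergodic theorem. It gives an event of positive probability on which all
box averages around the origin are bounded; that this happens around some centre is an invariant
event, hence almost sure, and changing the centre costs only a constant for large radii
(`ae_sum_ball_le`). The analytic constants depend only on `A`, `d` and the exponents, so the final
constant is deterministic and the threshold for `n` involves only `ω` and `x₀`. -/

namespace RCM

variable {d : ℕ}

/-! ### Lattice distance, conductances as a matrix, the cut-off function, and boxes -/

theorem mem_ballFinset {x y : Lattice d} {R : ℝ} :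
    y ∈ ballFinset x R ↔ ((latticeGraph d).dist x y : ℝ) ≤ R := by
  simp [ballFinset, ball]

theorem ballFinset_mono (x : Lattice d) {R S : ℝ} (h : R ≤ S) :
    ballFinset x R ⊆ ballFinset x S := fun _ hy =>
  mem_ballFinset.2 ((mem_ballFinset.1 hy).trans h)

theorem dist_real (x y : Lattice d) :
    ((latticeGraph d).dist x y : ℝ) = ∑ i, |(x i : ℝ) - y i| := by
  have h := latticeGraph_dist x y
  have h' : (((latticeGraph d).dist x y : ℤ) : ℝ) = ((∑ i, |x i - y i| : ℤ) : ℝ) := by rw [h]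
  push_cast at h'
  exact h'

theorem dist_triangle' (x y z : Lattice d) :
    ((latticeGraph d).dist x z : ℝ) ≤ (latticeGraph d).dist x y + (latticeGraph d).dist y z := by
  simp only [dist_real, ← Finset.sum_add_distrib]
  exact Finset.sum_le_sum fun i _ => abs_sub_le _ _ _

theorem dist_of_adj {x y : Lattice d} (h : (latticeGraph d).Adj x y) :
    ((latticeGraph d).dist x y : ℝ) = 1 := by
  have := latticeGraph_dist x y
  rw [latticeGraph_adj.1 h] at this
  exact_mod_cast this

theorem dist_le_add_one {x₀ x y : Lattice d} (h : (latticeGraph d).Adj x y) :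
    ((latticeGraph d).dist x₀ y : ℝ) ≤ (latticeGraph d).dist x₀ x + 1 := by
  have := dist_triangle' x₀ x y
  rwa [dist_of_adj h] at this

theorem abs_dist_sub_le {x₀ x y : Lattice d} (h : (latticeGraph d).Adj x y) :
    |((latticeGraph d).dist x₀ y : ℝ) - (latticeGraph d).dist x₀ x| ≤ 1 := by
  rw [abs_le]
  constructor
  · linarith [dist_le_add_one (x₀ := x₀) h.symm]
  · linarith [dist_le_add_one (x₀ := x₀) h]

instance : DecidableRel (latticeGraph d).Adj := fun x y =>
  decidable_of_iff (∑ i, |x i - y i| = 1) latticeGraph_adj.symm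

/-- The conductances as a symmetric matrix indexed by the vertices. -/
noncomputable def weight (ω : Environment d) (x y : Lattice d) : ℝ :=
  if h : (latticeGraph d).Adj x y then (ω ⟨s(x, y), h⟩ : ℝ) else 0

theorem weight_nonneg (ω : Environment d) (x y : Lattice d) : 0 ≤ weight ω x y := by
  unfold weight
  split_ifs <;> positivity

theorem weight_symm (ω : Environment d) (x y : Lattice d) : weight ω x y = weight ω y x := by
  unfold weight
  by_cases h : (latticeGraph d).Adj x y
  · have h' := h.symm
    simp only [h, h', dif_pos]
    congr 2
    exact Subtype.ext Sym2.eq_swap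
  · have h' : ¬ (latticeGraph d).Adj y x := fun h' => h h'.symm
    simp only [h, h', dif_neg, not_false_eq_true]

theorem weight_of_not_adj (ω : Environment d) {x y : Lattice d}
    (h : ¬ (latticeGraph d).Adj x y) : weight ω x y = 0 := by
  simp [weight, h]

theorem weight_pos {ω : Environment d} (hω : ∀ e, 0 < ω e) {x y : Lattice d}
    (h : (latticeGraph d).Adj x y) : 0 < weight ω x y := by
  simp only [weight, h, dif_pos]
  exact_mod_cast hω _

theorem conductance_eq_weight (ω : Environment d) (x : Lattice d)
    (y : (latticeGraph d).neighborSet x) : conductance ω x y = weight ω x y := by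
  have h : (latticeGraph d).Adj x y := y.2
  simp [conductance, weight, h]

/-- A sum over neighbours as a sum over a finite set containing all neighbours. -/
theorem sum_neighborSet {x : Lattice d} {B : Finset (Lattice d)}
    (hB : ∀ y, (latticeGraph d).Adj x y → y ∈ B) (F : Lattice d → ℝ) :
    ∑ y : (latticeGraph d).neighborSet x, F y = ∑ y ∈ B with (latticeGraph d).Adj x y, F y := by
  refine Finset.sum_bij' (i := fun y _ => (y : Lattice d))
    (j := fun y hy => ⟨y, (Finset.mem_filter.1 hy).2⟩) ?_ ?_ ?_ ?_ ?_
  · intro y _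
    exact Finset.mem_filter.2 ⟨hB _ y.2, y.2⟩
  all_goals simp

theorem sum_filter_le_sum_neighborSet (x : Lattice d) (B : Finset (Lattice d))
    {F : Lattice d → ℝ} (hF : ∀ y, 0 ≤ F y) :
    ∑ y ∈ B with (latticeGraph d).Adj x y, F y ≤ ∑ y : (latticeGraph d).neighborSet x, F y := by
  classical
  let N : Finset (Lattice d) := (neighborSet_finite x).toFinset
  rw [sum_neighborSet (B := B ∪ N) (fun y hy => Finset.mem_union_right _ (by simpa [N] using hy))]
  exact Finset.sum_le_sum_of_subset_of_nonneg
    (Finset.filter_subset_filter _ Finset.subset_union_left) fun y _ _ => hF y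

theorem sum_weight_mul (ω : Environment d) (x : Lattice d) (B : Finset (Lattice d))
    (F : Lattice d → ℝ) :
    ∑ y ∈ B, weight ω x y * F y
      = ∑ y ∈ B with (latticeGraph d).Adj x y, weight ω x y * F y := by
  rw [Finset.sum_filter]
  refine Finset.sum_congr rfl fun y _ => ?_
  split_ifs with h
  · rfl
  · rw [weight_of_not_adj ω h, zero_mul]

theorem sum_weight_le_muMeasure (ω : Environment d) (x : Lattice d) (B : Finset (Lattice d)) :
    ∑ y ∈ B, weight ω x y ≤ muMeasure ω x := by
  have h := sum_weight_mul ω x B (fun _ => 1)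
  simp only [mul_one] at h
  rw [h, muMeasure]
  simp only [conductance_eq_weight]
  exact sum_filter_le_sum_neighborSet x B (weight_nonneg ω x)

theorem sum_inv_weight_le_nuMeasure (ω : Environment d) (x : Lattice d)
    (B : Finset (Lattice d)) :
    ∑ y ∈ B with (latticeGraph d).Adj x y, (weight ω x y)⁻¹ ≤ nuMeasure ω x := by
  rw [nuMeasure]
  simp only [conductance_eq_weight, one_div]
  exact sum_filter_le_sum_neighborSet x B fun y => inv_nonneg.2 (weight_nonneg ω x y)

theorem muMeasure_nonneg (ω : Environment d) (x : Lattice d) : 0 ≤ muMeasure ω x :=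
  Finset.sum_nonneg fun y _ => by rw [conductance_eq_weight]; exact weight_nonneg _ _ _

theorem nuMeasure_nonneg (ω : Environment d) (x : Lattice d) : 0 ≤ nuMeasure ω x :=
  Finset.sum_nonneg fun y _ => by
    rw [conductance_eq_weight]; exact one_div_nonneg.2 (weight_nonneg _ _ _)

theorem abs_cutoff_sub_le {x₀ x y : Lattice d} {n : ℝ} (hn : 0 < n)
    (h : (latticeGraph d).Adj x y) : |cutoff x₀ n x - cutoff x₀ n y| ≤ 2 / n := by
  unfold cutoff
  refine (abs_max_sub_max_le_abs _ _ _).trans ?_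
  have : 1 - 2 * ((latticeGraph d).dist x₀ x : ℝ) / n - (1 - 2 * ((latticeGraph d).dist x₀ y : ℝ) / n)
      = 2 / n * ((latticeGraph d).dist x₀ y - (latticeGraph d).dist x₀ x) := by
    field_simp
    ring
  rw [this, abs_mul, abs_of_pos (by positivity)]
  exact mul_le_of_le_one_right (by positivity) (abs_dist_sub_le h)

theorem cutoff_nonneg (x₀ : Lattice d) (n : ℝ) (x : Lattice d) : 0 ≤ cutoff x₀ n x :=
  le_max_right _ _

theorem cutoff_le_one (x₀ x : Lattice d) {n : ℝ} (hn : 0 < n) : cutoff x₀ n x ≤ 1 :=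
  max_le (by linarith [show 0 ≤ 2 * ((latticeGraph d).dist x₀ x : ℝ) / n by positivity]) zero_le_one

theorem dist_lt_of_cutoff_ne_zero {x₀ x : Lattice d} {n : ℝ} (hn : 0 < n)
    (h : cutoff x₀ n x ≠ 0) : ((latticeGraph d).dist x₀ x : ℝ) < n / 2 := by
  by_contra! hc
  refine h (max_eq_right ?_)
  rw [sub_nonpos, one_le_div hn]
  linarith

theorem le_cutoff {x₀ x : Lattice d} {n c : ℝ} (hn : 0 < n)
    (h : ((latticeGraph d).dist x₀ x : ℝ) ≤ (1 - c) / 2 * n) : c ≤ cutoff x₀ n x := by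
  refine le_max_of_le_left ?_
  rw [le_sub_comm, div_le_iff₀ hn]
  linarith

/-- Boxes `{y : |y i - x i| ≤ k}`. -/
noncomputable def box (x : Lattice d) (k : ℕ) : Finset (Lattice d) :=
  Fintype.piFinset fun i => Finset.Icc (x i - k) (x i + k)

theorem mem_box {x y : Lattice d} {k : ℕ} : y ∈ box x k ↔ ∀ i, |y i - x i| ≤ k := by
  simp only [box, Fintype.mem_piFinset, Finset.mem_Icc, abs_le]
  exact forall_congr' fun i => ⟨fun h => ⟨by linarith [h.1], by linarith [h.2]⟩,
    fun h => ⟨by linarith [h.1], by linarith [h.2]⟩⟩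

theorem card_box (x : Lattice d) (k : ℕ) : (box x k).card = (2 * k + 1) ^ d := by
  rw [box, Fintype.card_piFinset]
  simp only [Int.card_Icc]
  rw [Finset.prod_congr rfl (g := fun _ => 2 * k + 1) (fun i _ => by omega)]
  simp

theorem ballFinset_subset_box (x : Lattice d) {R : ℝ} {k : ℕ} (h : R ≤ k) :
    ballFinset x R ⊆ box x k := by
  intro y hy
  rw [mem_ballFinset, dist_real] at hy
  rw [mem_box]
  intro i
  have h3 : |(x i : ℝ) - y i| ≤ ∑ j, |(x j : ℝ) - y j| :=
    Finset.single_le_sum (f := fun j => |(x j : ℝ) - y j|) (fun j _ => abs_nonneg _)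
      (Finset.mem_univ i)
  have h4 : |(y i : ℝ) - x i| ≤ k := by rw [abs_sub_comm]; linarith
  exact_mod_cast h4

theorem box_subset_ballFinset (x : Lattice d) {R : ℝ} {k : ℕ} (h : d * (k : ℝ) ≤ R) :
    box x k ⊆ ballFinset x R := by
  intro y hy
  rw [mem_box] at hy
  rw [mem_ballFinset, dist_real]
  calc ∑ i, |(x i : ℝ) - y i| ≤ ∑ _i : Fin d, (k : ℝ) := Finset.sum_le_sum fun i _ => by
        rw [abs_sub_comm]; exact_mod_cast hy i
    _ = d * k := by simp
    _ ≤ R := h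

theorem pow_le_card_ballFinset (hd : 0 < d) (x : Lattice d) {R : ℝ} (hR : 0 ≤ R) :
    (R / d) ^ d ≤ (ballFinset x R).card := by
  have hd' : (0 : ℝ) < d := by exact_mod_cast hd
  have h0 : 0 ≤ R / d := by positivity
  set k := ⌊R / d⌋₊
  have h1 : (k : ℝ) ≤ R / d := Nat.floor_le h0
  have h2 : R / d < k + 1 := Nat.lt_floor_add_one _
  have h3 := Finset.card_le_card (box_subset_ballFinset x (R := R) (k := k) (by
    rw [le_div_iff₀ hd'] at h1; linarith))
  rw [card_box] at h3
  calc (R / d) ^ d ≤ (2 * k + 1 : ℝ) ^ d := by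
        gcongr
        have : (0 : ℝ) ≤ k := by positivity
        linarith
    _ ≤ _ := by exact_mod_cast h3

theorem adj_update (x : Lattice d) (i : Fin d) (t : ℤ) :
    (latticeGraph d).Adj (Function.update x i t) (Function.update x i (t + 1)) := by
  rw [latticeGraph_adj, Finset.sum_eq_single i]
  · simp
  · intro j _ hj
    simp [hj]
  · simp

/-! ### Discrete Sobolev inequalities -/

theorem pi_count_eq : Measure.pi (fun _ : Fin d => (Measure.count : Measure ℤ)) = Measure.count := by
  refine Measure.ext_of_singleton fun x => ?_
  rw [Measure.pi_singleton]
  simp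

/-- The discrete gradient of `f`, as the sum over the `d` positive directions. -/
noncomputable def forwardGrad (f : Lattice d → ℝ) (x : Lattice d) : ℝ≥0∞ :=
  ∑ i, ENNReal.ofReal |f (Function.update x i (x i + 1)) - f x|

theorem ofReal_abs_sub_le_forwardGrad (f : Lattice d → ℝ) (x : Lattice d) (i : Fin d) :
    ENNReal.ofReal |f (Function.update x i (x i + 1)) - f x| ≤ forwardGrad f x := by
  rw [forwardGrad, ← Finset.add_sum_erase Finset.univ _ (Finset.mem_univ i)]
  exact le_self_add

theorem ofReal_abs_sub_le_sum (f : Lattice d → ℝ) (x : Lattice d) (i : Fin d) (k : ℕ) (a : ℤ) :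
    ENNReal.ofReal |f (Function.update x i (a + k)) - f (Function.update x i a)|
      ≤ ∑ j ∈ Finset.range k, forwardGrad f (Function.update x i (a + j)) := by
  induction k with
  | zero => simp
  | succ k ih =>
    rw [Finset.sum_range_succ]
    have h1 : |f (Function.update x i (a + (k + 1 : ℕ))) - f (Function.update x i a)|
        ≤ |f (Function.update x i (a + k)) - f (Function.update x i a)|
          + |f (Function.update x i (a + k + 1)) - f (Function.update x i (a + k))| := by
      have e : a + ((k + 1 : ℕ) : ℤ) = a + k + 1 := by push_cast; ring
      rw [e]
      exact (abs_sub_le (f (Function.update x i (a + k + 1))) _ _).trans_eq (add_comm _ _)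
    refine (ENNReal.ofReal_le_ofReal h1).trans ((ENNReal.ofReal_add_le).trans (add_le_add ih ?_))
    simpa using ofReal_abs_sub_le_forwardGrad f (Function.update x i (a + k)) i

/-- A finitely supported function vanishes somewhere on every coordinate half-line, and telescoping
from `x` to such a point costs at most the gradient summed over the whole line. -/
theorem ofReal_abs_le_lintegral {f : Lattice d → ℝ} {S : Finset (Lattice d)}
    (hf : ∀ x ∉ S, f x = 0) (x : Lattice d) (i : Fin d) :
    ENNReal.ofReal |f x| ≤ ∫⁻ t, forwardGrad f (Function.update x i t) ∂Measure.count := by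
  rw [lintegral_count]
  obtain ⟨k, hk⟩ : ∃ k : ℕ, f (Function.update x i (x i + k)) = 0 := by
    by_contra! h
    have hinj : Function.Injective fun k : ℕ => Function.update x i (x i + k) := by
      intro k l hkl
      have := congrFun hkl i
      simpa using this
    exact Set.infinite_of_injective_forall_mem hinj (s := (S : Set (Lattice d)))
      (fun k => by by_contra hc; exact h k (hf _ hc)) S.finite_toSet
  have h := ofReal_abs_sub_le_sum f x i k (x i)
  rw [hk, Function.update_eq_self, zero_sub, abs_neg] at h
  refine h.trans ?_
  have hinj : Set.InjOn (fun j : ℕ => x i + (j : ℤ)) (Finset.range k) := by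
    intro a _ b _ hab
    simpa using hab
  calc ∑ j ∈ Finset.range k, forwardGrad f (Function.update x i (x i + j))
      = ∑ t ∈ (Finset.range k).image (fun j : ℕ => x i + (j : ℤ)),
          forwardGrad f (Function.update x i t) := by
        rw [Finset.sum_image hinj]
    _ ≤ _ := ENNReal.sum_le_tsum _

/-- The discrete Gagliardo–Nirenberg–Sobolev inequality in `L¹`. -/
theorem sum_rpow_le_sum_grad (hd : 2 ≤ d) {f : Lattice d → ℝ} {S B : Finset (Lattice d)}
    (hf : ∀ x ∉ S, f x = 0) (hSB : ∀ x ∈ S, x ∈ B)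
    (hB : ∀ x ∈ S, ∀ y, (latticeGraph d).Adj x y → y ∈ B) :
    ∑ x ∈ B, |f x| ^ ((d : ℝ) / (d - 1))
      ≤ (∑ x ∈ B, ∑ y ∈ B with (latticeGraph d).Adj x y, |f y - f x|) ^ ((d : ℝ) / (d - 1)) := by
  have hd1 : (1 : ℝ) < d := by exact_mod_cast (by omega : 1 < d)
  have hd0 : (0 : ℝ) < d - 1 := by linarith
  have hconj : Real.HolderConjugate (Fintype.card (Fin d) : ℝ) ((d : ℝ) / (d - 1)) := by
    rw [Fintype.card_fin]
    exact Real.HolderConjugate.conjExponent hd1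
  -- The grid-lines inequality of Gagliardo and Nirenberg, with counting measure on each factor: the
  -- sum over all points of the product of powers of the line integrals is controlled by a power of
  -- the total gradient.
  have key := lintegral_prod_lintegral_pow_le (fun _ : Fin d => (Measure.count : Measure ℤ)) hconj
    (f := forwardGrad f) (measurable_of_countable _)
  rw [pi_count_eq, lintegral_count, lintegral_count, Fintype.card_fin] at key
  -- Each forward edge with nonzero increment touches the support `S`, so both its endpoints lie in
  -- `B` and it occurs among the ordered pairs on the right.
  have hG : ∑' x, forwardGrad f x
      ≤ ENNReal.ofReal (∑ x ∈ B, ∑ y ∈ B with (latticeGraph d).Adj x y, |f y - f x|) := by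
    have hadj : ∀ (x : Lattice d) i, (latticeGraph d).Adj x (Function.update x i (x i + 1)) :=
      fun x i => by simpa using adj_update x i (x i)
    have hmem : ∀ x i, f (Function.update x i (x i + 1)) - f x ≠ 0 →
        x ∈ B ∧ Function.update x i (x i + 1) ∈ B := by
      intro x i h
      by_cases hx : x ∈ S
      · exact ⟨hSB x hx, hB x hx _ (hadj x i)⟩
      · by_cases hy : Function.update x i (x i + 1) ∈ S
        · exact ⟨hB _ hy _ (hadj x i).symm, hSB _ hy⟩
        · exact absurd (by rw [hf _ hx, hf _ hy, sub_zero]) h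
    rw [tsum_eq_sum (s := B), ENNReal.ofReal_sum_of_nonneg
      (fun x _ => Finset.sum_nonneg fun y _ => abs_nonneg _)]
    · refine Finset.sum_le_sum fun x _ => ?_
      rw [ENNReal.ofReal_sum_of_nonneg (fun y _ => abs_nonneg _), forwardGrad]
      have hinj : Set.InjOn (fun i : Fin d => Function.update x i (x i + 1))
          ((Finset.univ.filter fun i => f (Function.update x i (x i + 1)) - f x ≠ 0 :
            Finset (Fin d)) : Set (Fin d)) := by
        intro i _ j _ hij
        by_contra hne
        have := congrFun hij i
        simp [hne] at this
      rw [← Finset.sum_filter_of_ne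
        (p := fun i => f (Function.update x i (x i + 1)) - f x ≠ 0) (by
          intro i _ h h'
          simp [h'] at h),
        ← Finset.sum_image (f := fun y => ENNReal.ofReal |f y - f x|) hinj]
      refine Finset.sum_le_sum_of_subset ?_
      intro y hy
      obtain ⟨i, hi, rfl⟩ := Finset.mem_image.1 hy
      exact Finset.mem_filter.2 ⟨(hmem x i (Finset.mem_filter.1 hi).2).2, hadj x i⟩
    · intro x hx
      rw [forwardGrad]
      refine Finset.sum_eq_zero fun i _ => ?_
      by_contra h
      exact hx (hmem x i fun h' => h (by simp [h'])).1
  have hp0 : (0 : ℝ) ≤ (d : ℝ) / (d - 1) := by positivity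
  have hlow : ∀ x, ENNReal.ofReal (|f x| ^ ((d : ℝ) / (d - 1)))
      ≤ ∏ i, (∫⁻ t, forwardGrad f (Function.update x i t) ∂Measure.count)
        ^ ((1 : ℝ) / (d - 1 : ℝ)) := by
    intro x
    calc ENNReal.ofReal (|f x| ^ ((d : ℝ) / (d - 1)))
        = ∏ _i : Fin d, ENNReal.ofReal |f x| ^ ((1 : ℝ) / (d - 1 : ℝ)) := by
          rw [Finset.prod_const, Finset.card_univ, Fintype.card_fin, ← ENNReal.rpow_natCast,
            ← ENNReal.rpow_mul, ← ENNReal.ofReal_rpow_of_nonneg (abs_nonneg _) hp0]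
          congr 1
          field_simp
      _ ≤ _ := Finset.prod_le_prod' fun i _ =>
          ENNReal.rpow_le_rpow (ofReal_abs_le_lintegral hf x i) (by positivity)
  have hfin : ENNReal.ofReal (∑ x ∈ B, |f x| ^ ((d : ℝ) / (d - 1)))
      ≤ ENNReal.ofReal ((∑ x ∈ B, ∑ y ∈ B with (latticeGraph d).Adj x y, |f y - f x|)
        ^ ((d : ℝ) / (d - 1))) := by
    rw [ENNReal.ofReal_sum_of_nonneg (fun x _ => by positivity),
      ← ENNReal.ofReal_rpow_of_nonneg
        (Finset.sum_nonneg fun x _ => Finset.sum_nonneg fun y _ => abs_nonneg _) hp0]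
    calc _ ≤ ∑ x ∈ B, ∏ i, (∫⁻ t, forwardGrad f (Function.update x i t) ∂Measure.count)
            ^ ((1 : ℝ) / (d - 1 : ℝ)) := Finset.sum_le_sum fun x _ => hlow x
      _ ≤ _ := ENNReal.sum_le_tsum _
      _ ≤ _ := key
      _ ≤ _ := ENNReal.rpow_le_rpow hG hp0
  rwa [ENNReal.ofReal_le_ofReal_iff] at hfin
  exact Real.rpow_nonneg
    (Finset.sum_nonneg fun x _ => Finset.sum_nonneg fun y _ => abs_nonneg _) _

/-- The tangent inequality for the convex function `x ↦ x ^ k`. -/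
theorem mul_rpow_mul_sub_le {k a b : ℝ} (hk : 1 ≤ k) (ha : 0 ≤ a) (hb : 0 < b) :
    k * b ^ (k - 1) * (a - b) ≤ a ^ k - b ^ k := by
  have h := one_add_mul_self_le_rpow_one_add (s := a / b - 1) (p := k)
    (by have : 0 ≤ a / b := by positivity
        linarith) hk
  rw [add_sub_cancel, Real.div_rpow ha hb.le, le_div_iff₀ (by positivity)] at h
  have e : b ^ k = b ^ (k - 1) * b := by
    rw [Real.rpow_sub_one hb.ne']; field_simp
  have e2 : (1 + k * (a / b - 1)) * b ^ k = b ^ k + k * b ^ (k - 1) * (a - b) := by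
    rw [e]; field_simp
  linarith

/-- Convexity gives the tangent bound with the derivative at the larger of the two points; adding
the other term makes the bound symmetric. -/
theorem abs_rpow_sub_rpow_le {k a b : ℝ} (hk : 1 ≤ k) (ha : 0 ≤ a) (hb : 0 ≤ b) :
    |b ^ k - a ^ k| ≤ k * (a ^ (k - 1) + b ^ (k - 1)) * |b - a| := by
  have main : ∀ {a b : ℝ}, 0 ≤ a → a ≤ b →
      |b ^ k - a ^ k| ≤ k * (a ^ (k - 1) + b ^ (k - 1)) * |b - a| := by
    intro a b ha hab
    rw [abs_of_nonneg (sub_nonneg.2 (Real.rpow_le_rpow ha hab (by linarith))),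
      abs_of_nonneg (sub_nonneg.2 hab)]
    rcases (ha.trans hab).eq_or_lt with hb | hb
    · have : a = b := le_antisymm hab (hb ▸ ha)
      simp [this]
    · have h := mul_rpow_mul_sub_le hk ha hb
      have : 0 ≤ k * a ^ (k - 1) * (b - a) :=
        mul_nonneg (mul_nonneg (by linarith) (by positivity)) (sub_nonneg.2 hab)
      linarith
  rcases le_total a b with h | h
  · exact main ha h
  · have := main hb h
    rwa [abs_sub_comm, abs_sub_comm a b, add_comm] at this

theorem sum_sum_adj_comm (B : Finset (Lattice d)) (F : Lattice d → Lattice d → ℝ) :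
    ∑ x ∈ B, ∑ y ∈ B with (latticeGraph d).Adj x y, F x y
      = ∑ x ∈ B, ∑ y ∈ B with (latticeGraph d).Adj x y, F y x := by
  simp only [Finset.sum_filter]
  rw [Finset.sum_comm]
  simp only [(latticeGraph d).adj_comm]

/-- Cauchy–Schwarz with the conductances as weights. -/
theorem sq_sum_sum_adj_le {ω : Environment d} (hω : ∀ e, 0 < ω e) (B : Finset (Lattice d))
    (F : Lattice d → Lattice d → ℝ) (g : Lattice d → ℝ) :
    (∑ x ∈ B, ∑ y ∈ B with (latticeGraph d).Adj x y, g x * |F x y|) ^ 2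
      ≤ (∑ x ∈ B, ∑ y ∈ B, weight ω x y * F x y ^ 2)
        * ∑ x ∈ B, nuMeasure ω x * g x ^ 2 := by
  have h := Finset.sum_sq_le_sum_mul_sum_of_sq_le_mul (B.sigma fun x =>
      {y ∈ B | (latticeGraph d).Adj x y})
    (r := fun p => g p.1 * |F p.1 p.2|) (f := fun p => weight ω p.1 p.2 * F p.1 p.2 ^ 2)
    (g := fun p => (weight ω p.1 p.2)⁻¹ * g p.1 ^ 2)
    (fun p _ => mul_nonneg (weight_nonneg _ _ _) (sq_nonneg _))
    (fun p _ => mul_nonneg (inv_nonneg.2 (weight_nonneg _ _ _)) (sq_nonneg _))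
    (by
      intro p hp
      have hpos := weight_pos hω (Finset.mem_filter.1 (Finset.mem_sigma.1 hp).2).2
      rw [mul_pow, sq_abs]
      field_simp
      exact le_rfl)
  simp only [Finset.sum_sigma] at h
  refine h.trans ?_
  have h1 : ∑ x ∈ B, ∑ y ∈ B with (latticeGraph d).Adj x y, weight ω x y * F x y ^ 2
      ≤ ∑ x ∈ B, ∑ y ∈ B, weight ω x y * F x y ^ 2 :=
    Finset.sum_le_sum fun x _ => (sum_weight_mul ω x B _).ge
  have h2 : ∑ x ∈ B, ∑ y ∈ B with (latticeGraph d).Adj x y, (weight ω x y)⁻¹ * g x ^ 2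
      ≤ ∑ x ∈ B, nuMeasure ω x * g x ^ 2 := by
    refine Finset.sum_le_sum fun x _ => ?_
    rw [← Finset.sum_mul]
    exact mul_le_mul_of_nonneg_right (sum_inv_weight_le_nuMeasure ω x B) (sq_nonneg _)
  refine mul_le_mul h1 h2 (Finset.sum_nonneg fun x _ => Finset.sum_nonneg fun y _ => ?_)
    (Finset.sum_nonneg fun x _ => Finset.sum_nonneg fun y _ => ?_)
  · exact mul_nonneg (inv_nonneg.2 (weight_nonneg _ _ _)) (sq_nonneg _)
  · exact mul_nonneg (weight_nonneg _ _ _) (sq_nonneg _)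

/-- The Sobolev inequality for a Dirichlet form with conductances whose inverse is in `ℓ^q`. -/
theorem weighted_sobolev (hd : 2 ≤ d) {q s : ℝ} (hq : 1 < q)
    (hs : s⁻¹ = 1 / 2 + 1 / (2 * q) - 1 / d) :
    ∃ C : ℝ, 0 < C ∧ ∀ ω : Environment d, (∀ e, 0 < ω e) → ∀ (f : Lattice d → ℝ)
      (S B : Finset (Lattice d)), (∀ x, 0 ≤ f x) → (∀ x ∉ S, f x = 0) → (∀ x ∈ S, x ∈ B) →
      (∀ x ∈ S, ∀ y, (latticeGraph d).Adj x y → y ∈ B) →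
      (∑ x ∈ B, f x ^ s) ^ (2 / s) ≤ C * (∑ x ∈ B, nuMeasure ω x ^ q) ^ (1 / q)
        * ∑ x ∈ B, ∑ y ∈ B, weight ω x y * (f y - f x) ^ 2 := by
  have hd2 : (2 : ℝ) ≤ d := by exact_mod_cast hd
  have hq0 : 0 < q := by linarith
  have hs0 : 0 < s := by
    rw [← inv_pos, hs]
    have : (1 : ℝ) / d ≤ 1 / 2 := one_div_le_one_div_of_le (by norm_num) hd2
    have : 0 < 1 / (2 * q) := by positivity
    linarith
  have hsm : s * (1 / 2 + 1 / (2 * q) - 1 / d) = 1 := by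
    rw [← hs]; exact mul_inv_cancel₀ hs0.ne'
  -- The `L¹` inequality is applied to `f ^ k`. With this `k` one has `k * d / (d - 1) = s` and `2
  -- (k - 1) * q / (q - 1) = s`, so the left side and the Hölder factor are powers of the same sum
  -- `Φ`.
  set k : ℝ := s * (d - 1) / d with hkdef
  have hk2 : 2 * (k - 1) = s * (1 - 1 / q) := by
    rw [hkdef]; field_simp; field_simp at hsm; linarith
  have hq1 : 0 < 1 - 1 / q := by
    rw [sub_pos, div_lt_one hq0]; exact hq
  have hk : 1 ≤ k := by nlinarith [mul_pos hs0 hq1]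
  refine ⟨4 * k ^ 2, by positivity, ?_⟩
  intro ω hω f S B hf0 hfS hSB hBS
  set Φ := ∑ x ∈ B, f x ^ s with hΦ
  set E := ∑ x ∈ B, ∑ y ∈ B, weight ω x y * (f y - f x) ^ 2 with hE
  set N := (∑ x ∈ B, nuMeasure ω x ^ q) ^ (1 / q) with hN
  have hE0 : 0 ≤ E := Finset.sum_nonneg fun x _ => Finset.sum_nonneg fun y _ =>
    mul_nonneg (weight_nonneg _ _ _) (sq_nonneg _)
  have hN0 : 0 ≤ N := Real.rpow_nonneg (Finset.sum_nonneg fun x _ =>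
    Real.rpow_nonneg (nuMeasure_nonneg _ _) _) _
  have hΦ0 : 0 ≤ Φ := Finset.sum_nonneg fun x _ => Real.rpow_nonneg (hf0 x) _
  -- At the end a power of `Φ` is cancelled, which needs `Φ > 0`.
  rcases hΦ0.eq_or_lt with h0 | hΦpos
  · rw [← h0, Real.zero_rpow (by positivity)]
    positivity
  have hsob := sum_rpow_le_sum_grad hd (f := fun x => f x ^ k) (S := S) (B := B)
    (fun x hx => by simp only [hfS x hx]; exact Real.zero_rpow (by linarith)) hSB hBS
  have hdd : (0 : ℝ) < d - 1 := by linarith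
  have e1 : ∑ x ∈ B, |f x ^ k| ^ ((d : ℝ) / (d - 1)) = Φ := by
    refine Finset.sum_congr rfl fun x _ => ?_
    rw [abs_of_nonneg (Real.rpow_nonneg (hf0 x) _), ← Real.rpow_mul (hf0 x)]
    congr 1
    rw [hkdef]; field_simp
  simp only [e1] at hsob
  set G := ∑ x ∈ B, ∑ y ∈ B with (latticeGraph d).Adj x y, |f y ^ k - f x ^ k| with hG
  have hG0 : 0 ≤ G := Finset.sum_nonneg fun x _ => Finset.sum_nonneg fun y _ => abs_nonneg _
  set J := ∑ x ∈ B, ∑ y ∈ B with (latticeGraph d).Adj x y, f x ^ (k - 1) * |f y - f x| with hJ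
  have hJ0 : 0 ≤ J := Finset.sum_nonneg fun x _ => Finset.sum_nonneg fun y _ =>
    mul_nonneg (Real.rpow_nonneg (hf0 x) _) (abs_nonneg _)
  -- The two terms of the increment bound have equal sums, by exchanging the roles of the endpoints.
  have hGJ : G ≤ 2 * k * J := by
    have h1 : G ≤ ∑ x ∈ B, ∑ y ∈ B with (latticeGraph d).Adj x y,
        k * (f x ^ (k - 1) * |f y - f x| + f y ^ (k - 1) * |f y - f x|) := by
      refine Finset.sum_le_sum fun x _ => Finset.sum_le_sum fun y _ => ?_
      have := abs_rpow_sub_rpow_le hk (hf0 x) (hf0 y)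
      linarith
    have h2 : ∑ x ∈ B, ∑ y ∈ B with (latticeGraph d).Adj x y, f y ^ (k - 1) * |f y - f x|
        = J := by
      rw [sum_sum_adj_comm]
      simp only [abs_sub_comm (f _) (f _), hJ]
    have h3 : ∑ x ∈ B, ∑ y ∈ B with (latticeGraph d).Adj x y,
        k * (f x ^ (k - 1) * |f y - f x| + f y ^ (k - 1) * |f y - f x|) = k * (J + J) := by
      nth_rw 2 [← h2]
      simp only [hJ, Finset.mul_sum, mul_add, Finset.sum_add_distrib]
    linarith
  have hJE : J ^ 2 ≤ E * (N * Φ ^ (1 - 1 / q)) := by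
    refine (sq_sum_sum_adj_le hω B (fun x y => f y - f x) (fun x => f x ^ (k - 1))).trans ?_
    refine mul_le_mul_of_nonneg_left ?_ hE0
    have hconj : q.HolderConjugate (q / (q - 1)) := Real.HolderConjugate.conjExponent hq
    have h := Real.inner_le_Lp_mul_Lq_of_nonneg B hconj (f := nuMeasure ω)
      (g := fun x => (f x ^ (k - 1)) ^ 2) (fun x _ => nuMeasure_nonneg _ _)
      (fun x _ => sq_nonneg _)
    refine h.trans_eq ?_
    have hq2 : q - 1 ≠ 0 := by linarith
    congr 2
    · refine Finset.sum_congr rfl fun x _ => ?_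
      rw [← Real.rpow_natCast, ← Real.rpow_mul (hf0 x), ← Real.rpow_mul (hf0 x)]
      congr 1
      push_cast
      rw [mul_comm (k - 1) 2, hk2]
      field_simp
    · field_simp
  have hΦG : Φ ^ (((d : ℝ) - 1) / d) ≤ G := by
    have := Real.rpow_le_rpow hΦ0 hsob (z := ((d : ℝ) - 1) / d) (by positivity)
    rwa [← Real.rpow_mul hG0, show (d : ℝ) / (d - 1) * ((d - 1) / d) = 1 by field_simp,
      Real.rpow_one] at this
  have hsq : (Φ ^ (((d : ℝ) - 1) / d)) ^ 2 ≤ 4 * k ^ 2 * (E * (N * Φ ^ (1 - 1 / q))) := by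
    calc (Φ ^ (((d : ℝ) - 1) / d)) ^ 2 ≤ (2 * k * J) ^ 2 :=
          pow_le_pow_left₀ (by positivity) (hΦG.trans hGJ) 2
      _ = 4 * k ^ 2 * J ^ 2 := by ring
      _ ≤ _ := by gcongr
  have e2 : (Φ ^ (((d : ℝ) - 1) / d)) ^ 2 = Φ ^ (2 / s) * Φ ^ (1 - 1 / q) := by
    rw [← Real.rpow_natCast, ← Real.rpow_mul hΦ0, ← Real.rpow_add hΦpos]
    congr 1
    rw [div_eq_mul_inv 2 s, hs]
    push_cast
    field_simp
    ring
  rw [e2] at hsq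
  have hp : 0 < Φ ^ (1 - 1 / q) := by positivity
  refine le_of_mul_le_mul_right ?_ hp
  calc _ ≤ _ := hsq
    _ = _ := by ring

/-! ### A weighted Poincaré inequality in `L¹` -/

/-- The weighted increment of `f` over the edge leaving `z` in the direction `k`. -/
noncomputable def edgeIncrement (e f : Lattice d → ℝ) (k : Fin d) (z : Lattice d) : ℝ :=
  e z * e (Function.update z k (z k + 1)) * |f (Function.update z k (z k + 1)) - f z|

theorem edgeIncrement_nonneg {e f : Lattice d → ℝ} (he : ∀ x, 0 ≤ e x) (k : Fin d)
    (z : Lattice d) : 0 ≤ edgeIncrement e f k z :=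
  mul_nonneg (mul_nonneg (he _) (he _)) (abs_nonneg _)

theorem abs_sub_le_sum_Ico (φ : ℤ → ℝ) {a b : ℤ} (h : a ≤ b) :
    |φ a - φ b| ≤ ∑ t ∈ Finset.Ico a b, |φ (t + 1) - φ t| := by
  induction b, h using Int.leInduction with
  | base => simp
  | succ b hb ih =>
    have : Finset.Ico a (b + 1) = insert b (Finset.Ico a b) := by
      ext t
      simp only [Finset.mem_Ico, Finset.mem_insert]
      omega
    rw [this, Finset.sum_insert (by simp)]
    have := abs_sub_le (φ a) (φ b) (φ (b + 1))
    rw [abs_sub_comm (φ b)] at this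
    linarith

/-- Between `a` and `b` the line stays within distance `m` of `o`, so both endpoints of each edge
used have weight at least `c`. The bound is then enlarged to the full line, which no longer depends
on `a` and `b`. -/
theorem sq_mul_abs_sub_le_sum_line {e f : Lattice d → ℝ} (he : ∀ x, 0 ≤ e x) {c : ℝ}
    (hc : 0 ≤ c) (k : Fin d) (z : Lattice d) {o a b m R : ℤ} (ha : |a - o| ≤ m)
    (hb : |b - o| ≤ m) (hm : m ≤ R) (hec : ∀ t, |t - o| ≤ m → c ≤ e (Function.update z k t)) :
    c ^ 2 * |f (Function.update z k a) - f (Function.update z k b)|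
      ≤ ∑ t ∈ Finset.Icc (o - R) (o + R), edgeIncrement e f k (Function.update z k t) := by
  have main : ∀ {a b : ℤ}, |a - o| ≤ m → |b - o| ≤ m → a ≤ b →
      c ^ 2 * |f (Function.update z k a) - f (Function.update z k b)|
      ≤ ∑ t ∈ Finset.Icc (o - R) (o + R), edgeIncrement e f k (Function.update z k t) := by
    intro a b ha hb hab
    rw [abs_le] at ha hb
    calc c ^ 2 * |f (Function.update z k a) - f (Function.update z k b)|
        ≤ c ^ 2 * ∑ t ∈ Finset.Ico a b,
            |f (Function.update z k (t + 1)) - f (Function.update z k t)| := by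
          gcongr
          exact abs_sub_le_sum_Ico (fun t => f (Function.update z k t)) hab
      _ ≤ ∑ t ∈ Finset.Ico a b, edgeIncrement e f k (Function.update z k t) := by
          rw [Finset.mul_sum]
          refine Finset.sum_le_sum fun t ht => ?_
          rw [Finset.mem_Ico] at ht
          simp only [edgeIncrement, Function.update_self, Function.update_idem]
          refine mul_le_mul_of_nonneg_right ?_ (abs_nonneg _)
          rw [pow_two]
          exact mul_le_mul (hec t (abs_le.2 ⟨by omega, by omega⟩))
            (hec _ (abs_le.2 ⟨by omega, by omega⟩)) hc (he _)
      _ ≤ _ := by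
          refine Finset.sum_le_sum_of_subset_of_nonneg ?_ fun _ _ _ => edgeIncrement_nonneg he _ _
          intro t ht
          rw [Finset.mem_Ico] at ht
          rw [Finset.mem_Icc]
          omega
  rcases le_total a b with h | h
  · exact main ha hb h
  · rw [abs_sub_comm]
    exact main hb ha h

/-- The sum of the weighted increments of `f` over all coordinate lines through the points which
mix coordinates of `x` and `y`. -/
noncomputable def lineSum (o : Lattice d) (R : ℕ) (e f : Lattice d → ℝ) (x y : Lattice d) : ℝ :=
  ∑ D : Finset (Fin d), ∑ k, ∑ t ∈ Finset.Icc (o k - R) (o k + R),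
    edgeIncrement e f k (Function.update (D.piecewise y x) k t)

theorem sum_line_le_lineSum {o : Lattice d} {R : ℕ} {e f : Lattice d → ℝ} (he : ∀ x, 0 ≤ e x)
    (x y : Lattice d) (D : Finset (Fin d)) (k : Fin d) :
    ∑ t ∈ Finset.Icc (o k - R) (o k + R),
      edgeIncrement e f k (Function.update (D.piecewise y x) k t) ≤ lineSum o R e f x y := by
  have h1 : ∀ (D : Finset (Fin d)) (k : Fin d), 0 ≤ ∑ t ∈ Finset.Icc (o k - R) (o k + R),
      edgeIncrement e f k (Function.update (D.piecewise y x) k t) :=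
    fun D k => Finset.sum_nonneg fun t _ => edgeIncrement_nonneg he _ _
  calc _ ≤ ∑ k, ∑ t ∈ Finset.Icc (o k - R) (o k + R),
          edgeIncrement e f k (Function.update (D.piecewise y x) k t) :=
        Finset.single_le_sum (f := fun k => ∑ t ∈ Finset.Icc (o k - R) (o k + R),
          edgeIncrement e f k (Function.update (D.piecewise y x) k t))
          (fun k _ => h1 D k) (Finset.mem_univ k)
    _ ≤ _ := Finset.single_le_sum (f := fun D : Finset (Fin d) => ∑ k,
          ∑ t ∈ Finset.Icc (o k - R) (o k + R),
          edgeIncrement e f k (Function.update (D.piecewise y x) k t))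
          (fun D _ => Finset.sum_nonneg fun k _ => h1 D k) (Finset.mem_univ D)

/-- The coordinates in `D` are moved from those of `x` to those of `y` one at a time. No
intermediate point is farther from `o` than `x` in any coordinate, so monotonicity keeps the weight
at least `e x` along the whole path. -/
theorem sq_mul_abs_sub_piecewise_le {o : Lattice d} {R : ℕ} {e f : Lattice d → ℝ}
    (he : ∀ x, 0 ≤ e x) (hmono : ∀ x z, (∀ i, |z i - o i| ≤ |x i - o i|) → e x ≤ e z)
    {x y : Lattice d} (hx : x ∈ box o R) (D : Finset (Fin d))
    (hD : ∀ j ∈ D, |y j - o j| ≤ |x j - o j|) :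
    e x ^ 2 * |f x - f (D.piecewise y x)| ≤ D.card * lineSum o R e f x y := by
  induction D using Finset.induction_on with
  | empty => simp
  | insert k D hk ih =>
    rw [Finset.card_insert_of_notMem hk, Finset.piecewise_insert]
    have ih := ih fun j hj => hD j (Finset.mem_insert_of_mem hj)
    have hkx : (D.piecewise y x) k = x k := Finset.piecewise_eq_of_notMem _ _ _ hk
    have hstep := sq_mul_abs_sub_le_sum_line (f := f) he (he x) k (D.piecewise y x) (o := o k)
      (a := x k) (b := y k) (m := |x k - o k|) (R := R) le_rfl (hD k (Finset.mem_insert_self k D))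
      (mem_box.1 hx k) (by
        intro t ht
        refine hmono _ _ fun i => ?_
        rcases eq_or_ne i k with rfl | hik
        · simpa using ht
        · rw [Function.update_of_ne hik]
          by_cases hi : i ∈ D
          · rw [Finset.piecewise_eq_of_mem _ _ _ hi]
            exact hD i (Finset.mem_insert_of_mem hi)
          · rw [Finset.piecewise_eq_of_notMem _ _ _ hi])
    have hupd : Function.update (D.piecewise y x) k (x k) = D.piecewise y x := by
      rw [← hkx, Function.update_eq_self]
    rw [hupd] at hstep
    have h2 := sum_line_le_lineSum (o := o) (R := R) (f := f) he x y D k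
    push_cast
    have h3 := mul_le_mul_of_nonneg_left (abs_sub_le (f x) (f (D.piecewise y x))
      (f (Function.update (D.piecewise y x) k (y k)))) (sq_nonneg (e x))
    linarith

/-- Exchanging the coordinates in `D` between `x` and `y` is an involution of the square of the box,
and it turns the mixed point into the first component of the pair. -/
theorem sum_box_piecewise (o : Lattice d) (R : ℕ) (D : Finset (Fin d)) (h : Lattice d → ℝ) :
    ∑ x ∈ box o R, ∑ y ∈ box o R, h (D.piecewise y x)
      = (box o R).card * ∑ x ∈ box o R, h x := by
  have h1 : ∑ x ∈ box o R, ∑ y ∈ box o R, h (D.piecewise y x)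
      = ∑ x ∈ box o R, ∑ y ∈ box o R, h x := by
    rw [← Finset.sum_product', ← Finset.sum_product']
    have hmem : ∀ x y : Lattice d, x ∈ box o R → y ∈ box o R → D.piecewise y x ∈ box o R := by
      intro x y hx hy
      rw [mem_box] at *
      intro i
      by_cases hi : i ∈ D
      · simpa [hi] using hy i
      · simpa [hi] using hx i
    refine Finset.sum_bij' (i := fun p _ => (D.piecewise p.2 p.1, D.piecewise p.1 p.2))
      (j := fun p _ => (D.piecewise p.2 p.1, D.piecewise p.1 p.2)) ?_ ?_ ?_ ?_ ?_
    · intro p hp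
      rw [Finset.mem_product] at *
      exact ⟨hmem _ _ hp.1 hp.2, hmem _ _ hp.2 hp.1⟩
    · intro p hp
      rw [Finset.mem_product] at *
      exact ⟨hmem _ _ hp.1 hp.2, hmem _ _ hp.2 hp.1⟩
    · intro p _
      refine Prod.ext ?_ ?_ <;> funext i <;> by_cases hi : i ∈ D <;> simp [hi]
    · intro p _
      refine Prod.ext ?_ ?_ <;> funext i <;> by_cases hi : i ∈ D <;> simp [hi]
    · intro p _
      rfl
  rw [h1]
  simp [Finset.mul_sum]

/-- Exchanging the `k`-th coordinate of `x` with `t` is an involution of the product of the box with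
the interval. -/
theorem sum_box_update (o : Lattice d) (R : ℕ) (k : Fin d) (h : Lattice d → ℝ) :
    ∑ x ∈ box o R, ∑ t ∈ Finset.Icc (o k - R) (o k + R), h (Function.update x k t)
      = (2 * R + 1) * ∑ x ∈ box o R, h x := by
  have h1 : ∑ x ∈ box o R, ∑ t ∈ Finset.Icc (o k - R) (o k + R), h (Function.update x k t)
      = ∑ x ∈ box o R, ∑ _t ∈ Finset.Icc (o k - R) (o k + R), h x := by
    rw [← Finset.sum_product', ← Finset.sum_product']
    have hmem : ∀ p ∈ box o R ×ˢ Finset.Icc (o k - (R : ℤ)) (o k + R),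
        (Function.update p.1 k p.2, p.1 k) ∈ box o R ×ˢ Finset.Icc (o k - (R : ℤ)) (o k + R) := by
      intro p hp
      rw [Finset.mem_product, mem_box, Finset.mem_Icc] at *
      refine ⟨fun i => ?_, ?_⟩
      · rcases eq_or_ne i k with rfl | hik
        · simp only [Function.update_self, abs_le]
          omega
        · simpa [hik] using hp.1 i
      · have := abs_le.1 (hp.1 k)
        dsimp only
        omega
    refine Finset.sum_bij' (i := fun p _ => (Function.update p.1 k p.2, p.1 k))
      (j := fun p _ => (Function.update p.1 k p.2, p.1 k)) hmem hmem ?_ ?_ ?_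
    · intro p _; simp
    · intro p _; simp
    · intro p _; rfl
  rw [h1]
  simp only [Finset.sum_const, Int.card_Icc, nsmul_eq_mul, ← Finset.mul_sum]
  congr 1
  have : (o k + (R : ℤ) + 1 - (o k - R)).toNat = 2 * R + 1 := by omega
  rw [this]
  push_cast
  ring

theorem sum_box_lineSum (o : Lattice d) (R : ℕ) (e f : Lattice d → ℝ) :
    ∑ x ∈ box o R, ∑ y ∈ box o R, lineSum o R e f x y
      = 2 ^ d * (2 * R + 1) ^ (d + 1) * ∑ x ∈ box o R, ∑ k, edgeIncrement e f k x := by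
  have h1 : ∀ (D : Finset (Fin d)) (k : Fin d),
      ∑ x ∈ box o R, ∑ y ∈ box o R, ∑ t ∈ Finset.Icc (o k - R) (o k + R),
        edgeIncrement e f k (Function.update (D.piecewise y x) k t)
      = (2 * R + 1) ^ (d + 1) * ∑ x ∈ box o R, edgeIncrement e f k x := by
    intro D k
    rw [sum_box_piecewise o R D (fun z => ∑ t ∈ Finset.Icc (o k - R) (o k + R),
      edgeIncrement e f k (Function.update z k t)), sum_box_update, card_box]
    push_cast
    ring
  calc _ = ∑ D : Finset (Fin d), ∑ k, ∑ x ∈ box o R, ∑ y ∈ box o R,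
        ∑ t ∈ Finset.Icc (o k - R) (o k + R),
        edgeIncrement e f k (Function.update (D.piecewise y x) k t) := by
        rw [← Finset.sum_product']
        simp only [lineSum]
        rw [Finset.sum_comm]
        refine Finset.sum_congr rfl fun D _ => ?_
        rw [Finset.sum_comm]
        refine Finset.sum_congr rfl fun k _ => ?_
        rw [Finset.sum_product]
    _ = _ := by
        simp only [h1]
        rw [Finset.sum_const, Finset.card_univ, Fintype.card_finset, Fintype.card_fin,
          ← Finset.mul_sum, Finset.sum_comm, nsmul_eq_mul]
        push_cast
        ring

/-- A weighted Poincaré inequality in `L¹`, for weights which decrease with the distances of the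
coordinates to those of `o`. -/
theorem sum_box_poincare {o : Lattice d} {R : ℕ} {e : Lattice d → ℝ} (f : Lattice d → ℝ)
    (he : ∀ x, 0 ≤ e x) (he1 : ∀ x, e x ≤ 1)
    (hmono : ∀ x z, (∀ i, |z i - o i| ≤ |x i - o i|) → e x ≤ e z) :
    ∑ x ∈ box o R, ∑ y ∈ box o R, e x ^ 2 * e y ^ 2 * |f x - f y|
      ≤ d * 2 ^ (d + 1) * (2 * R + 1) ^ (d + 1)
        * ∑ x ∈ box o R, ∑ k, edgeIncrement e f k x := by
  have hS : ∀ x y, 0 ≤ lineSum o R e f x y := fun x y => Finset.sum_nonneg fun D _ =>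
    Finset.sum_nonneg fun k _ => Finset.sum_nonneg fun t _ => edgeIncrement_nonneg he _ _
  have key : ∀ x ∈ box o R, ∀ y ∈ box o R, e x ^ 2 * e y ^ 2 * |f x - f y|
      ≤ d * lineSum o R e f x y + d * lineSum o R e f y x := by
    intro x hx y hy
    -- With this choice the mixed point `D.piecewise y x` takes in every coordinate the value closer
    -- to `o`. Both the path from `x` and the path from `y` to it therefore only move inwards, where
    -- the weight is at least `e x` or `e y` respectively.
    let D : Finset (Fin d) := {j | |y j - o j| ≤ |x j - o j|}
    have h1 := sq_mul_abs_sub_piecewise_le (f := f) he hmono (y := y) hx D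
      (fun j hj => by simpa [D] using hj)
    have h2 := sq_mul_abs_sub_piecewise_le (f := f) he hmono (y := x) hy Dᶜ
      (fun j hj => by
        have : ¬ |y j - o j| ≤ |x j - o j| := by simpa [D] using hj
        exact (not_le.1 this).le)
    rw [Finset.piecewise_compl] at h2
    have hc : ∀ D : Finset (Fin d), (D.card : ℝ) ≤ d := fun D => by
      exact_mod_cast (Finset.card_le_univ D).trans_eq (Fintype.card_fin d)
    have h3 := h1.trans (mul_le_mul_of_nonneg_right (hc D) (hS x y))
    have h4 := h2.trans (mul_le_mul_of_nonneg_right (hc Dᶜ) (hS y x))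
    have h5 := abs_sub_le (f x) (f (D.piecewise y x)) (f y)
    rw [abs_sub_comm (f (D.piecewise y x))] at h5
    have hx1 : e x ^ 2 ≤ 1 := pow_le_one₀ (he x) (he1 x)
    have hy1 : e y ^ 2 ≤ 1 := pow_le_one₀ (he y) (he1 y)
    calc e x ^ 2 * e y ^ 2 * |f x - f y|
        ≤ e x ^ 2 * e y ^ 2 * (|f x - f (D.piecewise y x)| + |f y - f (D.piecewise y x)|) := by
          gcongr
      _ = e y ^ 2 * (e x ^ 2 * |f x - f (D.piecewise y x)|)
          + e x ^ 2 * (e y ^ 2 * |f y - f (D.piecewise y x)|) := by ring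
      _ ≤ 1 * (e x ^ 2 * |f x - f (D.piecewise y x)|)
          + 1 * (e y ^ 2 * |f y - f (D.piecewise y x)|) := by gcongr
      _ ≤ _ := by rw [one_mul, one_mul]; exact add_le_add h3 h4
  calc _ ≤ ∑ x ∈ box o R, ∑ y ∈ box o R,
        (d * lineSum o R e f x y + d * lineSum o R e f y x) :=
        Finset.sum_le_sum fun x hx => Finset.sum_le_sum fun y hy => key x hx y hy
    _ = 2 * d * ∑ x ∈ box o R, ∑ y ∈ box o R, lineSum o R e f x y := by
        simp only [Finset.sum_add_distrib, ← Finset.mul_sum]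
        rw [Finset.sum_comm (f := fun x y => lineSum o R e f y x)]
        ring
    _ = _ := by rw [sum_box_lineSum]; ring

/-- Increments carry the weight of both endpoints and so vanish unless both lie in `B`; the rest are
distinct ordered pairs of neighbours in `B`. This passes from boxes back to graph balls. -/
theorem sum_edgeIncrement_le {e : Lattice d → ℝ} (f : Lattice d → ℝ) {B Q : Finset (Lattice d)}
    (he : ∀ x, 0 ≤ e x) (heB : ∀ x ∉ B, e x = 0) :
    ∑ x ∈ Q, ∑ k, edgeIncrement e f k x
      ≤ ∑ x ∈ B, ∑ y ∈ B with (latticeGraph d).Adj x y, e x * e y * |f y - f x| := by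
  have h0 : ∀ x ∉ B, ∑ k, edgeIncrement e f k x = 0 := fun x hx =>
    Finset.sum_eq_zero fun k _ => by simp [edgeIncrement, heB x hx]
  have hnn : ∀ x, 0 ≤ ∑ k, edgeIncrement e f k x := fun x =>
    Finset.sum_nonneg fun k _ => edgeIncrement_nonneg he k x
  calc _ ≤ ∑ x ∈ B ∪ Q, ∑ k, edgeIncrement e f k x :=
        Finset.sum_le_sum_of_subset_of_nonneg Finset.subset_union_right fun x _ _ => hnn x
    _ = ∑ x ∈ B, ∑ k, edgeIncrement e f k x :=
        (Finset.sum_subset Finset.subset_union_left fun x _ hx => h0 x hx).symm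
    _ ≤ _ := by
        refine Finset.sum_le_sum fun x _ => ?_
        have hinj : Set.InjOn (fun k : Fin d => Function.update x k (x k + 1))
            ((Finset.univ.filter fun k => Function.update x k (x k + 1) ∈ B : Finset (Fin d)) :
              Set (Fin d)) := by
          intro i _ j _ hij
          by_contra hne
          have := congrFun hij i
          simp [hne] at this
        rw [← Finset.sum_filter_of_ne (p := fun k => Function.update x k (x k + 1) ∈ B) (by
          intro k _ h
          by_contra hc
          exact h (by simp [edgeIncrement, heB _ hc]))]
        simp only [edgeIncrement]
        rw [← Finset.sum_image (f := fun y => e x * e y * |f y - f x|) hinj]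
        refine Finset.sum_le_sum_of_subset_of_nonneg ?_ fun y _ _ =>
          mul_nonneg (mul_nonneg (he _) (he _)) (abs_nonneg _)
        intro y hy
        obtain ⟨k, hk, rfl⟩ := Finset.mem_image.1 hy
        exact Finset.mem_filter.2 ⟨(Finset.mem_filter.1 hk).2, by simpa using adj_update x k (x k)⟩

/-- The weighted Poincaré inequality in `L¹` with the cut-off function as weight. -/
theorem cutoff_poincare (x₀ : Lattice d) {n : ℝ} (hn : 1 ≤ n) (f : Lattice d → ℝ) :
    ∑ x ∈ ballFinset x₀ n, ∑ y ∈ ballFinset x₀ n,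
        cutoff x₀ n x ^ 2 * cutoff x₀ n y ^ 2 * |f x - f y|
      ≤ d * 2 ^ (d + 1) * (5 * n) ^ (d + 1)
        * ∑ x ∈ ballFinset x₀ n, ∑ y ∈ ballFinset x₀ n with (latticeGraph d).Adj x y,
          cutoff x₀ n x * cutoff x₀ n y * |f y - f x| := by
  have hn0 : 0 < n := by linarith
  set B := ballFinset x₀ n
  set e := cutoff x₀ n
  have he : ∀ x, 0 ≤ e x := cutoff_nonneg x₀ n
  set R := ⌈n⌉₊
  have hnR : n ≤ R := Nat.le_ceil n
  have hRn : (R : ℝ) ≤ n + 1 := (Nat.ceil_lt_add_one hn0.le).le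
  have hBQ : B ⊆ box x₀ R := ballFinset_subset_box x₀ hnR
  have heB : ∀ x ∉ B, e x = 0 := by
    intro x hx
    by_contra h
    have := dist_lt_of_cutoff_ne_zero hn0 h
    exact hx (mem_ballFinset.2 (by linarith))
  have hp := sum_box_poincare (o := x₀) (R := R) f he (fun x => cutoff_le_one x₀ x hn0) (by
    intro x z h
    refine max_le_max ?_ le_rfl
    have : ((latticeGraph d).dist x₀ z : ℝ) ≤ (latticeGraph d).dist x₀ x := by
      rw [dist_real, dist_real]
      refine Finset.sum_le_sum fun i _ => ?_
      rw [abs_sub_comm, abs_sub_comm (x₀ i : ℝ)]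
      exact_mod_cast h i
    gcongr)
  have hE := sum_edgeIncrement_le f (B := B) (Q := box x₀ R) he heB
  have hE0 : 0 ≤ ∑ x ∈ B, ∑ y ∈ B with (latticeGraph d).Adj x y, e x * e y * |f y - f x| :=
    Finset.sum_nonneg fun x _ => Finset.sum_nonneg fun y _ =>
      mul_nonneg (mul_nonneg (he _) (he _)) (abs_nonneg _)
  calc _ ≤ ∑ x ∈ box x₀ R, ∑ y ∈ box x₀ R, e x ^ 2 * e y ^ 2 * |f x - f y| := by
        refine (Finset.sum_le_sum fun x _ => Finset.sum_le_sum_of_subset_of_nonneg hBQ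
          fun y _ _ => by positivity).trans ?_
        exact Finset.sum_le_sum_of_subset_of_nonneg hBQ fun x _ _ =>
          Finset.sum_nonneg fun y _ => by positivity
    _ ≤ _ := hp
    _ ≤ d * 2 ^ (d + 1) * (5 * n) ^ (d + 1) *
        ∑ x ∈ B, ∑ y ∈ B with (latticeGraph d).Adj x y, e x * e y * |f y - f x| := by
        have h0 : 0 ≤ ∑ x ∈ box x₀ R, ∑ k, edgeIncrement e f k x :=
          Finset.sum_nonneg fun x _ => Finset.sum_nonneg fun k _ => edgeIncrement_nonneg he k x
        gcongr
        linarith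

/-! ### Summation by parts and energy estimates for subsolutions -/

/-- The unnormalised generator. -/
noncomputable def laplacian (ω : Environment d) (f : Lattice d → ℝ) (x : Lattice d) : ℝ :=
  ∑ y : (latticeGraph d).neighborSet x, weight ω x y * (f y - f x)

theorem laplacian_eq {ω : Environment d} {x : Lattice d} {B : Finset (Lattice d)}
    (hB : ∀ y, (latticeGraph d).Adj x y → y ∈ B) (f : Lattice d → ℝ) :
    laplacian ω f x = ∑ y ∈ B, weight ω x y * (f y - f x) := by
  rw [sum_weight_mul ω x B (fun y => f y - f x), laplacian,
    ← sum_neighborSet hB (fun y => weight ω x y * (f y - f x))]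

theorem speed_mul_generator {ω : Environment d} {ϑ f : Lattice d → ℝ} {x : Lattice d}
    (hx : 0 < ϑ x) : ϑ x * generator ω ϑ f x = laplacian ω f x := by
  rw [generator, laplacian]
  simp only [conductance_eq_weight]
  field_simp

/-- Summation by parts. -/
theorem sum_mul_sum_weight (ω : Environment d) (B : Finset (Lattice d)) (g f : Lattice d → ℝ) :
    2 * ∑ x ∈ B, g x * ∑ y ∈ B, weight ω x y * (f y - f x)
      = -∑ x ∈ B, ∑ y ∈ B, weight ω x y * ((g y - g x) * (f y - f x)) := by
  have h1 : ∑ x ∈ B, g x * ∑ y ∈ B, weight ω x y * (f y - f x)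
      = ∑ x ∈ B, ∑ y ∈ B, weight ω x y * (g x * (f y - f x)) := by
    refine Finset.sum_congr rfl fun x _ => ?_
    rw [Finset.mul_sum]
    exact Finset.sum_congr rfl fun y _ => by ring
  have h2 : ∑ x ∈ B, ∑ y ∈ B, weight ω x y * (g x * (f y - f x))
      = ∑ x ∈ B, ∑ y ∈ B, weight ω x y * (g y * (f x - f y)) := by
    rw [Finset.sum_comm]
    exact Finset.sum_congr rfl fun x _ => Finset.sum_congr rfl fun y _ => by
      rw [weight_symm ω y x]
  rw [two_mul, h1]
  nth_rw 2 [h2]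
  rw [← Finset.sum_add_distrib, ← Finset.sum_neg_distrib]
  refine Finset.sum_congr rfl fun x _ => ?_
  rw [← Finset.sum_add_distrib, ← Finset.sum_neg_distrib]
  exact Finset.sum_congr rfl fun y _ => by ring

/-- A bound for the errors which come from the gradient of a cut-off function. -/
theorem sum_weight_sq_sub_mul_le (ω : Environment d) (B : Finset (Lattice d))
    {η v : Lattice d → ℝ} {L : ℝ}
    (hL : ∀ x y, (latticeGraph d).Adj x y → (η x - η y) ^ 2 ≤ L) (hv : ∀ x ∈ B, 0 ≤ v x) :
    ∑ x ∈ B, ∑ y ∈ B, weight ω x y * ((η x - η y) ^ 2 * (v x * v y))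
      ≤ L * ∑ x ∈ B, muMeasure ω x * v x ^ 2 := by
  -- A negative `L` is possible only if there are no edges at all, and then both sides vanish.
  by_cases hL0 : 0 ≤ L
  swap
  · have hna : ∀ x y, ¬ (latticeGraph d).Adj x y := fun x y h =>
      hL0 ((sq_nonneg _).trans (hL x y h))
    have hμ : ∀ x, muMeasure ω x = 0 := fun x => Finset.sum_eq_zero fun y _ => absurd y.2 (hna x y)
    simp [weight_of_not_adj ω (hna _ _), hμ]
  have h1 : ∑ x ∈ B, ∑ y ∈ B, weight ω x y * ((η x - η y) ^ 2 * (v x * v y))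
      ≤ ∑ x ∈ B, ∑ y ∈ B, weight ω x y * (L * ((v x ^ 2 + v y ^ 2) / 2)) := by
    refine Finset.sum_le_sum fun x hx => Finset.sum_le_sum fun y hy => ?_
    by_cases h : (latticeGraph d).Adj x y
    · refine mul_le_mul_of_nonneg_left ?_ (weight_nonneg _ _ _)
      exact mul_le_mul (hL x y h) (by nlinarith [sq_nonneg (v x - v y)])
        (mul_nonneg (hv x hx) (hv y hy)) hL0
    · simp [weight_of_not_adj ω h]
  have h2 : ∑ x ∈ B, ∑ y ∈ B, weight ω x y * v y ^ 2 = ∑ x ∈ B, ∑ y ∈ B, weight ω x y * v x ^ 2 := by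
    rw [Finset.sum_comm]
    exact Finset.sum_congr rfl fun x _ => Finset.sum_congr rfl fun y _ => by
      rw [weight_symm ω y x]
  have h3 : ∑ x ∈ B, ∑ y ∈ B, weight ω x y * (L * ((v x ^ 2 + v y ^ 2) / 2))
      = L * ∑ x ∈ B, ∑ y ∈ B, weight ω x y * v x ^ 2 := by
    have : ∀ x y, weight ω x y * (L * ((v x ^ 2 + v y ^ 2) / 2))
        = L / 2 * (weight ω x y * v x ^ 2) + L / 2 * (weight ω x y * v y ^ 2) := by
      intros; ring
    simp only [this, Finset.sum_add_distrib, ← Finset.mul_sum, h2]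
    ring
  rw [h3] at h1
  refine h1.trans (mul_le_mul_of_nonneg_left (Finset.sum_le_sum fun x _ => ?_) hL0)
  rw [← Finset.sum_mul]
  exact mul_le_mul_of_nonneg_right (sum_weight_le_muMeasure ω x B) (sq_nonneg _)

/-- The Caccioppoli inequality for a fixed time. -/
theorem caccioppoli {ω : Environment d} {ϑ : Lattice d → ℝ} {B : Finset (Lattice d)}
    {η v v' : Lattice d → ℝ} {L : ℝ}
    (hL : ∀ x y, (latticeGraph d).Adj x y → (η x - η y) ^ 2 ≤ L) (hv : ∀ x ∈ B, 0 ≤ v x)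
    (hB : ∀ x ∈ B, η x ≠ 0 → ∀ y, (latticeGraph d).Adj x y → y ∈ B)
    (hsub : ∀ x ∈ B, η x ≠ 0 → ϑ x * v' x ≤ laplacian ω v x) :
    2 * ∑ x ∈ B, ϑ x * η x ^ 2 * (v x * v' x)
      ≤ -∑ x ∈ B, ∑ y ∈ B, weight ω x y * (η y * v y - η x * v x) ^ 2
        + L * ∑ x ∈ B, muMeasure ω x * v x ^ 2 := by
  have h1 : ∑ x ∈ B, ϑ x * η x ^ 2 * (v x * v' x)
      ≤ ∑ x ∈ B, η x ^ 2 * v x * ∑ y ∈ B, weight ω x y * (v y - v x) := by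
    refine Finset.sum_le_sum fun x hx => ?_
    by_cases h : η x = 0
    · simp [h]
    · rw [← laplacian_eq (hB x hx h)]
      have := mul_le_mul_of_nonneg_left (hsub x hx h) (mul_nonneg (sq_nonneg (η x)) (hv x hx))
      linarith
  have h2 := sum_mul_sum_weight ω B (fun x => η x ^ 2 * v x) v
  -- Discrete product rule: testing with `η² v` produces the energy of `η v` exactly, up to an error
  -- which sees only the gradient of `η`.
  have h3 : ∑ x ∈ B, ∑ y ∈ B,
        weight ω x y * ((η y ^ 2 * v y - η x ^ 2 * v x) * (v y - v x))
      = ∑ x ∈ B, ∑ y ∈ B, weight ω x y * (η y * v y - η x * v x) ^ 2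
        - ∑ x ∈ B, ∑ y ∈ B, weight ω x y * ((η x - η y) ^ 2 * (v x * v y)) := by
    simp only [← Finset.sum_sub_distrib]
    exact Finset.sum_congr rfl fun x _ => Finset.sum_congr rfl fun y _ => by ring
  have h4 := sum_weight_sq_sub_mul_le ω B hL hv
  simp only [h3] at h2
  linarith

/-- The fundamental theorem of calculus for differential inequalities. -/
theorem sub_le_integral_of_deriv_le {F F' G : ℝ → ℝ} {a b t : ℝ}
    (hF : ∀ s ∈ Icc a b, HasDerivWithinAt F (F' s) (Icc a b) s)
    (hG : ContinuousOn G (Icc a b)) (hFG : ∀ s ∈ Icc a b, F' s ≤ G s) (ht : t ∈ Icc a b) :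
    F t - F a ≤ ∫ s in a..t, G s := by
  have hsub : Icc a t ⊆ Icc a b := Icc_subset_Icc_right ht.2
  refine intervalIntegral.sub_le_integral_of_hasDeriv_right_of_le (g' := F') ht.1
    (fun s hs => ((hF s (hsub hs)).continuousWithinAt).mono hsub) (fun s hs => ?_)
    ((hG.mono hsub).integrableOn_Icc) (fun s hs => hFG s (hsub (Ioo_subset_Icc_self hs)))
  exact ((hF s (hsub (Ioo_subset_Icc_self hs))).hasDerivAt
    (Icc_mem_nhds hs.1 (hs.2.trans_le ht.2))).hasDerivWithinAt

/-- Positive subsolutions `ϑ ∂ₜ w ≤ ∑ ω (w y - w x)` on `[a, b] × B(x₀, ρ)`, where `w'` is the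
time derivative of `w`. -/
structure IsSubcaloric (ω : Environment d) (ϑ : Lattice d → ℝ) (x₀ : Lattice d) (ρ a b : ℝ)
    (w w' : ℝ → Lattice d → ℝ) : Prop where
  pos : ∀ t ∈ Icc a b, ∀ x ∈ ballFinset x₀ ρ, 0 < w t x
  cont : ∀ x ∈ ballFinset x₀ ρ, ContinuousOn (fun t => w t x) (Icc a b)
  deriv : ∀ t ∈ Icc a b, ∀ x ∈ ballFinset x₀ (ρ - 1),
    HasDerivWithinAt (fun s => w s x) (w' t x) (Icc a b) t
  le : ∀ t ∈ Icc a b, ∀ x ∈ ballFinset x₀ (ρ - 1), ϑ x * w' t x ≤ laplacian ω (w t) x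

theorem mem_ballFinset_of_adj {x₀ x y : Lattice d} {ρ : ℝ} (hx : x ∈ ballFinset x₀ (ρ - 1))
    (h : (latticeGraph d).Adj x y) : y ∈ ballFinset x₀ ρ := by
  rw [mem_ballFinset] at *
  linarith [dist_le_add_one (x₀ := x₀) h]

theorem IsSubcaloric.mono {ω : Environment d} {ϑ : Lattice d → ℝ} {x₀ : Lattice d}
    {ρ ρ' a a' b : ℝ} {w w' : ℝ → Lattice d → ℝ} (h : IsSubcaloric ω ϑ x₀ ρ a b w w')
    (hρ : ρ' ≤ ρ) (ha : a ≤ a') : IsSubcaloric ω ϑ x₀ ρ' a' b w w' where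
  pos t ht x hx := h.pos t (Icc_subset_Icc_left ha ht) x (ballFinset_mono _ hρ hx)
  cont x hx := (h.cont x (ballFinset_mono _ hρ hx)).mono (Icc_subset_Icc_left ha)
  deriv t ht x hx := (h.deriv t (Icc_subset_Icc_left ha ht) x
    (ballFinset_mono _ (by linarith) hx)).mono (Icc_subset_Icc_left ha)
  le t ht x hx := h.le t (Icc_subset_Icc_left ha ht) x (ballFinset_mono _ (by linarith) hx)

/-- Powers of subsolutions are subsolutions. -/
theorem IsSubcaloric.rpow {ω : Environment d} {ϑ : Lattice d → ℝ} {x₀ : Lattice d}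
    {ρ a b α : ℝ} {w w' : ℝ → Lattice d → ℝ} (h : IsSubcaloric ω ϑ x₀ ρ a b w w')
    (hα : 1 ≤ α) :
    IsSubcaloric ω ϑ x₀ ρ a b (fun t x => w t x ^ α)
      (fun t x => α * w t x ^ (α - 1) * w' t x) where
  pos t ht x hx := Real.rpow_pos_of_pos (h.pos t ht x hx) _
  cont x hx := (h.cont x hx).rpow_const fun t ht => Or.inr (by linarith)
  deriv t ht x hx := by
    have := (h.deriv t ht x hx).rpow_const (p := α)
      (Or.inl (h.pos t ht x (ballFinset_mono _ (by linarith) hx)).ne')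
    convert! this using 1
    ring
  le t ht x hx := by
    have hx' : x ∈ ballFinset x₀ ρ := ballFinset_mono _ (by linarith) hx
    have hwx := h.pos t ht x hx'
    have hc : 0 ≤ α * w t x ^ (α - 1) := by positivity
    calc ϑ x * (α * w t x ^ (α - 1) * w' t x) = α * w t x ^ (α - 1) * (ϑ x * w' t x) := by ring
      _ ≤ α * w t x ^ (α - 1) * laplacian ω (w t) x :=
          mul_le_mul_of_nonneg_left (h.le t ht x hx) hc
      _ ≤ laplacian ω (fun x => w t x ^ α) x := by
          rw [laplacian, laplacian, Finset.mul_sum]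
          refine Finset.sum_le_sum fun y _ => ?_
          have hy : 0 ≤ w t y := (h.pos t ht y (mem_ballFinset_of_adj hx y.2)).le
          have := mul_le_mul_of_nonneg_left (mul_rpow_mul_sub_le hα hy hwx)
            (weight_nonneg ω x y)
          linarith

/-- The energy estimate for subsolutions. -/
theorem IsSubcaloric.energy {ω : Environment d} {ϑ : Lattice d → ℝ} {x₀ : Lattice d}
    {ρ a b L : ℝ} {w w' : ℝ → Lattice d → ℝ} (h : IsSubcaloric ω ϑ x₀ ρ a b w w')
    (hϑ : ∀ x, 0 < ϑ x) {η : Lattice d → ℝ} (hη1 : ∀ x, η x ^ 2 ≤ 1)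
    (hη : ∀ x, η x ≠ 0 → x ∈ ballFinset x₀ (ρ - 1)) (hL0 : 0 ≤ L)
    (hL : ∀ x y, (latticeGraph d).Adj x y → (η x - η y) ^ 2 ≤ L) {t : ℝ} (ht : t ∈ Icc a b) :
    (t - a) * ∑ x ∈ ballFinset x₀ ρ, ϑ x * η x ^ 2 * w t x ^ 2
      + ∫ s in a..t, (s - a) * ∑ x ∈ ballFinset x₀ ρ, ∑ y ∈ ballFinset x₀ ρ,
          weight ω x y * (η y * w s y - η x * w s x) ^ 2
      ≤ ∫ s in a..b, (∑ x ∈ ballFinset x₀ ρ, ϑ x * w s x ^ 2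
          + (b - a) * L * ∑ x ∈ ballFinset x₀ ρ, muMeasure ω x * w s x ^ 2) := by
  set B := ballFinset x₀ ρ with hBdef
  have hSB : ∀ x, η x ≠ 0 → x ∈ B := fun x hx => ballFinset_mono _ (by linarith) (hη x hx)
  have hcont2 : ∀ c : Lattice d → ℝ, ContinuousOn (fun t => ∑ x ∈ B, c x * w t x ^ 2) (Icc a b) :=
    fun c => continuousOn_finsetSum _ fun x hx => continuousOn_const.mul ((h.cont x hx).pow 2)
  have hD : ContinuousOn (fun s => ∑ x ∈ B, ∑ y ∈ B,
      weight ω x y * (η y * w s y - η x * w s x) ^ 2) (Icc a b) :=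
    continuousOn_finsetSum _ fun x hx => continuousOn_finsetSum _ fun y hy =>
      continuousOn_const.mul (((continuousOn_const.mul (h.cont y hy)).sub
        (continuousOn_const.mul (h.cont x hx))).pow 2)
  set D := fun s => ∑ x ∈ B, ∑ y ∈ B, weight ω x y * (η y * w s y - η x * w s x) ^ 2
  set F := fun s => ∑ x ∈ B, ϑ x * w s x ^ 2
  set M := fun s => ∑ x ∈ B, muMeasure ω x * w s x ^ 2
  have hid : ContinuousOn (fun s : ℝ => s - a) (Icc a b) := by fun_prop
  have hF0 : ∀ s, 0 ≤ F s := fun s => Finset.sum_nonneg fun x _ =>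
    mul_nonneg (hϑ x).le (sq_nonneg _)
  have hM0 : ∀ s, 0 ≤ M s := fun s => Finset.sum_nonneg fun x _ =>
    mul_nonneg (muMeasure_nonneg ω x) (sq_nonneg _)
  -- The factor `s - a` is a cut-off in time. It removes the initial value at `a`, and its
  -- derivative is the source of the term `F` on the right.
  have hderiv : ∀ s ∈ Icc a b, HasDerivWithinAt
      (fun s => (s - a) * ∑ x ∈ B, ϑ x * η x ^ 2 * w s x ^ 2)
      (1 * (∑ x ∈ B, ϑ x * η x ^ 2 * w s x ^ 2)
        + (s - a) * ∑ x ∈ B, ϑ x * η x ^ 2 * (2 * (w s x * w' s x))) (Icc a b) s := by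
    intro s hs
    refine ((hasDerivWithinAt_id s _).sub_const a).mul (HasDerivWithinAt.fun_sum fun x _ => ?_)
    by_cases hx : η x = 0
    · simpa [hx] using hasDerivWithinAt_const s (Icc a b) (0 : ℝ)
    · have := ((h.deriv s hs x (hη x hx)).fun_pow 2).const_mul (ϑ x * η x ^ 2)
      convert! this using 1
      push_cast
      ring
  have hle : ∀ s ∈ Icc a b, 1 * (∑ x ∈ B, ϑ x * η x ^ 2 * w s x ^ 2)
        + (s - a) * ∑ x ∈ B, ϑ x * η x ^ 2 * (2 * (w s x * w' s x))
      ≤ F s + (b - a) * L * M s - (s - a) * D s := by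
    intro s hs
    have h1 : ∑ x ∈ B, ϑ x * η x ^ 2 * w s x ^ 2 ≤ F s := Finset.sum_le_sum fun x _ => by
      have := mul_le_mul_of_nonneg_left (hη1 x) (mul_nonneg (hϑ x).le (sq_nonneg (w s x)))
      linarith
    have h2 := caccioppoli (ω := ω) (ϑ := ϑ) (B := B) (η := η) (v := w s) (v' := w' s) hL
      (fun x hx => (h.pos s hs x hx).le)
      (fun x _ hx y hy => mem_ballFinset_of_adj (hη x hx) hy)
      (fun x _ hx => h.le s hs x (hη x hx))
    have h3 : ∑ x ∈ B, ϑ x * η x ^ 2 * (2 * (w s x * w' s x))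
        = 2 * ∑ x ∈ B, ϑ x * η x ^ 2 * (w s x * w' s x) := by
      rw [Finset.mul_sum]
      exact Finset.sum_congr rfl fun x _ => by ring
    rw [h3]
    have h4 := mul_le_mul_of_nonneg_left h2 (sub_nonneg.2 hs.1)
    have h5 : (s - a) * (L * M s) ≤ (b - a) * (L * M s) :=
      mul_le_mul_of_nonneg_right (by linarith [hs.2]) (mul_nonneg hL0 (hM0 s))
    have h6 : (s - a) * (-D s + L * M s) = -((s - a) * D s) + (s - a) * (L * M s) := by ring
    rw [h6] at h4
    linarith
  have hFM : ContinuousOn (fun s => F s + (b - a) * L * M s) (Icc a b) :=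
    (hcont2 ϑ).add (continuousOn_const.mul (hcont2 _))
  have key := sub_le_integral_of_deriv_le hderiv
    (G := fun s => F s + (b - a) * L * M s - (s - a) * D s) (hFM.sub (hid.mul hD)) hle ht
  have hsub : Icc a t ⊆ Icc a b := Icc_subset_Icc_right ht.2
  have hi1 : IntervalIntegrable (fun s => F s + (b - a) * L * M s) volume a t :=
    (hFM.mono hsub).intervalIntegrable_of_Icc ht.1
  have hi1' : IntervalIntegrable (fun s => F s + (b - a) * L * M s) volume a b :=
    hFM.intervalIntegrable_of_Icc (ht.1.trans ht.2)
  have hi2 : IntervalIntegrable (fun s => (s - a) * D s) volume a t :=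
    ((hid.mul hD).mono hsub).intervalIntegrable_of_Icc ht.1
  rw [intervalIntegral.integral_sub hi1 hi2] at key
  have hmono : ∫ s in a..t, (F s + (b - a) * L * M s) ≤ ∫ s in a..b, (F s + (b - a) * L * M s) :=
    intervalIntegral.integral_mono_interval le_rfl ht.1 ht.2 (by
      filter_upwards with s
      exact add_nonneg (hF0 s) (mul_nonneg (mul_nonneg (by linarith [ht.1, ht.2]) hL0) (hM0 s)))
      hi1'
  simp only [sub_self, zero_mul, sub_zero] at key
  linarith

/-! ### Exponents and one step of the Moser iteration -/

/-- The weighted Hölder inequality. -/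
theorem sum_weight_mul_le {ι : Type*} (B : Finset ι) {p P : ℝ} (hp : p.HolderConjugate P)
    {ϑ f g : ι → ℝ} (hϑ : ∀ x ∈ B, 0 ≤ ϑ x) (hf : ∀ x ∈ B, 0 ≤ f x) (hg : ∀ x ∈ B, 0 ≤ g x) :
    ∑ x ∈ B, ϑ x * (f x * g x)
      ≤ (∑ x ∈ B, ϑ x * f x ^ p) ^ (1 / p) * (∑ x ∈ B, ϑ x * g x ^ P) ^ (1 / P) := by
  have h := Real.inner_le_Lp_mul_Lq_of_nonneg B hp (f := fun x => ϑ x ^ (1 / p) * f x)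
    (g := fun x => ϑ x ^ (1 / P) * g x)
    (fun x hx => mul_nonneg (Real.rpow_nonneg (hϑ x hx) _) (hf x hx))
    (fun x hx => mul_nonneg (Real.rpow_nonneg (hϑ x hx) _) (hg x hx))
  have hsum : 1 / p + 1 / P = 1 := by
    rw [one_div, one_div]; exact hp.inv_add_inv_eq_one
  have e1 : ∀ x ∈ B, ϑ x ^ (1 / p) * f x * (ϑ x ^ (1 / P) * g x) = ϑ x * (f x * g x) := by
    intro x hx
    have : ϑ x ^ (1 / p) * ϑ x ^ (1 / P) = ϑ x := by
      rw [← Real.rpow_add' (hϑ x hx) (by rw [hsum]; norm_num), hsum, Real.rpow_one]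
    calc _ = ϑ x ^ (1 / p) * ϑ x ^ (1 / P) * (f x * g x) := by ring
      _ = _ := by rw [this]
  have e2 : ∀ {p : ℝ}, 0 < p → ∀ {f : ι → ℝ}, (∀ x ∈ B, 0 ≤ f x) →
      ∀ x ∈ B, (ϑ x ^ (1 / p) * f x) ^ p = ϑ x * f x ^ p := by
    intro p hp f hf x hx
    rw [Real.mul_rpow (Real.rpow_nonneg (hϑ x hx) _) (hf x hx), ← Real.rpow_mul (hϑ x hx),
      one_div_mul_cancel hp.ne', Real.rpow_one]
  rw [Finset.sum_congr rfl e1, Finset.sum_congr rfl (e2 hp.pos hf),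
    Finset.sum_congr rfl (e2 hp.symm.pos hg)] at h
  exact h

/-- The conditions on the finite exponents. -/
structure AdmissibleExponents (d : ℕ) (p q r : ℝ) : Prop where
  two_le : 2 ≤ d
  one_lt_p : 1 < p
  one_lt_q : 1 < q
  one_lt_r : 1 < r
  lt : 1 / r + 1 / p * (1 - 1 / r) + 1 / q < 2 / d

/-- The Sobolev exponent. -/
noncomputable def sobolevExponent (d : ℕ) (q : ℝ) : ℝ := (1 / 2 + 1 / (2 * q) - 1 / (d : ℝ))⁻¹

/-- The gain of integrability in space. -/
noncomputable def spaceGain (d : ℕ) (q r : ℝ) : ℝ := sobolevExponent d q * (1 - 1 / r) / 2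

/-- The gain of integrability in space-time in one step of the Moser iteration. -/
noncomputable def moserGain (d : ℕ) (p q r : ℝ) : ℝ := 2 - 1 / p - 1 / spaceGain d q r

/-- The Hölder conjugate of `p`. -/
noncomputable def conjExp (p : ℝ) : ℝ := p / (p - 1)

namespace AdmissibleExponents

variable {p q r : ℝ}

theorem two_le' (h : AdmissibleExponents d p q r) : (2 : ℝ) ≤ d := by exact_mod_cast h.two_le

theorem conj (h : AdmissibleExponents d p q r) : p.HolderConjugate (conjExp p) :=
  Real.HolderConjugate.conjExponent h.one_lt_p

theorem one_div_conjExp (h : AdmissibleExponents d p q r) : 1 / conjExp p = 1 - 1 / p := by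
  have := h.conj.inv_add_inv_eq_one
  rw [one_div, one_div]; linarith

theorem conjExp_pos (h : AdmissibleExponents d p q r) : 0 < conjExp p := h.conj.symm.pos

theorem inv_sobolev (_h : AdmissibleExponents d p q r) :
    (sobolevExponent d q)⁻¹ = 1 / 2 + 1 / (2 * q) - 1 / (d : ℝ) := inv_inv _

theorem sobolev_pos (h : AdmissibleExponents d p q r) : 0 < sobolevExponent d q := by
  rw [← inv_pos, h.inv_sobolev]
  have h1 : (1 : ℝ) / d ≤ 1 / 2 := one_div_le_one_div_of_le (by norm_num) h.two_le'
  have h2 : 0 < 1 / (2 * q) := one_div_pos.2 (by linarith [h.one_lt_q])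
  linarith

theorem one_sub_inv_r_pos (h : AdmissibleExponents d p q r) : 0 < 1 - 1 / r := by
  have h1 := h.one_lt_r
  rw [sub_pos, div_lt_one (by linarith)]
  exact h1

theorem spaceGain_pos (h : AdmissibleExponents d p q r) : 0 < spaceGain d q r :=
  div_pos (mul_pos h.sobolev_pos h.one_sub_inv_r_pos) two_pos

theorem inv_spaceGain_mul (h : AdmissibleExponents d p q r) :
    1 / spaceGain d q r * (1 - 1 / r) = 1 + 1 / q - 2 / d := by
  have h1 := h.inv_sobolev
  have h2 := h.one_sub_inv_r_pos.ne'
  have h3 := h.sobolev_pos.ne'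
  have e : 1 / spaceGain d q r * (1 - 1 / r) = 2 * (sobolevExponent d q)⁻¹ := by
    unfold spaceGain
    generalize 1 - 1 / r = c at *
    field_simp
  rw [e, h1]
  have := h.one_lt_q
  have := h.two_le'
  field_simp

/-- The gain minus one is `(1 - 1 / p) - 1 / κ`, with `κ` the gain in space. Multiplied by `1 - 1 /
r`, this is exactly the slack in the assumption on the exponents. -/
theorem one_lt_moserGain (h : AdmissibleExponents d p q r) : 1 < moserGain d p q r := by
  have h1 := h.inv_spaceGain_mul
  have h2 := h.one_sub_inv_r_pos
  have h3 := h.lt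
  have : 1 / spaceGain d q r < 1 - 1 / p := by
    refine lt_of_mul_lt_mul_right ?_ h2.le
    rw [h1]
    linarith
  unfold moserGain
  linarith

end AdmissibleExponents

/-- Bounds for the averages of the functionals of the environment over `B(x₀, n)`. -/
structure VolumeBounds (A p q r : ℝ) (ω : Environment d) (ϑ : Lattice d → ℝ) (x₀ : Lattice d)
    (n : ℝ) : Prop where
  conductance_pos : ∀ e, 0 < ω e
  speed_pos : ∀ x, 0 < ϑ x
  speed : ∑ x ∈ ballFinset x₀ n, ϑ x ≤ A * n ^ d
  mu : ∑ x ∈ ballFinset x₀ n, muMeasure ω x ≤ A * n ^ d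
  nu : ∑ x ∈ ballFinset x₀ n, nuMeasure ω x ≤ A * n ^ d
  mu_div_speed : ∑ x ∈ ballFinset x₀ n, ϑ x * (muMeasure ω x / ϑ x) ^ p ≤ A * n ^ d
  nu_rpow : ∑ x ∈ ballFinset x₀ n, nuMeasure ω x ^ q ≤ A * n ^ d
  inv_speed : ∑ x ∈ ballFinset x₀ n, (ϑ x)⁻¹ ≤ A * n ^ d
  speed_rpow : ∑ x ∈ ballFinset x₀ n, ϑ x ^ r ≤ A * n ^ d

theorem sum_ball_le {x₀ : Lattice d} {ρ n M : ℝ} {F : Lattice d → ℝ} (hF : ∀ x, 0 ≤ F x)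
    (hρ : ρ ≤ n) (h : ∑ x ∈ ballFinset x₀ n, F x ≤ M) : ∑ x ∈ ballFinset x₀ ρ, F x ≤ M :=
  (Finset.sum_le_sum_of_subset_of_nonneg (ballFinset_mono x₀ hρ) fun x _ _ => hF x).trans h

/-- The gain of integrability which follows from the Sobolev inequality. -/
theorem sobolev_gain {p q r : ℝ} (h : AdmissibleExponents d p q r) :
    ∃ C : ℝ, 0 < C ∧ ∀ (A : ℝ) (ω : Environment d) (ϑ : Lattice d → ℝ) (x₀ : Lattice d) (n ρ : ℝ),
      VolumeBounds A p q r ω ϑ x₀ n → 0 ≤ A * n ^ d → ρ ≤ n →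
      ∀ f : Lattice d → ℝ, (∀ x, 0 ≤ f x) → (∀ x, f x ≠ 0 → x ∈ ballFinset x₀ (ρ - 1)) →
      (∑ x ∈ ballFinset x₀ ρ, ϑ x * (f x ^ 2) ^ (moserGain d p q r * conjExp p)) ^ (1 / conjExp p)
        ≤ C * (A * n ^ d) ^ (1 / (r * spaceGain d q r) + 1 / q)
          * ((∑ x ∈ ballFinset x₀ ρ, ϑ x * f x ^ 2) ^ (moserGain d p q r - 1)
          * ∑ x ∈ ballFinset x₀ ρ, ∑ y ∈ ballFinset x₀ ρ, weight ω x y * (f y - f x) ^ 2) := by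
  obtain ⟨C, hC, hsob⟩ := weighted_sobolev h.two_le h.one_lt_q h.inv_sobolev
  refine ⟨C, hC, ?_⟩
  intro A ω ϑ x₀ n ρ hV hAn hρ f hf hfS
  set B := ballFinset x₀ ρ with hB
  set κ := spaceGain d q r with hκ
  set s := sobolevExponent d q with hs
  set β := moserGain d p q r with hβ
  set P := conjExp p with hP
  have hκ0 : 0 < κ := h.spaceGain_pos
  have hβ1 : 1 < β := h.one_lt_moserGain
  have hP0 : 0 < P := h.conjExp_pos
  have hs0 : 0 < s := h.sobolev_pos
  have hr1 := h.one_lt_r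
  have hq1 := h.one_lt_q
  have hϑ0 : ∀ x, 0 ≤ ϑ x := fun x => (hV.speed_pos x).le
  set F := ∑ x ∈ B, ϑ x * f x ^ 2 with hF
  set D := ∑ x ∈ B, ∑ y ∈ B, weight ω x y * (f y - f x) ^ 2 with hD
  have hF0 : 0 ≤ F := Finset.sum_nonneg fun x _ => mul_nonneg (hϑ0 x) (sq_nonneg _)
  have hD0 : 0 ≤ D := Finset.sum_nonneg fun x _ => Finset.sum_nonneg fun y _ =>
    mul_nonneg (weight_nonneg _ _ _) (sq_nonneg _)
  set K := ∑ x ∈ B, ϑ x * (f x ^ 2) ^ κ with hK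
  have hK0 : 0 ≤ K := Finset.sum_nonneg fun x _ =>
    mul_nonneg (hϑ0 x) (Real.rpow_nonneg (sq_nonneg _) _)
  have hSB : ∀ x ∈ ballFinset x₀ (ρ - 1), x ∈ B := fun x hx => ballFinset_mono _ (by linarith) hx
  have h1 := hsob ω hV.conductance_pos f (ballFinset x₀ (ρ - 1)) B hf
    (fun x hx => by by_contra hne; exact hx (hfS x hne)) hSB
    (fun x hx y hy => mem_ballFinset_of_adj hx hy)
  have hN : (∑ x ∈ B, nuMeasure ω x ^ q) ^ (1 / q) ≤ (A * n ^ d) ^ (1 / q) := by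
    refine Real.rpow_le_rpow (Finset.sum_nonneg fun x _ =>
      Real.rpow_nonneg (nuMeasure_nonneg _ _) _) ?_ (by positivity)
    exact sum_ball_le (fun x => Real.rpow_nonneg (nuMeasure_nonneg _ _) _) hρ hV.nu_rpow
  have hconjr : r.HolderConjugate (r / (r - 1)) := Real.HolderConjugate.conjExponent hr1
  have hr' : 1 / (r / (r - 1)) = 1 - 1 / r := by
    field_simp
  have hrpos : 0 < 1 - 1 / r := h.one_sub_inv_r_pos
  -- Hölder with exponent `r` on the speed measure. The gain `κ` is defined so that `2 κ` times the
  -- conjugate of `r` is the Sobolev exponent `s`.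
  have h2 : K ≤ (A * n ^ d) ^ (1 / r) * (∑ x ∈ B, f x ^ s) ^ (1 - 1 / r) := by
    have := Real.inner_le_Lp_mul_Lq_of_nonneg B hconjr (f := ϑ) (g := fun x => (f x ^ 2) ^ κ)
      (fun x _ => hϑ0 x) (fun x _ => Real.rpow_nonneg (sq_nonneg _) _)
    rw [hr'] at this
    refine this.trans ?_
    have e : ∀ x ∈ B, ((f x ^ 2) ^ κ) ^ (r / (r - 1)) = f x ^ s := by
      intro x _
      rw [← Real.rpow_natCast, ← Real.rpow_mul (hf x), ← Real.rpow_mul (hf x)]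
      congr 1
      rw [hκ, spaceGain, ← hs]
      have : r - 1 ≠ 0 := by linarith
      push_cast
      field_simp
    rw [Finset.sum_congr rfl e]
    refine mul_le_mul_of_nonneg_right (Real.rpow_le_rpow (Finset.sum_nonneg fun x _ =>
      Real.rpow_nonneg (hϑ0 x) _) ?_ (by positivity)) (Real.rpow_nonneg (Finset.sum_nonneg
        fun x _ => Real.rpow_nonneg (hf x) _) _)
    exact sum_ball_le (fun x => Real.rpow_nonneg (hϑ0 x) _) hρ hV.speed_rpow
  have hfs0 : 0 ≤ ∑ x ∈ B, f x ^ s := Finset.sum_nonneg fun x _ => Real.rpow_nonneg (hf x) _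
  have h3 : K ^ (1 / κ) ≤ (A * n ^ d) ^ (1 / (r * κ)) * (C * (A * n ^ d) ^ (1 / q) * D) := by
    calc K ^ (1 / κ) ≤ ((A * n ^ d) ^ (1 / r) * (∑ x ∈ B, f x ^ s) ^ (1 - 1 / r)) ^ (1 / κ) :=
          Real.rpow_le_rpow hK0 h2 (by positivity)
      _ = (A * n ^ d) ^ (1 / (r * κ)) * (∑ x ∈ B, f x ^ s) ^ (2 / s) := by
          rw [Real.mul_rpow (Real.rpow_nonneg hAn _) (Real.rpow_nonneg hfs0 _),
            ← Real.rpow_mul hAn, ← Real.rpow_mul hfs0]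
          congr 2
          · field_simp
          · rw [hκ, spaceGain, ← hs]
            generalize 1 - 1 / r = c at *
            field_simp
      _ ≤ _ := by
          refine mul_le_mul_of_nonneg_left (h1.trans ?_) (Real.rpow_nonneg hAn _)
          gcongr
  -- This identity is the reason for the value of `β`: it permits interpolating the exponent `β P`
  -- between `1` and `κ`, in such a way that after taking the root `1 / P` the Dirichlet energy
  -- appears to the first power and can be integrated in time.
  have hPβ : P * (β - 1) + P / κ = 1 := by
    have e : β - 1 = 1 / P - 1 / κ := by
      rw [hP, h.one_div_conjExp, hβ, moserGain]; ring
    rw [e]; field_simp; ring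
  have hpos1 : 0 < P * (β - 1) := mul_pos hP0 (by linarith)
  have hpos2 : 0 < P / κ := by positivity
  have hconj : (1 / (P * (β - 1))).HolderConjugate (1 / (P / κ)) := by
    rw [Real.holderConjugate_iff]
    refine ⟨?_, ?_⟩
    · rw [one_lt_div hpos1]; linarith
    · simpa using hPβ
  have h4 : ∑ x ∈ B, ϑ x * (f x ^ 2) ^ (β * P) ≤ F ^ (P * (β - 1)) * K ^ (P / κ) := by
    have := sum_weight_mul_le B hconj (ϑ := ϑ) (f := fun x => (f x ^ 2) ^ (P * (β - 1)))
      (g := fun x => ((f x ^ 2) ^ κ) ^ (P / κ)) (fun x _ => hϑ0 x)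
      (fun x _ => Real.rpow_nonneg (sq_nonneg _) _)
      (fun x _ => Real.rpow_nonneg (Real.rpow_nonneg (sq_nonneg _) _) _)
    rw [one_div_one_div, one_div_one_div] at this
    have e1 : ∀ x ∈ B, ϑ x * ((f x ^ 2) ^ (P * (β - 1)) * ((f x ^ 2) ^ κ) ^ (P / κ))
        = ϑ x * (f x ^ 2) ^ (β * P) := by
      intro x _
      have e : κ * (P / κ) = P := by field_simp
      rw [← Real.rpow_mul (sq_nonneg _), e, ← Real.rpow_add' (sq_nonneg _) (by positivity)]
      congr 2
      ring
    have e2 : ∀ x ∈ B, ϑ x * ((f x ^ 2) ^ (P * (β - 1))) ^ (1 / (P * (β - 1)))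
        = ϑ x * f x ^ 2 := by
      intro x _
      rw [← Real.rpow_mul (sq_nonneg _), mul_one_div_cancel hpos1.ne', Real.rpow_one]
    have e3 : ∀ x ∈ B, ϑ x * (((f x ^ 2) ^ κ) ^ (P / κ)) ^ (1 / (P / κ))
        = ϑ x * (f x ^ 2) ^ κ := by
      intro x _
      rw [← Real.rpow_mul (Real.rpow_nonneg (sq_nonneg _) _), mul_one_div_cancel hpos2.ne',
        Real.rpow_one]
    rwa [Finset.sum_congr rfl e1, Finset.sum_congr rfl e2, Finset.sum_congr rfl e3] at this
  calc (∑ x ∈ B, ϑ x * (f x ^ 2) ^ (β * P)) ^ (1 / P)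
      ≤ (F ^ (P * (β - 1)) * K ^ (P / κ)) ^ (1 / P) :=
        Real.rpow_le_rpow (Finset.sum_nonneg fun x _ =>
          mul_nonneg (hϑ0 x) (Real.rpow_nonneg (sq_nonneg _) _)) h4 (by positivity)
    _ = F ^ (β - 1) * K ^ (1 / κ) := by
        rw [Real.mul_rpow (Real.rpow_nonneg hF0 _) (Real.rpow_nonneg hK0 _),
          ← Real.rpow_mul hF0, ← Real.rpow_mul hK0]
        congr 2 <;> field_simp
    _ ≤ F ^ (β - 1) * ((A * n ^ d) ^ (1 / (r * κ)) * (C * (A * n ^ d) ^ (1 / q) * D)) := by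
        gcongr
    _ = _ := by
        rw [Real.rpow_add' hAn (by positivity)]
        ring

/-- A radial cut-off function which is `1` on `B(x₀, ρ')` and vanishes outside `B(x₀, ρ)`. -/
noncomputable def annulusCutoff (x₀ : Lattice d) (ρ' ρ : ℝ) (x : Lattice d) : ℝ :=
  max 0 (min 1 ((ρ - (latticeGraph d).dist x₀ x) / (ρ - ρ')))

section annulusCutoff

variable {x₀ : Lattice d} {ρ' ρ : ℝ}

theorem annulusCutoff_nonneg (x : Lattice d) : 0 ≤ annulusCutoff x₀ ρ' ρ x := le_max_left _ _

theorem annulusCutoff_le_one (x : Lattice d) : annulusCutoff x₀ ρ' ρ x ≤ 1 :=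
  max_le zero_le_one (min_le_left _ _)

theorem annulusCutoff_eq_one (h : ρ' < ρ) {x : Lattice d} (hx : x ∈ ballFinset x₀ ρ') :
    annulusCutoff x₀ ρ' ρ x = 1 := by
  rw [mem_ballFinset] at hx
  have : 1 ≤ (ρ - (latticeGraph d).dist x₀ x) / (ρ - ρ') := by
    rw [one_le_div (by linarith)]; linarith
  rw [annulusCutoff, min_eq_left this, max_eq_right zero_le_one]

theorem mem_of_annulusCutoff_ne_zero (h : ρ' < ρ) {x : Lattice d}
    (hx : annulusCutoff x₀ ρ' ρ x ≠ 0) : x ∈ ballFinset x₀ ρ := by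
  rw [mem_ballFinset]
  by_contra! hc
  refine hx (max_eq_left ((min_le_right _ _).trans ?_))
  exact div_nonpos_of_nonpos_of_nonneg (by linarith) (by linarith)

theorem annulusCutoff_sub_sq_le (h : ρ' < ρ) {x y : Lattice d} (hxy : (latticeGraph d).Adj x y) :
    (annulusCutoff x₀ ρ' ρ x - annulusCutoff x₀ ρ' ρ y) ^ 2 ≤ 1 / (ρ - ρ') ^ 2 := by
  have h0 : 0 < ρ - ρ' := by linarith
  have h1 : |annulusCutoff x₀ ρ' ρ x - annulusCutoff x₀ ρ' ρ y| ≤ 1 / (ρ - ρ') := by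
    unfold annulusCutoff
    refine (abs_max_sub_max_le_max _ _ _ _).trans ?_
    rw [sub_self, abs_zero, max_eq_right (abs_nonneg _)]
    refine (abs_min_sub_min_le_max _ _ _ _).trans ?_
    rw [sub_self, abs_zero, max_eq_right (abs_nonneg _), ← sub_div, abs_div, abs_of_pos h0]
    gcongr
    have := abs_dist_sub_le (x₀ := x₀) hxy
    rwa [show ρ - ((latticeGraph d).dist x₀ x : ℝ) - (ρ - (latticeGraph d).dist x₀ y)
      = (latticeGraph d).dist x₀ y - (latticeGraph d).dist x₀ x by ring]
  calc _ = |annulusCutoff x₀ ρ' ρ x - annulusCutoff x₀ ρ' ρ y| ^ 2 := (sq_abs _).symm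
    _ ≤ (1 / (ρ - ρ')) ^ 2 := pow_le_pow_left₀ (abs_nonneg _) h1 2
    _ = _ := by rw [div_pow, one_pow]

end annulusCutoff

/-- The bound for the energy in one step of the Moser iteration. -/
noncomputable def stepEnergy (p A n ρ ρ' a c b : ℝ) (d : ℕ) (X : ℝ) : ℝ :=
  1 / (c - a) * ((1 + (b - a) * (4 / (ρ - ρ') ^ 2)) * ((A * n ^ d) ^ (1 / p) * X))

/-- One step of the Moser iteration. -/
theorem moser_step {p q r : ℝ} (h : AdmissibleExponents d p q r) :
    ∃ C : ℝ, 0 < C ∧ ∀ (A : ℝ) (ω : Environment d) (ϑ : Lattice d → ℝ) (x₀ : Lattice d)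
      (n ρ ρ' a b c : ℝ) (w w' : ℝ → Lattice d → ℝ),
      VolumeBounds A p q r ω ϑ x₀ n → 0 ≤ A * n ^ d → ρ ≤ n → ρ' + 2 ≤ ρ → a < c → c ≤ b →
      IsSubcaloric ω ϑ x₀ ρ a b w w' →
      (∀ t ∈ Icc c b, ∀ x ∈ ballFinset x₀ ρ', ϑ x * w t x ^ 2
        ≤ stepEnergy p A n ρ ρ' a c b d (∫ t in a..b,
          (∑ x ∈ ballFinset x₀ ρ, ϑ x * (w t x ^ 2) ^ conjExp p) ^ (1 / conjExp p))) ∧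
      ∫ t in c..b, (∑ x ∈ ballFinset x₀ ρ', ϑ x * (w t x ^ 2) ^ (moserGain d p q r * conjExp p))
          ^ (1 / conjExp p)
        ≤ C * (A * n ^ d) ^ (1 / (r * spaceGain d q r) + 1 / q)
          * stepEnergy p A n ρ ρ' a c b d (∫ t in a..b,
          (∑ x ∈ ballFinset x₀ ρ, ϑ x * (w t x ^ 2) ^ conjExp p) ^ (1 / conjExp p))
            ^ moserGain d p q r := by
  obtain ⟨C, hC, hgain⟩ := sobolev_gain h
  refine ⟨C, hC, ?_⟩
  intro A ω ϑ x₀ n ρ ρ' a b c w w' hV hAn hρ hρ' hac hcb hw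
  set β := moserGain d p q r with hβ
  set P := conjExp p with hP
  have hβ1 : 1 < β := h.one_lt_moserGain
  have hP0 : 0 < P := h.conjExp_pos
  have hp0 : 0 < p := by linarith [h.one_lt_p]
  have hϑ0 : ∀ x, 0 ≤ ϑ x := fun x => (hV.speed_pos x).le
  set Y := fun t => (∑ x ∈ ballFinset x₀ ρ, ϑ x * (w t x ^ 2) ^ P) ^ (1 / P) with hY
  set X := ∫ t in a..b, Y t with hX
  set G := stepEnergy p A n ρ ρ' a c b d X with hG
  set B := ballFinset x₀ ρ with hB
  have hab : a ≤ b := hac.le.trans hcb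
  have hgap : ρ' < ρ - 1 := by linarith
  set η := annulusCutoff x₀ ρ' (ρ - 1) with hη
  -- The cut-off has to vanish outside `B(x₀, ρ - 1)`, so that neighbours of its support stay in the
  -- ball. Since the gap `ρ - ρ'` is at least `2`, the remaining width is at least half of it, which
  -- gives the factor `4`.
  set L := 4 / (ρ - ρ') ^ 2 with hLdef
  have hL0 : 0 ≤ L := by positivity
  have hηL : ∀ x y, (latticeGraph d).Adj x y → (η x - η y) ^ 2 ≤ L := by
    intro x y hxy
    refine (annulusCutoff_sub_sq_le hgap hxy).trans ?_
    have h1 : 0 < ρ - 1 - ρ' := by linarith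
    have h2 : 0 < ρ - ρ' := by linarith
    rw [hLdef, div_le_div_iff₀ (by positivity) (by positivity)]
    nlinarith
  have hη0 : ∀ x, 0 ≤ η x := annulusCutoff_nonneg
  have hη1 : ∀ x, η x ^ 2 ≤ 1 := fun x => pow_le_one₀ (hη0 x) (annulusCutoff_le_one x)
  have hηS : ∀ x, η x ≠ 0 → x ∈ ballFinset x₀ (ρ - 1) :=
    fun x hx => mem_of_annulusCutoff_ne_zero hgap hx
  have hYcont : ContinuousOn Y (Icc a b) := by
    refine ContinuousOn.rpow_const ?_ fun _ _ => Or.inr (by positivity)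
    exact continuousOn_finsetSum _ fun x hx => continuousOn_const.mul
      (((hw.cont x hx).pow 2).rpow_const fun _ _ => Or.inr hP0.le)
  have hsumY0 : ∀ t, 0 ≤ ∑ x ∈ B, ϑ x * (w t x ^ 2) ^ P := fun t => Finset.sum_nonneg fun x _ =>
    mul_nonneg (hϑ0 x) (Real.rpow_nonneg (sq_nonneg _) _)
  have hY0 : ∀ t, 0 ≤ Y t := fun t => Real.rpow_nonneg (hsumY0 t) _
  have hX0 : 0 ≤ X := intervalIntegral.integral_nonneg hab fun t _ => hY0 t
  set G₀ := (1 + (b - a) * L) * ((A * n ^ d) ^ (1 / p) * X) with hG₀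
  have hGG : (c - a) * G = G₀ := by
    rw [hG, stepEnergy, ← hLdef, ← hG₀]
    have : c - a ≠ 0 := by linarith
    field_simp
  have hca : 0 < c - a := by linarith
  have hG₀0 : 0 ≤ G₀ := by
    have : 0 ≤ b - a := by linarith
    positivity
  have hG0 : 0 ≤ G := by
    by_contra! hneg
    have := mul_neg_of_pos_of_neg hca hneg
    linarith
  have hAp : 0 ≤ (A * n ^ d) ^ (1 / p) := Real.rpow_nonneg hAn _
  -- Both terms are reduced to `Y` by Hölder with exponent `p`: against `1` for the speed measure,
  -- and against `μ / ϑ` for `μ`.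
  have hrhs : ∫ s in a..b, (∑ x ∈ B, ϑ x * w s x ^ 2
      + (b - a) * L * ∑ x ∈ B, muMeasure ω x * w s x ^ 2) ≤ G₀ := by
    have hle : ∀ s ∈ Icc a b, ∑ x ∈ B, ϑ x * w s x ^ 2
        + (b - a) * L * ∑ x ∈ B, muMeasure ω x * w s x ^ 2
        ≤ (1 + (b - a) * L) * (A * n ^ d) ^ (1 / p) * Y s := by
      intro s _
      have h1 : ∑ x ∈ B, ϑ x * w s x ^ 2 ≤ (A * n ^ d) ^ (1 / p) * Y s := by
        have := sum_weight_mul_le B h.conj (ϑ := ϑ) (f := fun _ => 1) (g := fun x => w s x ^ 2)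
          (fun x _ => hϑ0 x) (fun _ _ => zero_le_one) (fun x _ => sq_nonneg _)
        simp only [one_mul, Real.one_rpow, mul_one] at this
        refine this.trans (mul_le_mul_of_nonneg_right (Real.rpow_le_rpow
          (Finset.sum_nonneg fun x _ => hϑ0 x) ?_ (by positivity)) (hY0 s))
        exact sum_ball_le hϑ0 hρ hV.speed
      have h2 : ∑ x ∈ B, muMeasure ω x * w s x ^ 2 ≤ (A * n ^ d) ^ (1 / p) * Y s := by
        have := sum_weight_mul_le B h.conj (ϑ := ϑ) (f := fun x => muMeasure ω x / ϑ x)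
          (g := fun x => w s x ^ 2) (fun x _ => hϑ0 x)
          (fun x _ => div_nonneg (muMeasure_nonneg _ _) (hϑ0 x)) (fun x _ => sq_nonneg _)
        have e : ∀ x ∈ B, ϑ x * (muMeasure ω x / ϑ x * w s x ^ 2) = muMeasure ω x * w s x ^ 2 := by
          intro x _
          have := (hV.speed_pos x).ne'
          field_simp
        rw [Finset.sum_congr rfl e] at this
        have hnn : ∀ x, 0 ≤ ϑ x * (muMeasure ω x / ϑ x) ^ p := fun x => mul_nonneg (hϑ0 x)
          (Real.rpow_nonneg (div_nonneg (muMeasure_nonneg _ _) (hϑ0 x)) _)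
        refine this.trans (mul_le_mul_of_nonneg_right (Real.rpow_le_rpow
          (Finset.sum_nonneg fun x _ => hnn x) ?_ (by positivity)) (hY0 s))
        exact sum_ball_le hnn hρ hV.mu_div_speed
      have h3 : 0 ≤ (b - a) * L := mul_nonneg (by linarith) hL0
      have h4 := mul_le_mul_of_nonneg_left h2 h3
      linarith
    have hcont : ContinuousOn (fun s => ∑ x ∈ B, ϑ x * w s x ^ 2
        + (b - a) * L * ∑ x ∈ B, muMeasure ω x * w s x ^ 2) (Icc a b) :=
      (continuousOn_finsetSum _ fun x hx => continuousOn_const.mul ((hw.cont x hx).pow 2)).add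
        (continuousOn_const.mul
          (continuousOn_finsetSum _ fun x hx => continuousOn_const.mul ((hw.cont x hx).pow 2)))
    calc _ ≤ ∫ s in a..b, (1 + (b - a) * L) * (A * n ^ d) ^ (1 / p) * Y s :=
          intervalIntegral.integral_mono_on hab (hcont.intervalIntegrable_of_Icc hab)
            ((continuousOn_const.mul hYcont).intervalIntegrable_of_Icc hab) hle
      _ = G₀ := by
          rw [intervalIntegral.integral_const_mul, hG₀, ← hX]
          ring
  set F := fun t => ∑ x ∈ B, ϑ x * (η x * w t x) ^ 2 with hF
  set D := fun t => ∑ x ∈ B, ∑ y ∈ B, weight ω x y * (η y * w t y - η x * w t x) ^ 2 with hD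
  have hD0 : ∀ t, 0 ≤ D t := fun t => Finset.sum_nonneg fun x _ => Finset.sum_nonneg fun y _ =>
    mul_nonneg (weight_nonneg _ _ _) (sq_nonneg _)
  have hF0 : ∀ t, 0 ≤ F t := fun t => Finset.sum_nonneg fun x _ =>
    mul_nonneg (hϑ0 x) (sq_nonneg _)
  have hDcont : ContinuousOn D (Icc a b) :=
    continuousOn_finsetSum _ fun x hx => continuousOn_finsetSum _ fun y hy =>
      continuousOn_const.mul (((continuousOn_const.mul (hw.cont y hy)).sub
        (continuousOn_const.mul (hw.cont x hx))).pow 2)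
  have henergy : ∀ t ∈ Icc a b, (t - a) * F t + ∫ s in a..t, (s - a) * D s ≤ G₀ := by
    intro t ht
    have := hw.energy hV.speed_pos hη1 hηS hL0 hηL ht
    have e : ∑ x ∈ B, ϑ x * η x ^ 2 * w t x ^ 2 = F t :=
      Finset.sum_congr rfl fun x _ => by ring
    rw [e] at this
    exact this.trans hrhs
  have hFG : ∀ t ∈ Icc c b, F t ≤ G := by
    intro t ht
    have h1 := henergy t ⟨hac.le.trans ht.1, ht.2⟩
    have h2 : 0 ≤ ∫ s in a..t, (s - a) * D s :=
      intervalIntegral.integral_nonneg (hac.le.trans ht.1) fun s hs =>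
        mul_nonneg (by linarith [hs.1]) (hD0 s)
    have h3 : (c - a) * F t ≤ (t - a) * F t :=
      mul_le_mul_of_nonneg_right (by linarith [ht.1]) (hF0 t)
    refine le_of_mul_le_mul_left ?_ hca
    rw [hGG]
    linarith
  have hDG : ∫ t in c..b, D t ≤ G := by
    have h1 := henergy b (right_mem_Icc.2 hab)
    have h2 : 0 ≤ (b - a) * F b := mul_nonneg (by linarith) (hF0 b)
    have hcont : ContinuousOn (fun s => (s - a) * D s) (Icc a b) :=
      ContinuousOn.mul (by fun_prop) hDcont
    have hsub : Icc c b ⊆ Icc a b := Icc_subset_Icc_left hac.le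
    have h3 : ∫ s in c..b, (s - a) * D s ≤ ∫ s in a..b, (s - a) * D s := by
      refine intervalIntegral.integral_mono_interval hac.le hcb le_rfl ?_
        (hcont.intervalIntegrable_of_Icc hab)
      filter_upwards [ae_restrict_mem measurableSet_Ioc] with s hs
      exact mul_nonneg (by linarith [hs.1]) (hD0 s)
    have h4 : ∫ s in c..b, (c - a) * D s ≤ ∫ s in c..b, (s - a) * D s :=
      intervalIntegral.integral_mono_on hcb
        ((continuousOn_const.mul (hDcont.mono hsub)).intervalIntegrable_of_Icc hcb)
        ((hcont.mono hsub).intervalIntegrable_of_Icc hcb) fun s hs =>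
        mul_le_mul_of_nonneg_right (by linarith [hs.1]) (hD0 s)
    rw [intervalIntegral.integral_const_mul] at h4
    refine le_of_mul_le_mul_left ?_ hca
    rw [hGG]
    linarith
  have hBB : ballFinset x₀ ρ' ⊆ B := ballFinset_mono _ (by linarith)
  have hηone : ∀ x ∈ ballFinset x₀ ρ', η x = 1 := fun x hx => annulusCutoff_eq_one hgap hx
  refine ⟨fun t ht x hx => ?_, ?_⟩
  · refine le_trans ?_ (hFG t ht)
    have := Finset.single_le_sum (f := fun x => ϑ x * (η x * w t x) ^ 2)
      (fun x _ => mul_nonneg (hϑ0 x) (sq_nonneg _)) (hBB hx)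
    simpa [hηone x hx] using this
  · set M := C * (A * n ^ d) ^ (1 / (r * spaceGain d q r) + 1 / q) with hM
    have hM0 : 0 ≤ M := mul_nonneg hC.le (Real.rpow_nonneg hAn _)
    have hsub : Icc c b ⊆ Icc a b := Icc_subset_Icc_left hac.le
    -- The power `β - 1` falls on `F t`, which is bounded uniformly in time by `G`. Only the linear
    -- factor `D t` is left to integrate, and its integral is again at most `G`.
    have hpt : ∀ t ∈ Icc c b, (∑ x ∈ ballFinset x₀ ρ', ϑ x * (w t x ^ 2) ^ (β * P)) ^ (1 / P)
        ≤ M * G ^ (β - 1) * D t := by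
      intro t ht
      have h1 := hgain A ω ϑ x₀ n ρ hV hAn hρ (fun x => η x * w t x) (fun x => by
          by_cases hx : η x = 0
          · simp [hx]
          · exact mul_nonneg (hη0 x)
              (hw.pos t (hsub ht) x (ballFinset_mono _ (by linarith) (hηS x hx))).le)
        (fun x hx => hηS x (left_ne_zero_of_mul hx))
      have h2 : ∑ x ∈ ballFinset x₀ ρ', ϑ x * (w t x ^ 2) ^ (β * P)
          ≤ ∑ x ∈ B, ϑ x * ((η x * w t x) ^ 2) ^ (β * P) := by
        calc _ = ∑ x ∈ ballFinset x₀ ρ', ϑ x * ((η x * w t x) ^ 2) ^ (β * P) :=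
              Finset.sum_congr rfl fun x hx => by rw [hηone x hx, one_mul]
          _ ≤ _ := Finset.sum_le_sum_of_subset_of_nonneg hBB fun x _ _ =>
              mul_nonneg (hϑ0 x) (Real.rpow_nonneg (sq_nonneg _) _)
      calc _ ≤ (∑ x ∈ B, ϑ x * ((η x * w t x) ^ 2) ^ (β * P)) ^ (1 / P) :=
            Real.rpow_le_rpow (Finset.sum_nonneg fun x _ =>
              mul_nonneg (hϑ0 x) (Real.rpow_nonneg (sq_nonneg _) _)) h2 (by positivity)
        _ ≤ M * (F t ^ (β - 1) * D t) := h1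
        _ ≤ M * (G ^ (β - 1) * D t) := by
            have h3 := Real.rpow_le_rpow (hF0 t) (hFG t ht) (by linarith : 0 ≤ β - 1)
            have h4 := hD0 t
            gcongr
        _ = _ := by ring
    have hcontl : ContinuousOn (fun t => (∑ x ∈ ballFinset x₀ ρ', ϑ x * (w t x ^ 2) ^ (β * P))
        ^ (1 / P)) (Icc c b) := by
      refine ContinuousOn.rpow_const ?_ fun _ _ => Or.inr (by positivity)
      exact continuousOn_finsetSum _ fun x hx => continuousOn_const.mul
        ((((hw.cont x (hBB hx)).mono hsub).pow 2).rpow_const fun _ _ => Or.inr (by positivity))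
    calc _ ≤ ∫ t in c..b, M * G ^ (β - 1) * D t :=
          intervalIntegral.integral_mono_on hcb (hcontl.intervalIntegrable_of_Icc hcb)
            ((continuousOn_const.mul (hDcont.mono hsub)).intervalIntegrable_of_Icc hcb) hpt
      _ = M * G ^ (β - 1) * ∫ t in c..b, D t := intervalIntegral.integral_const_mul _ _
      _ ≤ M * G ^ (β - 1) * G := by gcongr
      _ = M * G ^ β := by
          have : G ^ β = G ^ (β - 1) * G := by
            conv_rhs => rw [← Real.rpow_one G, ← Real.rpow_mul hG0, one_mul]
            rw [← Real.rpow_add' hG0 (by linarith)]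
            congr 1
            ring
          rw [this]; ring

/-! ### The Moser iteration and the maximal inequality -/

/-- The solution of the recursion of the Moser iteration. -/
theorem exists_iterate_bound {β C c : ℝ} (hβ : 1 < β) (hC : 1 ≤ C) (hc : 1 ≤ c) :
    ∃ M : ℝ, 0 < M ∧ ∀ (K : ℕ) (X : ℕ → ℝ), (∀ k, 0 ≤ X k) →
      (∀ k < K, X (k + 1) ≤ (C * c ^ k * X k) ^ β) → X K ≤ (M * X 0) ^ (β ^ K) := by
  have hβ0 : 0 < β := by linarith
  have hb : ‖β⁻¹‖ < 1 := by
    rw [Real.norm_of_nonneg (by positivity)]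
    exact inv_lt_one_of_one_lt₀ hβ
  have hs0 : Summable fun k : ℕ => β⁻¹ ^ k := summable_geometric_of_norm_lt_one hb
  have hs1 : Summable fun k : ℕ => (k : ℝ) * β⁻¹ ^ k := by
    simpa using summable_pow_mul_geometric_of_norm_lt_one 1 hb
  set S0 := ∑' k : ℕ, β⁻¹ ^ k
  set S1 := ∑' k : ℕ, (k : ℝ) * β⁻¹ ^ k
  have hC0 : 0 < C := by linarith
  have hc0 : 0 < c := by linarith
  refine ⟨C ^ S0 * c ^ S1, by positivity, ?_⟩
  intro K X hX hrec
  -- Extracting the root of order `β ^ k` makes the recursion multiplicative: the logarithms of the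
  -- constants add up along `β⁻¹ ^ j` and `j * β⁻¹ ^ j`, both summable.
  have main : ∀ k ≤ K, X k ≤ (C ^ (∑ j ∈ Finset.range k, β⁻¹ ^ j)
      * c ^ (∑ j ∈ Finset.range k, (j : ℝ) * β⁻¹ ^ j) * X 0) ^ (β ^ k) := by
    intro k
    induction k with
    | zero => intro _; simp
    | succ k ih =>
      intro hk
      set a := ∑ j ∈ Finset.range k, β⁻¹ ^ j
      set b := ∑ j ∈ Finset.range k, (j : ℝ) * β⁻¹ ^ j
      have hY0 : 0 ≤ C ^ a * c ^ b * X 0 := mul_nonneg (by positivity) (hX 0)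
      have h1 : X (k + 1) ≤ (C * c ^ k * (C ^ a * c ^ b * X 0) ^ (β ^ k)) ^ β := by
        refine (hrec k (by omega)).trans (Real.rpow_le_rpow ?_ ?_ hβ0.le)
        · exact mul_nonneg (by positivity) (hX k)
        · exact mul_le_mul_of_nonneg_left (ih (by omega)) (by positivity)
      refine h1.trans_eq ?_
      have e : C * c ^ k = (C ^ (β⁻¹ ^ k) * c ^ ((k : ℝ) * β⁻¹ ^ k)) ^ (β ^ k) := by
        rw [Real.mul_rpow (by positivity) (by positivity), ← Real.rpow_mul hC0.le,
          ← Real.rpow_mul hc0.le, mul_assoc, ← mul_pow, inv_mul_cancel₀ hβ0.ne', one_pow, mul_one,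
          Real.rpow_one, Real.rpow_natCast]
      rw [e, ← Real.mul_rpow (by positivity) hY0, ← Real.rpow_mul (mul_nonneg (by positivity) hY0),
        Finset.sum_range_succ, Finset.sum_range_succ, Real.rpow_add hC0, Real.rpow_add hc0,
        ← pow_succ]
      congr 1
      ring
  refine (main K le_rfl).trans (Real.rpow_le_rpow (mul_nonneg (by positivity) (hX 0)) ?_
    (by positivity))
  have h0 : ∑ j ∈ Finset.range K, β⁻¹ ^ j ≤ S0 :=
    hs0.sum_le_tsum _ fun j _ => by positivity
  have h1 : ∑ j ∈ Finset.range K, (j : ℝ) * β⁻¹ ^ j ≤ S1 :=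
    hs1.sum_le_tsum _ fun j _ => by positivity
  have := hX 0
  gcongr

theorem rpow_rpow_sq {x α γ : ℝ} (hx : 0 < x) : ((x ^ α) ^ 2) ^ γ = (x ^ 2) ^ (α * γ) := by
  rw [← Real.rpow_natCast, ← Real.rpow_natCast, ← Real.rpow_mul hx.le, ← Real.rpow_mul hx.le,
    ← Real.rpow_mul hx.le]
  congr 1
  ring

/-- The gap in time contributes `2 ^ k` and the squared gap in space `4 ^ k`, whence `8 ^ k`; the
numerical constant is `16 * 257 ≤ 2 ^ 13`. -/
theorem stepEnergy_le {p A n ρ ρ' a c b X : ℝ} {k : ℕ} (hn : 0 < n)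
    (hca : c - a = (1 / 2) ^ k / 16 * n ^ 2) (hgap : ρ - ρ' = (1 / 2) ^ k / 16 * n)
    (hba : b - a ≤ n ^ 2 / 4) (hX : 0 ≤ (A * n ^ d) ^ (1 / p) * X) :
    stepEnergy p A n ρ ρ' a c b d X
      ≤ 2 ^ 13 * 8 ^ k / n ^ 2 * ((A * n ^ d) ^ (1 / p) * X) := by
  set m : ℝ := 2 ^ k with hm
  have hm1 : 1 ≤ m := one_le_pow₀ (by norm_num)
  have hm0 : 0 < m := by linarith
  have e1 : ((1 : ℝ) / 2) ^ k = 1 / m := by rw [div_pow, one_pow]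
  have e2 : (8 : ℝ) ^ k = m ^ 3 := by
    rw [hm, ← pow_mul, mul_comm, pow_mul]; norm_num
  unfold stepEnergy
  rw [← mul_assoc]
  refine mul_le_mul_of_nonneg_right ?_ hX
  rw [hca, hgap, e1, e2]
  have h1 : (b - a) * (4 / (1 / m / 16 * n) ^ 2) ≤ 256 * m ^ 2 := by
    calc (b - a) * (4 / (1 / m / 16 * n) ^ 2) ≤ n ^ 2 / 4 * (4 / (1 / m / 16 * n) ^ 2) := by
          gcongr
      _ = 256 * m ^ 2 := by field_simp; norm_num
  calc 1 / (1 / m / 16 * n ^ 2) * (1 + (b - a) * (4 / (1 / m / 16 * n) ^ 2))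
      ≤ 1 / (1 / m / 16 * n ^ 2) * (m ^ 2 + 256 * m ^ 2) := by
        gcongr
        exact one_le_pow₀ hm1
    _ = 4112 * m ^ 3 / n ^ 2 := by field_simp; norm_num
    _ ≤ _ := by gcongr; norm_num

/-- The exponents of `n` in the Moser iteration balance. -/
theorem AdmissibleExponents.balance {p q r : ℝ} (h : AdmissibleExponents d p q r) :
    (d : ℝ) * (1 / (r * spaceGain d q r) + 1 / q) + d * moserGain d p q r
      = 2 + d / conjExp p := by
  have h1 := h.inv_spaceGain_mul
  have h2 := h.one_div_conjExp
  have h3 : (d : ℝ) / conjExp p = d * (1 - 1 / p) := by rw [← h2]; ring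
  have hd : (d : ℝ) ≠ 0 := by linarith [h.two_le']
  rw [h3, moserGain]
  have e : 1 / (r * spaceGain d q r) = 1 / spaceGain d q r * (1 / r) := by
    rw [one_div_mul_one_div, mul_comm]
  rw [e]
  have h4 : 1 / spaceGain d q r * (1 / r) = 1 / spaceGain d q r - (1 + 1 / q - 2 / d) := by
    linarith
  rw [h4]
  field_simp
  ring

/-- The maximal inequality for positive subsolutions. -/
theorem maximal_inequality {p q r A : ℝ} (h : AdmissibleExponents d p q r) (hA : 1 ≤ A) :
    ∃ C : ℝ, 0 < C ∧ ∀ (ω : Environment d) (ϑ : Lattice d → ℝ) (x₀ : Lattice d)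
      (n t₀ : ℝ) (w w' : ℝ → Lattice d → ℝ), 32 ≤ n → VolumeBounds A p q r ω ϑ x₀ n →
      IsSubcaloric ω ϑ x₀ (3 / 8 * n) (t₀ - n ^ 2 / 4) t₀ w w' →
      ∀ t ∈ Icc (t₀ - n ^ 2 / 8) t₀, ∀ x ∈ ballFinset x₀ (n / 4),
        w t x ^ 2 ≤ C * ((∫ t in (t₀ - n ^ 2 / 4)..t₀, (∑ x ∈ ballFinset x₀ (3 / 8 * n),
          ϑ x * (w t x ^ 2) ^ conjExp p) ^ (1 / conjExp p)) / n ^ (2 + d / conjExp p)) := by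
  obtain ⟨C, hC, hstep⟩ := moser_step h
  set β := moserGain d p q r with hβ
  set P := conjExp p with hP
  set e := 1 / (r * spaceGain d q r) + 1 / q with he
  have hβ1 : 1 < β := h.one_lt_moserGain
  have hβ0 : 0 < β := by linarith
  have hP0 : 0 < P := h.conjExp_pos
  have hA0 : 0 < A := by linarith
  have hp0 : 0 < p := by linarith [h.one_lt_p]
  set K₁ : ℝ := 2 ^ 13 * A ^ (1 / p) with hK₁
  have hK₁1 : 1 ≤ K₁ := by
    have : 1 ≤ A ^ (1 / p) := Real.one_le_rpow hA (by positivity)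
    rw [hK₁]; linarith
  set K₂ : ℝ := (C * A ^ e) ^ (1 / β) with hK₂
  have hK₂0 : 0 ≤ K₂ := by positivity
  obtain ⟨M, hM, hiter⟩ := exists_iterate_bound (C := max 1 (K₂ * K₁)) (c := 8) hβ1
    (le_max_left _ _) (by norm_num)
  -- `K₄ * c₄ ^ K` absorbs the prefactor `8 ^ K * n ^ (2 * d)` of the final pointwise bound, by
  -- means of `n ≤ 64 * 2 ^ K`.
  set K₄ : ℝ := K₁ * A * 64 ^ (2 * d) with hK₄
  have hK₄1 : 1 ≤ K₄ := by
    have : (1 : ℝ) ≤ 64 ^ (2 * d) := one_le_pow₀ (by norm_num)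
    have h2 : 1 ≤ K₁ * A := one_le_mul_of_one_le_of_one_le hK₁1 hA
    exact one_le_mul_of_one_le_of_one_le h2 this
  set c₄ : ℝ := 8 * 4 ^ d with hc₄
  have hc₄1 : 1 ≤ c₄ := by
    have : (1 : ℝ) ≤ 4 ^ d := one_le_pow₀ (by norm_num)
    rw [hc₄]; linarith
  refine ⟨K₄ * c₄ ^ (1 / (β - 1)) * M, by positivity, ?_⟩
  intro ω ϑ x₀ n t₀ w w' hn hV hw t ht x hx
  have hn0 : 0 < n := by linarith
  -- On a lattice the iteration has to stop. `K` is the last step for which the spatial gap `(1 / 2)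
  -- ^ k / 16 * n` is still at least `2`, so `2 ^ K` is comparable to `n`.
  obtain ⟨K, hK1, hK2⟩ := exists_nat_pow_near (show 1 ≤ n / 32 by linarith)
    (show (1 : ℝ) < 2 by norm_num)
  have hAn : 0 ≤ A * n ^ d := by positivity
  -- With this normalisation the powers of `n` cancel in each step; this is
  -- `AdmissibleExponents.balance`.
  set N : ℝ := n ^ (2 + d / P) with hN
  have hN0 : 0 < N := by positivity
  set σ : ℕ → ℝ := fun k => (1 / 4 + (1 / 2) ^ k / 8) * n with hσ
  set τ : ℕ → ℝ := fun k => t₀ - (1 / 8 + (1 / 2) ^ k / 8) * n ^ 2 with hτ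
  have hhalf : ∀ k : ℕ, (0 : ℝ) < (1 / 2) ^ k ∧ ((1 : ℝ) / 2) ^ k ≤ 1 := fun k =>
    ⟨by positivity, pow_le_one₀ (by norm_num) (by norm_num)⟩
  have hσle : ∀ k, σ k ≤ 3 / 8 * n := fun k => by
    have := hhalf k
    exact mul_le_mul_of_nonneg_right (by linarith) hn0.le
  have hτle : ∀ k, t₀ - n ^ 2 / 4 ≤ τ k := fun k => by
    have := hhalf k
    have h2 : (1 / 8 + (1 / 2) ^ k / 8) * n ^ 2 ≤ 1 / 4 * n ^ 2 :=
      mul_le_mul_of_nonneg_right (by linarith) (sq_nonneg n)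
    simp only [hτ]; linarith
  have hτt : ∀ k, τ k ≤ t₀ - n ^ 2 / 8 := fun k => by
    have := hhalf k
    have h2 : 1 / 8 * n ^ 2 ≤ (1 / 8 + (1 / 2) ^ k / 8) * n ^ 2 :=
      mul_le_mul_of_nonneg_right (by linarith) (sq_nonneg n)
    simp only [hτ]; linarith
  have hτ0 : ∀ k, τ k ≤ t₀ := fun k => (hτt k).trans (by linarith [sq_nonneg n])
  have hσn : ∀ k, n / 4 ≤ σ k := fun k => by
    have := hhalf k
    have h2 : 1 / 4 * n ≤ (1 / 4 + (1 / 2) ^ k / 8) * n :=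
      mul_le_mul_of_nonneg_right (by linarith) hn0.le
    simp only [hσ]; linarith
  have hwk : ∀ k, IsSubcaloric ω ϑ x₀ (σ k) (τ k) t₀ w w' := fun k => hw.mono (hσle k) (hτle k)
  have hϑ0 : ∀ x, 0 ≤ ϑ x := fun x => (hV.speed_pos x).le
  set Y : ℕ → ℝ → ℝ := fun k t =>
    (∑ x ∈ ballFinset x₀ (σ k), ϑ x * (w t x ^ 2) ^ (β ^ k * P)) ^ (1 / P) with hY
  set X : ℕ → ℝ := fun k => (∫ t in (τ k)..t₀, Y k t) / N with hX
  have hY0 : ∀ k t, 0 ≤ Y k t := fun k t => Real.rpow_nonneg (Finset.sum_nonneg fun x _ =>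
    mul_nonneg (hϑ0 x) (Real.rpow_nonneg (sq_nonneg _) _)) _
  have hX0 : ∀ k, 0 ≤ X k := fun k =>
    div_nonneg (intervalIntegral.integral_nonneg (hτ0 k) fun t _ => hY0 k t) hN0.le
  have hAnp : (A * n ^ d) ^ (1 / p) = A ^ (1 / p) * n ^ ((d : ℝ) / p) := by
    rw [Real.mul_rpow hA0.le (by positivity), ← Real.rpow_natCast, ← Real.rpow_mul hn0.le]
    congr 2; ring
  have hsteps : ∀ k ≤ K,
      (∀ t ∈ Icc (τ (k + 1)) t₀, ∀ x ∈ ballFinset x₀ (σ (k + 1)),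
        ϑ x * (w t x ^ 2) ^ (β ^ k) ≤ K₁ * 8 ^ k * n ^ d * X k) ∧
      X (k + 1) ≤ (max 1 (K₂ * K₁) * 8 ^ k * X k) ^ β := by
    intro k hk
    have hβk : 1 ≤ β ^ k := one_le_pow₀ hβ1.le
    have hgapeq : σ k - σ (k + 1) = (1 / 2) ^ k / 16 * n := by
      simp only [hσ, pow_succ]; ring
    have hτeq : τ (k + 1) - τ k = (1 / 2) ^ k / 16 * n ^ 2 := by
      simp only [hτ, pow_succ]; ring
    have hgap2 : 2 ≤ (1 / 2) ^ k / 16 * n := by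
      have h2K : (2 : ℝ) ^ k ≤ n / 32 := (pow_le_pow_right₀ (by norm_num) hk).trans hK1
      have e1 : ((1 : ℝ) / 2) ^ k = 1 / 2 ^ k := by rw [div_pow, one_pow]
      rw [e1]
      have : (0 : ℝ) < 2 ^ k := by positivity
      rw [div_div, one_div_mul_eq_div, le_div_iff₀ (by positivity)]
      linarith
    have hlt : τ k < τ (k + 1) := by
      have : 0 < (1 / 2 : ℝ) ^ k / 16 * n ^ 2 := by positivity
      linarith
    -- The step is applied to the subsolution `w ^ (β ^ k)`.
    have hs := hstep A ω ϑ x₀ n (σ k) (σ (k + 1)) (τ k) t₀ (τ (k + 1)) _ _ hV hAn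
      ((hσle k).trans (by linarith)) (by linarith) hlt (hτ0 _) ((hwk k).rpow hβk)
    have hpow : ∀ γ : ℝ, ∀ t ∈ Icc (τ k) t₀, ∀ x ∈ ballFinset x₀ (σ k),
        ((w t x ^ (β ^ k)) ^ 2) ^ γ = (w t x ^ 2) ^ (β ^ k * γ) := fun γ t ht x hx =>
      rpow_rpow_sq ((hwk k).pos t ht x hx)
    have hint : ∫ t in (τ k)..t₀, (∑ x ∈ ballFinset x₀ (σ k),
        ϑ x * ((w t x ^ (β ^ k)) ^ 2) ^ P) ^ (1 / P) = X k * N := by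
      rw [hX]
      dsimp only
      rw [div_mul_cancel₀ _ hN0.ne']
      refine intervalIntegral.integral_congr fun t ht => ?_
      rw [uIcc_of_le (hτ0 k)] at ht
      simp only [hY]
      congr 1
      exact Finset.sum_congr rfl fun x hx => by rw [hpow P t ht x hx]
    have hint2 : ∫ t in (τ (k + 1))..t₀, (∑ x ∈ ballFinset x₀ (σ (k + 1)),
        ϑ x * ((w t x ^ (β ^ k)) ^ 2) ^ (β * P)) ^ (1 / P) = X (k + 1) * N := by
      rw [hX]
      dsimp only
      rw [div_mul_cancel₀ _ hN0.ne']
      refine intervalIntegral.integral_congr fun t ht => ?_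
      rw [uIcc_of_le (hτ0 _)] at ht
      simp only [hY]
      congr 1
      refine Finset.sum_congr rfl fun x hx => ?_
      rw [hpow _ t ⟨hlt.le.trans ht.1, ht.2⟩ x (ballFinset_mono _ (by linarith) hx), pow_succ]
      ring_nf
    rw [hint, hint2] at hs
    set G := stepEnergy p A n (σ k) (σ (k + 1)) (τ k) (τ (k + 1)) t₀ d (X k * N) with hG
    have hXN : 0 ≤ (A * n ^ d) ^ (1 / p) * (X k * N) :=
      mul_nonneg (Real.rpow_nonneg hAn _) (mul_nonneg (hX0 k) hN0.le)
    have hGle : G ≤ K₁ * 8 ^ k * n ^ d * X k := by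
      refine (stepEnergy_le hn0 hτeq hgapeq (by linarith [hτle k]) hXN).trans_eq ?_
      have e1 : n ^ ((d : ℝ) / p) * N = n ^ 2 * n ^ d := by
        rw [hN, ← Real.rpow_add hn0, ← Real.rpow_natCast n 2, ← Real.rpow_natCast n d,
          ← Real.rpow_add hn0]
        congr 1
        have := h.one_div_conjExp
        have e3 : (d : ℝ) / P = d * (1 - 1 / p) := by rw [← this]; ring
        rw [e3]; push_cast; ring
      rw [hAnp, hK₁]
      calc _ = 2 ^ 13 * 8 ^ k / n ^ 2 * (A ^ (1 / p) * X k * (n ^ ((d : ℝ) / p) * N)) := by ring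
        _ = _ := by rw [e1]; field_simp
    have hG0 : 0 ≤ G := by
      rw [hG, stepEnergy]
      have h1 : 0 ≤ t₀ - τ k := by linarith [hτ0 k]
      have h2 : 0 ≤ τ (k + 1) - τ k := by linarith
      positivity
    refine ⟨fun t ht x hx => ?_, ?_⟩
    · have := (hs.1 t ht x hx).trans hGle
      have e1 := hpow 1 t ⟨hlt.le.trans ht.1, ht.2⟩ x (ballFinset_mono _ (by linarith) hx)
      rw [Real.rpow_one, mul_one] at e1
      rwa [e1] at this
    · have h1 := hs.2
      have hb0 : 0 ≤ K₁ * 8 ^ k * X k := mul_nonneg (by positivity) (hX0 k)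
      have h2 : X (k + 1) * N ≤ (K₂ * K₁ * 8 ^ k * X k) ^ β * N := by
        calc X (k + 1) * N ≤ C * (A * n ^ d) ^ e * G ^ β := h1
          _ ≤ C * (A * n ^ d) ^ e * (K₁ * 8 ^ k * n ^ d * X k) ^ β := by gcongr
          _ = (C * A ^ e) * (K₁ * 8 ^ k * X k) ^ β
              * (n ^ ((d : ℝ) * e) * n ^ ((d : ℝ) * β)) := by
            rw [Real.mul_rpow hA0.le (by positivity), ← Real.rpow_natCast, ← Real.rpow_mul hn0.le,
              show K₁ * 8 ^ k * n ^ (d : ℝ) * X k = (K₁ * 8 ^ k * X k) * n ^ (d : ℝ) by ring,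
              Real.mul_rpow hb0 (by positivity), ← Real.rpow_mul hn0.le]
            ring
          _ = (K₂ ^ β) * (K₁ * 8 ^ k * X k) ^ β * N := by
            rw [← Real.rpow_add hn0, h.balance, hK₂, ← Real.rpow_mul (by positivity),
              one_div_mul_cancel hβ0.ne', Real.rpow_one]
          _ = _ := by
            rw [← Real.mul_rpow hK₂0 hb0]
            congr 2
            ring
      refine (le_of_mul_le_mul_right h2 hN0).trans (Real.rpow_le_rpow ?_ ?_ hβ0.le)
      · have := hX0 k
        positivity
      · have := hX0 k
        gcongr
        exact le_max_right _ _
  have hXK := hiter K X hX0 fun k hk => (hsteps k hk.le).2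
  have hfin := (hsteps K le_rfl).1 t ⟨(hτt _).trans ht.1, ht.2⟩ x (ballFinset_mono _ (hσn _) hx)
  have hX00 : X 0 = (∫ t in (t₀ - n ^ 2 / 4)..t₀, (∑ x ∈ ballFinset x₀ (3 / 8 * n),
      ϑ x * (w t x ^ 2) ^ P) ^ (1 / P)) / N := by
    have e1 : σ 0 = 3 / 8 * n := by simp only [hσ]; norm_num
    have e2 : τ 0 = t₀ - n ^ 2 / 4 := by simp only [hτ]; norm_num; ring
    simp only [hX, hY, e1, e2, pow_zero, one_mul]
  rw [← hX00]
  set α := β ^ K with hα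
  have hα1 : 1 ≤ α := one_le_pow₀ hβ1.le
  have hα0 : 0 < α := by linarith
  -- A single term is bounded crudely by the whole sum. The loss is polynomial in `n`, hence
  -- exponential in `K`, and harmless after the root of order `β ^ K`.
  have hinv : (ϑ x)⁻¹ ≤ A * n ^ d := by
    have h1 := hV.inv_speed
    have hxn : x ∈ ballFinset x₀ n := ballFinset_mono _ (by linarith) hx
    exact (Finset.single_le_sum (f := fun x => (ϑ x)⁻¹)
      (fun x _ => inv_nonneg.2 (hϑ0 x)) hxn).trans h1
  have hMX : 0 ≤ M * X 0 := mul_nonneg hM.le (hX0 0)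
  have hpw : (w t x ^ 2) ^ α ≤ (K₄ * c₄ ^ K) * (M * X 0) ^ α := by
    have h1 : (w t x ^ 2) ^ α = (ϑ x)⁻¹ * (ϑ x * (w t x ^ 2) ^ α) := by
      have := (hV.speed_pos x).ne'
      field_simp
    have h2 : (0 : ℝ) ≤ ϑ x * (w t x ^ 2) ^ α :=
      mul_nonneg (hϑ0 x) (Real.rpow_nonneg (sq_nonneg _) _)
    have hn64 : n ≤ 64 * 2 ^ K := by
      rw [div_lt_iff₀ (by norm_num), pow_succ] at hK2
      linarith
    calc (w t x ^ 2) ^ α ≤ (A * n ^ d) * (K₁ * 8 ^ K * n ^ d * X K) := by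
          rw [h1]
          exact mul_le_mul hinv hfin h2 hAn
      _ ≤ (A * n ^ d) * (K₁ * 8 ^ K * n ^ d * (M * X 0) ^ α) := by gcongr
      _ = K₁ * A * 8 ^ K * n ^ (2 * d) * (M * X 0) ^ α := by ring
      _ ≤ K₁ * A * 8 ^ K * (64 * 2 ^ K) ^ (2 * d) * (M * X 0) ^ α := by
          have := Real.rpow_nonneg hMX α
          gcongr
      _ = (K₄ * c₄ ^ K) * (M * X 0) ^ α := by
          rw [hK₄, hc₄, mul_pow, mul_pow, ← pow_mul, ← pow_mul,
            show (4 : ℝ) = 2 ^ 2 by norm_num, ← pow_mul]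
          ring
  have hroot : w t x ^ 2 ≤ (K₄ * c₄ ^ K) ^ (1 / α) * (M * X 0) := by
    have h1 := Real.rpow_le_rpow (Real.rpow_nonneg (sq_nonneg _) _) hpw
      (by positivity : 0 ≤ 1 / α)
    rwa [← Real.rpow_mul (sq_nonneg _), mul_one_div_cancel hα0.ne', Real.rpow_one,
      Real.mul_rpow (by positivity) (Real.rpow_nonneg hMX _), ← Real.rpow_mul hMX,
      mul_one_div_cancel hα0.ne', Real.rpow_one] at h1
  have hcst : (K₄ * c₄ ^ K) ^ (1 / α) ≤ K₄ * c₄ ^ (1 / (β - 1)) := by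
    rw [Real.mul_rpow (by linarith) (by positivity)]
    have h1 : K₄ ^ (1 / α) ≤ K₄ := by
      conv_rhs => rw [← Real.rpow_one K₄]
      exact Real.rpow_le_rpow_of_exponent_le hK₄1 (by rw [div_le_one hα0]; exact hα1)
    have h2 : (c₄ ^ K) ^ (1 / α) ≤ c₄ ^ (1 / (β - 1)) := by
      rw [← Real.rpow_natCast, ← Real.rpow_mul (by linarith)]
      refine Real.rpow_le_rpow_of_exponent_le hc₄1 ?_
      have hb : 0 < β - 1 := by linarith
      rw [mul_one_div, div_le_div_iff₀ hα0 hb]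
      -- Bernoulli gives `K * (β - 1) ≤ β ^ K`, so the root of `c₄ ^ K` stays bounded.
      have := one_add_mul_sub_le_pow (by linarith : -1 ≤ β) K
      linarith
    gcongr
  calc w t x ^ 2 ≤ (K₄ * c₄ ^ K) ^ (1 / α) * (M * X 0) := hroot
    _ ≤ K₄ * c₄ ^ (1 / (β - 1)) * (M * X 0) := by gcongr
    _ = _ := by ring

/-! ### The logarithmic barrier and its energy estimate -/

/-- A smooth convex decreasing function on `(0, ∞)` which behaves like `-log` at zero and for
which `exp (-g)` is concave. -/
noncomputable def logBarrier (z : ℝ) : ℝ := Real.log (1 + 1 / z)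

theorem logBarrier_pos {z : ℝ} (hz : 0 < z) : 0 < logBarrier z :=
  Real.log_pos (by have : 0 < 1 / z := by positivity
                   linarith)

theorem logBarrier_anti {y z : ℝ} (hy : 0 < y) (h : y ≤ z) : logBarrier z ≤ logBarrier y := by
  have hz : 0 < z := hy.trans_le h
  refine Real.log_le_log (by positivity) ?_
  gcongr

theorem hasDerivAt_logBarrier {z : ℝ} (hz : 0 < z) :
    HasDerivAt logBarrier (-1 / (z * (1 + z))) z := by
  have h1 : HasDerivAt (fun z : ℝ => 1 + 1 / z) (-1 / z ^ 2) z := by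
    simpa [neg_div] using (hasDerivAt_inv hz.ne').const_add 1
  convert! h1.log (by positivity : (1 + 1 / z) ≠ 0) using 1
  field_simp
  ring

theorem logBarrier_sub {a b : ℝ} (ha : 0 < a) (hb : 0 < b) :
    logBarrier a - logBarrier b = Real.log (b * (1 + a) / (a * (1 + b))) := by
  rw [logBarrier, logBarrier, ← Real.log_div (by positivity) (by positivity)]
  congr 1
  field_simp
  ring

/-- This is the convexity of the barrier in the form in which it turns caloric functions into
subsolutions. -/
theorem logBarrier_tangent {a b : ℝ} (ha : 0 < a) (hb : 0 < b) :
    -1 / (a * (1 + a)) * (b - a) ≤ logBarrier b - logBarrier a := by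
  rw [logBarrier_sub hb ha]
  have h1 := Real.one_sub_inv_le_log_of_pos
    (by positivity : 0 < a * (1 + b) / (b * (1 + a)))
  refine le_trans ?_ h1
  rw [inv_div]
  have e : 1 - b * (1 + a) / (a * (1 + b)) - -1 / (a * (1 + a)) * (b - a)
      = (b - a) ^ 2 / (a * (1 + a) * (1 + b)) := by
    field_simp
    ring
  have : 0 ≤ (b - a) ^ 2 / (a * (1 + a) * (1 + b)) := by positivity
  linarith

/-- With `X = exp (2 y)` the right side is `(2 sinh y) ^ 2`, and `|y| ≤ |sinh y|`. -/
theorem log_sq_le {X : ℝ} (hX : 0 < X) : Real.log X ^ 2 ≤ X + 1 / X - 2 := by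
  set y := Real.log X / 2 with hy
  have hlog : Real.log X = 2 * y := by rw [hy]; ring
  have hXe : X = Real.exp y ^ 2 := by
    rw [← Real.exp_nat_mul]; push_cast; rw [← hlog, Real.exp_log hX]
  have h1 : y ^ 2 ≤ Real.sinh y ^ 2 := by
    rcases le_total 0 y with h | h
    · exact pow_le_pow_left₀ h (Real.self_le_sinh_iff.2 h) 2
    · have := Real.sinh_le_self_iff.2 h
      nlinarith
  have h2 : (2 * Real.sinh y) ^ 2 = X + 1 / X - 2 := by
    have he := Real.exp_pos y
    rw [Real.sinh_eq, hXe, Real.exp_neg]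
    field_simp
    ring
  rw [hlog, ← h2]
  linarith

/-- With `l = log (e / f)` and `m = log s`, the bound for squared logarithms at `(e / f) * s` and at
`e / f` controls `(l + m) ^ 2` and `l ^ 2`. The claim follows from `m ^ 2 / 2 ≤ (l + m) ^ 2 + l ^
2`. The shift by `l` accounts for the different values of the cut-off at the two ends of an edge. -/
theorem log_energy_aux {s e f : ℝ} (hs : 0 < s) (he : 0 ≤ e) (hf : 0 ≤ f) :
    1 / 2 * (e * f) * Real.log s ^ 2 - 2 * (e - f) ^ 2 ≤ e ^ 2 * (s - 1) + f ^ 2 * (1 / s - 1) := by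
  have hs' : 0 < 1 / s := by positivity
  rcases he.eq_or_lt with rfl | he
  · nlinarith [mul_nonneg (sq_nonneg f) hs'.le]
  rcases hf.eq_or_lt with rfl | hf
  · nlinarith [mul_nonneg (sq_nonneg e) hs.le]
  have hef : 0 < e * f := mul_pos he hf
  have h1 := mul_le_mul_of_nonneg_left (log_sq_le (by positivity : 0 < e / f * s)) hef.le
  have h2 := mul_le_mul_of_nonneg_left (log_sq_le (by positivity : 0 < e / f)) hef.le
  rw [Real.log_mul (by positivity) hs.ne'] at h1
  set l := Real.log (e / f)
  set m := Real.log s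
  have e1 : e * f * (e / f * s + 1 / (e / f * s) - 2)
      = e ^ 2 * (s - 1) + f ^ 2 * (1 / s - 1) + (e - f) ^ 2 := by
    field_simp; ring
  have e2 : e * f * (e / f + 1 / (e / f) - 2) = (e - f) ^ 2 := by
    field_simp; ring
  rw [e1] at h1
  rw [e2] at h2
  have h3 : 0 ≤ e * f * (2 * l + m) ^ 2 := by positivity
  nlinarith

/-- For `ψ(z) = exp (-logBarrier z) = z / (1 + z)` the derivative of the barrier is `-ψ' / ψ`.
Concavity of `ψ` replaces `ψ'` by difference quotients, which leaves the ratio `s = ψ(b) / ψ(a)`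
alone; the two nonnegative remainders are the defects of concavity. -/
theorem logBarrier_energy {a b e f : ℝ} (ha : 0 < a) (hb : 0 < b) (he : 0 ≤ e) (hf : 0 ≤ f) :
    1 / 2 * (e * f) * (logBarrier b - logBarrier a) ^ 2 - 2 * (e - f) ^ 2
      ≤ (f ^ 2 * (-1 / (b * (1 + b))) - e ^ 2 * (-1 / (a * (1 + a)))) * (b - a) := by
  have hs : 0 < b * (1 + a) / (a * (1 + b)) := by positivity
  have h1 := log_energy_aux hs he hf
  rw [← logBarrier_sub ha hb] at h1
  have h2 : (f ^ 2 * (-1 / (b * (1 + b))) - e ^ 2 * (-1 / (a * (1 + a)))) * (b - a)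
      - (e ^ 2 * (b * (1 + a) / (a * (1 + b)) - 1)
        + f ^ 2 * (1 / (b * (1 + a) / (a * (1 + b))) - 1))
      = e ^ 2 * ((b - a) ^ 2 / (a * (1 + a) * (1 + b)))
        + f ^ 2 * ((b - a) ^ 2 / (b * (1 + a) * (1 + b))) := by
    field_simp
    ring
  have h3 : 0 ≤ e ^ 2 * ((b - a) ^ 2 / (a * (1 + a) * (1 + b)))
        + f ^ 2 * ((b - a) ^ 2 / (b * (1 + a) * (1 + b))) := by positivity
  have h4 : (logBarrier b - logBarrier a) ^ 2 = (logBarrier a - logBarrier b) ^ 2 := by ring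
  rw [h4]
  linarith

/-- The logarithmic energy estimate for a fixed time. -/
theorem sum_log_energy (ω : Environment d) {B : Finset (Lattice d)} {η z : Lattice d → ℝ} {L : ℝ}
    (hη : ∀ x, 0 ≤ η x) (hL : ∀ x y, (latticeGraph d).Adj x y → (η x - η y) ^ 2 ≤ L)
    (hz : ∀ x ∈ B, 0 < z x)
    (hB : ∀ x ∈ B, η x ≠ 0 → ∀ y, (latticeGraph d).Adj x y → y ∈ B) :
    ∑ x ∈ B, η x ^ 2 * (-1 / (z x * (1 + z x)) * laplacian ω z x)
      ≤ -(1 / 4) * ∑ x ∈ B, ∑ y ∈ B,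
          weight ω x y * (η x * η y * (logBarrier (z y) - logBarrier (z x)) ^ 2)
        + L * ∑ x ∈ B, muMeasure ω x := by
  have h1 : ∑ x ∈ B, η x ^ 2 * (-1 / (z x * (1 + z x)) * laplacian ω z x)
      = ∑ x ∈ B, (η x ^ 2 * (-1 / (z x * (1 + z x)))) * ∑ y ∈ B, weight ω x y * (z y - z x) := by
    refine Finset.sum_congr rfl fun x hx => ?_
    by_cases h : η x = 0
    · simp [h]
    · rw [laplacian_eq (hB x hx h)]; ring
  have h2 := sum_mul_sum_weight ω B (fun x => η x ^ 2 * (-1 / (z x * (1 + z x)))) z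
  have h3 : ∑ x ∈ B, ∑ y ∈ B, weight ω x y * (1 / 2 * (η x * η y)
        * (logBarrier (z y) - logBarrier (z x)) ^ 2 - 2 * (η x - η y) ^ 2)
      ≤ ∑ x ∈ B, ∑ y ∈ B, weight ω x y * ((η y ^ 2 * (-1 / (z y * (1 + z y)))
        - η x ^ 2 * (-1 / (z x * (1 + z x)))) * (z y - z x)) :=
    Finset.sum_le_sum fun x hx => Finset.sum_le_sum fun y hy =>
      mul_le_mul_of_nonneg_left (logBarrier_energy (hz x hx) (hz y hy) (hη x) (hη y))
        (weight_nonneg _ _ _)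
  have h4 := sum_weight_sq_sub_mul_le ω B (η := η) (v := fun _ => 1) hL
    (fun _ _ => zero_le_one)
  simp only [mul_one, one_pow] at h4
  have h5 : ∑ x ∈ B, ∑ y ∈ B, weight ω x y * (1 / 2 * (η x * η y)
        * (logBarrier (z y) - logBarrier (z x)) ^ 2 - 2 * (η x - η y) ^ 2)
      = 1 / 2 * ∑ x ∈ B, ∑ y ∈ B,
          weight ω x y * (η x * η y * (logBarrier (z y) - logBarrier (z x)) ^ 2)
        - 2 * ∑ x ∈ B, ∑ y ∈ B, weight ω x y * (η x - η y) ^ 2 := by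
    simp only [Finset.mul_sum, ← Finset.sum_sub_distrib]
    exact Finset.sum_congr rfl fun x _ => Finset.sum_congr rfl fun y _ => by ring
  rw [h5] at h3
  rw [h1]
  linarith

/-- Positive caloric functions on `[a, b] × B(x₀, n)`. -/
structure IsPositiveCaloric (ω : Environment d) (ϑ : Lattice d → ℝ) (x₀ : Lattice d)
    (n a b : ℝ) (z : ℝ → Lattice d → ℝ) : Prop where
  pos : ∀ t ∈ Icc a b, ∀ x ∈ ballFinset x₀ n, 0 < z t x
  deriv : ∀ t ∈ Icc a b, ∀ x ∈ ballFinset x₀ n,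
    HasDerivWithinAt (fun s => z s x) (generator ω ϑ (z t) x) (Icc a b) t

theorem IsPositiveCaloric.hasDerivWithinAt_logBarrier {ω : Environment d} {ϑ : Lattice d → ℝ}
    {x₀ : Lattice d} {n a b : ℝ} {z : ℝ → Lattice d → ℝ}
    (h : IsPositiveCaloric ω ϑ x₀ n a b z) {t : ℝ} (ht : t ∈ Icc a b) {x : Lattice d}
    (hx : x ∈ ballFinset x₀ n) :
    HasDerivWithinAt (fun s => logBarrier (z s x))
      (-1 / (z t x * (1 + z t x)) * generator ω ϑ (z t) x) (Icc a b) t :=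
  HasDerivAt.comp_hasDerivWithinAt (h₂ := logBarrier) t
    (hasDerivAt_logBarrier (h.pos t ht x hx)) (h.deriv t ht x hx)

theorem IsPositiveCaloric.continuousOn_logBarrier {ω : Environment d} {ϑ : Lattice d → ℝ}
    {x₀ : Lattice d} {n a b : ℝ} {z : ℝ → Lattice d → ℝ}
    (h : IsPositiveCaloric ω ϑ x₀ n a b z) {x : Lattice d} (hx : x ∈ ballFinset x₀ n) :
    ContinuousOn (fun s => logBarrier (z s x)) (Icc a b) := fun _ ht =>
  (h.hasDerivWithinAt_logBarrier ht hx).continuousWithinAt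

theorem IsPositiveCaloric.isSubcaloric {ω : Environment d} {ϑ : Lattice d → ℝ} {x₀ : Lattice d}
    {n a b a' ρ : ℝ} {z : ℝ → Lattice d → ℝ} (h : IsPositiveCaloric ω ϑ x₀ n a b z)
    (hϑ : ∀ x, 0 < ϑ x) (hρ : ρ ≤ n) (ha : a ≤ a') :
    IsSubcaloric ω ϑ x₀ ρ a' b (fun t x => logBarrier (z t x))
      (fun t x => -1 / (z t x * (1 + z t x)) * generator ω ϑ (z t) x) where
  pos t ht x hx := logBarrier_pos (h.pos t (Icc_subset_Icc_left ha ht) x (ballFinset_mono _ hρ hx))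
  cont x hx := (h.continuousOn_logBarrier (ballFinset_mono _ hρ hx)).mono (Icc_subset_Icc_left ha)
  deriv t ht x hx := (h.hasDerivWithinAt_logBarrier (Icc_subset_Icc_left ha ht)
    (ballFinset_mono _ (by linarith) hx)).mono (Icc_subset_Icc_left ha)
  le t ht x hx := by
    have ht' := Icc_subset_Icc_left ha ht
    have hz : ∀ y ∈ ballFinset x₀ ρ, 0 < z t y := fun y hy =>
      h.pos t ht' y (ballFinset_mono _ hρ hy)
    calc ϑ x * (-1 / (z t x * (1 + z t x)) * generator ω ϑ (z t) x)
        = -1 / (z t x * (1 + z t x)) * (ϑ x * generator ω ϑ (z t) x) := by ring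
      _ = -1 / (z t x * (1 + z t x)) * laplacian ω (z t) x := by rw [speed_mul_generator (hϑ x)]
      _ ≤ laplacian ω (fun x => logBarrier (z t x)) x := by
          rw [laplacian, laplacian, Finset.mul_sum]
          refine Finset.sum_le_sum fun y _ => ?_
          have := mul_le_mul_of_nonneg_left (logBarrier_tangent
            (hz x (ballFinset_mono _ (by linarith) hx)) (hz y (mem_ballFinset_of_adj hx y.2)))
            (weight_nonneg ω x y)
          linarith

/-- The Dirichlet energy of `log (1 + 1 / z)`, weighted by a cut-off function. -/
noncomputable def logEnergy (ω : Environment d) (B : Finset (Lattice d)) (η z : Lattice d → ℝ) :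
    ℝ :=
  ∑ x ∈ B, ∑ y ∈ B, weight ω x y * (η x * η y * (logBarrier (z y) - logBarrier (z x)) ^ 2)

theorem logEnergy_nonneg (ω : Environment d) (B : Finset (Lattice d)) {η : Lattice d → ℝ}
    (hη : ∀ x, 0 ≤ η x) (z : Lattice d → ℝ) : 0 ≤ logEnergy ω B η z :=
  Finset.sum_nonneg fun x _ => Finset.sum_nonneg fun y _ =>
    mul_nonneg (weight_nonneg _ _ _) (mul_nonneg (mul_nonneg (hη x) (hη y)) (sq_nonneg _))

theorem IsPositiveCaloric.continuousOn_logEnergy {ω : Environment d} {ϑ : Lattice d → ℝ}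
    {x₀ : Lattice d} {n a b : ℝ} {z : ℝ → Lattice d → ℝ}
    (h : IsPositiveCaloric ω ϑ x₀ n a b z) (η : Lattice d → ℝ) :
    ContinuousOn (fun t => logEnergy ω (ballFinset x₀ n) η (z t)) (Icc a b) :=
  continuousOn_finsetSum _ fun _ hx => continuousOn_finsetSum _ fun _ hy =>
    continuousOn_const.mul (continuousOn_const.mul
      (((h.continuousOn_logBarrier hy).sub (h.continuousOn_logBarrier hx)).pow 2))

/-- The logarithmic energy estimate. -/
theorem IsPositiveCaloric.log_energy {ω : Environment d} {ϑ : Lattice d → ℝ} {x₀ : Lattice d}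
    {n a b L : ℝ} {z : ℝ → Lattice d → ℝ} (h : IsPositiveCaloric ω ϑ x₀ n a b z)
    (hϑ : ∀ x, 0 < ϑ x) {η : Lattice d → ℝ} (hη : ∀ x, 0 ≤ η x)
    (hηS : ∀ x, η x ≠ 0 → x ∈ ballFinset x₀ (n - 1))
    (hL : ∀ x y, (latticeGraph d).Adj x y → (η x - η y) ^ 2 ≤ L) {s t : ℝ} (hs : s ∈ Icc a b)
    (ht : t ∈ Icc s b) :
    ∑ x ∈ ballFinset x₀ n, ϑ x * η x ^ 2 * logBarrier (z t x)
        + 1 / 4 * ∫ τ in s..t, logEnergy ω (ballFinset x₀ n) η (z τ)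
      ≤ ∑ x ∈ ballFinset x₀ n, ϑ x * η x ^ 2 * logBarrier (z s x)
        + (t - s) * (L * ∑ x ∈ ballFinset x₀ n, muMeasure ω x) := by
  set B := ballFinset x₀ n with hB
  have hsub : Icc s b ⊆ Icc a b := Icc_subset_Icc_left hs.1
  set R := L * ∑ x ∈ B, muMeasure ω x with hR
  have hcont := h.continuousOn_logEnergy η
  have key := sub_le_integral_of_deriv_le
    (F := fun t => ∑ x ∈ B, ϑ x * η x ^ 2 * logBarrier (z t x))
    (F' := fun t => ∑ x ∈ B, ϑ x * η x ^ 2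
      * (-1 / (z t x * (1 + z t x)) * generator ω ϑ (z t) x))
    (G := fun t => -(1 / 4) * logEnergy ω B η (z t) + R) (a := s) (b := b)
    (fun t ht => HasDerivWithinAt.fun_sum fun x hx =>
      ((h.hasDerivWithinAt_logBarrier (hsub ht) hx).mono hsub).const_mul _)
    ((continuousOn_const.mul (hcont.mono hsub)).add continuousOn_const)
    (fun t ht => by
      have := sum_log_energy ω (B := B) hη hL (h.pos t (hsub ht))
        (fun x _ hx y hy => mem_ballFinset_of_adj (hηS x hx) hy)
      refine le_trans (le_of_eq ?_) this
      refine Finset.sum_congr rfl fun x _ => ?_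
      rw [← speed_mul_generator (hϑ x)]
      ring) ht
  have hi : IntervalIntegrable (fun τ => logEnergy ω B η (z τ)) volume s t :=
    (hcont.mono ((Icc_subset_Icc_right ht.2).trans hsub)).intervalIntegrable_of_Icc ht.1
  rw [intervalIntegral.integral_add (hi.const_mul _) intervalIntegrable_const,
    intervalIntegral.integral_const_mul, intervalIntegral.integral_const, smul_eq_mul] at key
  linarith

/-! ### The `L¹` bound for the logarithmic barrier -/

/-- A lower bound for the mass of the cut-off function, from the bound for `1 / ϑ`. -/
theorem VolumeBounds.le_cutoff_mass {p q r A : ℝ} {ω : Environment d} {ϑ : Lattice d → ℝ}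
    {x₀ : Lattice d} {n : ℝ} (hV : VolumeBounds A p q r ω ϑ x₀ n) (hd : 0 < d) (hA : 0 < A)
    (hn : 0 < n) :
    1 / (4 * (4 * d) ^ (2 * d) * A) * n ^ d
      ≤ ∑ x ∈ ballFinset x₀ n, ϑ x * cutoff x₀ n x ^ 2 := by
  have hd' : (0 : ℝ) < d := by exact_mod_cast hd
  set B' := ballFinset x₀ (n / 4) with hB'
  have hBB : B' ⊆ ballFinset x₀ n := ballFinset_mono _ (by linarith)
  -- Cauchy–Schwarz applied to `1 = ϑ * ϑ⁻¹`: an upper bound for the sum of `1 / ϑ` forces a lower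
  -- bound for the mass.
  have h1 : ((B'.card : ℝ)) ^ 2 ≤ (∑ x ∈ B', ϑ x) * ∑ x ∈ B', (ϑ x)⁻¹ := by
    have := Finset.sum_sq_le_sum_mul_sum_of_sq_le_mul B' (r := fun _ => (1 : ℝ)) (f := ϑ)
      (g := fun x => (ϑ x)⁻¹) (fun x _ => (hV.speed_pos x).le)
      (fun x _ => inv_nonneg.2 (hV.speed_pos x).le)
      (fun x _ => by rw [mul_inv_cancel₀ (hV.speed_pos x).ne', one_pow])
    simpa using this
  have h2 : ∑ x ∈ B', (ϑ x)⁻¹ ≤ A * n ^ d :=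
    sum_ball_le (fun x => inv_nonneg.2 (hV.speed_pos x).le) (by linarith) hV.inv_speed
  have h3 : (n / 4 / d) ^ d ≤ B'.card := pow_le_card_ballFinset hd x₀ (by positivity)
  have hS0 : 0 ≤ ∑ x ∈ B', ϑ x := Finset.sum_nonneg fun x _ => (hV.speed_pos x).le
  have h4 : ((n / 4 / d) ^ d) ^ 2 ≤ (∑ x ∈ B', ϑ x) * (A * n ^ d) :=
    (pow_le_pow_left₀ (by positivity) h3 2).trans
      (h1.trans (mul_le_mul_of_nonneg_left h2 hS0))
  have h5 : 1 / 4 * ∑ x ∈ B', ϑ x ≤ ∑ x ∈ ballFinset x₀ n, ϑ x * cutoff x₀ n x ^ 2 := by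
    calc _ = ∑ x ∈ B', ϑ x * (1 / 2) ^ 2 := by rw [Finset.mul_sum]; congr! 1; ring
      _ ≤ ∑ x ∈ B', ϑ x * cutoff x₀ n x ^ 2 := by
          refine Finset.sum_le_sum fun x hx => mul_le_mul_of_nonneg_left ?_ (hV.speed_pos x).le
          refine pow_le_pow_left₀ (by norm_num) (le_cutoff hn ?_) 2
          rw [hB', mem_ballFinset] at hx
          linarith
      _ ≤ _ := Finset.sum_le_sum_of_subset_of_nonneg hBB fun x _ _ =>
          mul_nonneg (hV.speed_pos x).le (sq_nonneg _)
  refine le_trans ?_ h5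
  have hnd : 0 < n ^ d := by positivity
  have e : ((n / 4 / d) ^ d) ^ 2 = n ^ d * n ^ d / (4 * d) ^ (2 * d) := by
    rw [div_div, div_pow, div_pow]
    ring
  rw [e, div_le_iff₀ (by positivity)] at h4
  have h6 : n ^ d ≤ (∑ x ∈ B', ϑ x) * A * (4 * d) ^ (2 * d) := by
    refine le_of_mul_le_mul_right ?_ hnd
    linarith
  rw [one_div_mul_eq_div, div_le_iff₀ (by positivity)]
  linarith

theorem VolumeBounds.cutoff_mass_le {p q r A : ℝ} {ω : Environment d} {ϑ : Lattice d → ℝ}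
    {x₀ : Lattice d} {n : ℝ} (hV : VolumeBounds A p q r ω ϑ x₀ n) (hn : 0 < n) :
    ∑ x ∈ ballFinset x₀ n, ϑ x * cutoff x₀ n x ^ 2 ≤ A * n ^ d :=
  (Finset.sum_le_sum fun x _ => mul_le_of_le_one_right (hV.speed_pos x).le
    (pow_le_one₀ (cutoff_nonneg _ _ _) (cutoff_le_one x₀ x hn))).trans hV.speed

/-- If `f` is small on a set of large mass, then its average is bounded by the variation of `f`
and the tail of the weights. -/
theorem sum_mass_mul_le (B : Finset (Lattice d)) {ϑ e f : Lattice d → ℝ} {S : Lattice d → Prop}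
    [DecidablePred S] {ℓ H T : ℝ} (hϑ : ∀ x, 0 < ϑ x) (he1 : ∀ x, e x ^ 2 ≤ 1)
    (hf0 : ∀ x ∈ B, 0 ≤ f x) (hfH : ∀ x ∈ B, f x ≤ H) (hℓ : 0 ≤ ℓ) (hS : ∀ x ∈ B, S x → f x ≤ ℓ)
    (hM : 0 < ∑ x ∈ B, ϑ x * e x ^ 2)
    (hSM : 1 / 4 * ∑ x ∈ B, ϑ x * e x ^ 2 ≤ ∑ x ∈ B with S x, ϑ x * e x ^ 2) :
    ∑ x ∈ B, ϑ x * e x ^ 2 * f x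
      ≤ 4 * ℓ * ∑ x ∈ B, ϑ x * e x ^ 2
        + 4 * T ^ 2 / (∑ x ∈ B, ϑ x * e x ^ 2)
          * ∑ x ∈ B, ∑ y ∈ B, e x ^ 2 * e y ^ 2 * |f x - f y|
        + 8 * H * ∑ x ∈ B with T < ϑ x, ϑ x := by
  set m : Lattice d → ℝ := fun x => ϑ x * e x ^ 2 with hm
  have hm0 : ∀ x, 0 ≤ m x := fun x => mul_nonneg (hϑ x).le (sq_nonneg _)
  have hmϑ : ∀ x, m x ≤ ϑ x := fun x => mul_le_of_le_one_right (hϑ x).le (he1 x)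
  set M := ∑ x ∈ B, m x with hMdef
  set W := ∑ x ∈ B, m x * f x with hW
  set V := ∑ x ∈ B, ∑ y ∈ B, e x ^ 2 * e y ^ 2 * |f x - f y| with hVdef
  set τ := ∑ x ∈ B with T < ϑ x, ϑ x with hτ
  have hW0 : 0 ≤ W := Finset.sum_nonneg fun x hx => mul_nonneg (hm0 x) (hf0 x hx)
  -- Averaging `f y ≤ ℓ + |f x - f y|` over `x` in the large set where `f ≤ ℓ` compares the mean of
  -- `f` with its variation.
  have h1 : 1 / 4 * M * W ≤ ℓ * M ^ 2 + ∑ x ∈ B, ∑ y ∈ B, m x * m y * |f x - f y| := by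
    calc 1 / 4 * M * W ≤ (∑ x ∈ B with S x, m x) * W := mul_le_mul_of_nonneg_right hSM hW0
      _ = ∑ x ∈ B with S x, ∑ y ∈ B, m x * m y * f y := by
          rw [Finset.sum_mul]
          refine Finset.sum_congr rfl fun x _ => ?_
          rw [hW, Finset.mul_sum]
          exact Finset.sum_congr rfl fun y _ => by ring
      _ ≤ ∑ x ∈ B with S x, ∑ y ∈ B, m x * m y * (ℓ + |f x - f y|) := by
          refine Finset.sum_le_sum fun x hx => Finset.sum_le_sum fun y _ => ?_
          refine mul_le_mul_of_nonneg_left ?_ (mul_nonneg (hm0 x) (hm0 y))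
          have := hS x (Finset.mem_filter.1 hx).1 (Finset.mem_filter.1 hx).2
          have := neg_abs_le (f x - f y)
          linarith
      _ ≤ ∑ x ∈ B, ∑ y ∈ B, m x * m y * (ℓ + |f x - f y|) :=
          Finset.sum_le_sum_of_subset_of_nonneg (Finset.filter_subset _ _) fun x _ _ =>
            Finset.sum_nonneg fun y _ => mul_nonneg (mul_nonneg (hm0 x) (hm0 y)) (by positivity)
      _ = _ := by
          simp only [mul_add, Finset.sum_add_distrib]
          congr 1
          simp only [← Finset.sum_mul, ← Finset.mul_sum]
          ring
  -- Pairs with both speeds at most `T` are compared with counting measure at the price `T ^ 2`. For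
  -- the remaining pairs the difference is bounded by `H` and the tail of the speed measure appears.
  have h2 : ∑ x ∈ B, ∑ y ∈ B, m x * m y * |f x - f y| ≤ T ^ 2 * V + 2 * H * M * τ := by
    have hpt : ∀ x ∈ B, ∀ y ∈ B, m x * m y * |f x - f y|
        ≤ T ^ 2 * (e x ^ 2 * e y ^ 2 * |f x - f y|)
          + (H * ((if T < ϑ x then ϑ x else 0) * m y)
            + H * (m x * (if T < ϑ y then ϑ y else 0))) := by
      intro x hx y hy
      have hΔ : |f x - f y| ≤ H := by
        rw [abs_le]
        constructor <;> linarith [hf0 x hx, hf0 y hy, hfH x hx, hfH y hy]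
      have hH : 0 ≤ H := (abs_nonneg _).trans hΔ
      have hV0 : 0 ≤ T ^ 2 * (e x ^ 2 * e y ^ 2 * |f x - f y|) := by positivity
      have hm2 := hm0 x
      have hm3 := hm0 y
      have hϑx := (hϑ x).le
      have hϑy := (hϑ y).le
      by_cases hTx : T < ϑ x
      · rw [if_pos hTx]
        have h3 : m x * m y * |f x - f y| ≤ ϑ x * m y * H := by
          have := hmϑ x
          gcongr
        have h4 : 0 ≤ H * (m x * (if T < ϑ y then ϑ y else 0)) := by
          split_ifs <;> positivity
        linarith
      by_cases hTy : T < ϑ y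
      · rw [if_pos hTy]
        have h3 : m x * m y * |f x - f y| ≤ m x * ϑ y * H := by
          have := hmϑ y
          gcongr
        have h4 : 0 ≤ H * ((if T < ϑ x then ϑ x else 0) * m y) := by
          split_ifs; positivity
        linarith
      · rw [if_neg hTx, if_neg hTy]
        push Not at hTx hTy
        have h3 : ϑ x * ϑ y ≤ T ^ 2 := by
          rw [pow_two]
          exact mul_le_mul hTx hTy hϑy (hϑx.trans hTx)
        have h4 := mul_le_mul_of_nonneg_right h3
          (by positivity : 0 ≤ e x ^ 2 * e y ^ 2 * |f x - f y|)
        have h5 : m x * m y * |f x - f y| = ϑ x * ϑ y * (e x ^ 2 * e y ^ 2 * |f x - f y|) := by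
          simp only [hm]; ring
        rw [h5]
        linarith
    refine (Finset.sum_le_sum fun x hx => Finset.sum_le_sum fun y hy => hpt x hx y hy).trans_eq ?_
    simp only [Finset.sum_add_distrib, ← Finset.mul_sum, ← Finset.sum_mul, ← Finset.sum_filter]
    ring
  have h3 : W ≤ 4 / M * (ℓ * M ^ 2 + (T ^ 2 * V + 2 * H * M * τ)) := by
    rw [div_mul_eq_mul_div, le_div_iff₀ hM]
    linarith
  refine h3.trans_eq ?_
  field_simp
  ring

theorem sum_tail_le (B : Finset (Lattice d)) {ϑ : Lattice d → ℝ} {r T : ℝ} (hϑ : ∀ x, 0 < ϑ x)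
    (hr : 1 < r) (hT : 0 < T) :
    ∑ x ∈ B with T < ϑ x, ϑ x ≤ T ^ (1 - r) * ∑ x ∈ B, ϑ x ^ r := by
  rw [Finset.mul_sum]
  calc _ ≤ ∑ x ∈ B with T < ϑ x, T ^ (1 - r) * ϑ x ^ r := by
        refine Finset.sum_le_sum fun x hx => ?_
        have hx := (Finset.mem_filter.1 hx).2
        have h1 : ϑ x ^ (1 - r) ≤ T ^ (1 - r) :=
          Real.rpow_le_rpow_of_nonpos hT hx.le (by linarith)
        calc ϑ x = ϑ x ^ (1 - r) * ϑ x ^ r := by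
              rw [← Real.rpow_add (hϑ x), sub_add_cancel, Real.rpow_one]
          _ ≤ _ := mul_le_mul_of_nonneg_right h1 (Real.rpow_nonneg (hϑ x).le _)
    _ ≤ _ := Finset.sum_le_sum_of_subset_of_nonneg (Finset.filter_subset _ _) fun x _ _ =>
        mul_nonneg (Real.rpow_nonneg hT.le _) (Real.rpow_nonneg (hϑ x).le _)

/-- Since `0 ≤ e ≤ 1`, the weight `e x * e y` is at most its square root, which is the weight that
Cauchy–Schwarz pairs with the logarithmic energy. -/
theorem sq_sum_cutoff_grad_le {ω : Environment d} (hω : ∀ e, 0 < ω e) (B : Finset (Lattice d))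
    {e z : Lattice d → ℝ} (he : ∀ x, 0 ≤ e x) (he1 : ∀ x, e x ≤ 1) :
    (∑ x ∈ B, ∑ y ∈ B with (latticeGraph d).Adj x y,
        e x * e y * |logBarrier (z y) - logBarrier (z x)|) ^ 2
      ≤ logEnergy ω B e z * ∑ x ∈ B, nuMeasure ω x := by
  have h := sq_sum_sum_adj_le hω B
    (fun x y => √(e x * e y) * (logBarrier (z y) - logBarrier (z x))) (fun _ => 1)
  have e1 : ∀ x y, (√(e x * e y) * (logBarrier (z y) - logBarrier (z x))) ^ 2
      = e x * e y * (logBarrier (z y) - logBarrier (z x)) ^ 2 := fun x y => by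
    rw [mul_pow, Real.sq_sqrt (mul_nonneg (he x) (he y))]
  simp only [e1, one_pow, mul_one, one_mul] at h
  refine le_trans (pow_le_pow_left₀ ?_ ?_ 2) h
  · exact Finset.sum_nonneg fun x _ => Finset.sum_nonneg fun y _ =>
      mul_nonneg (mul_nonneg (he x) (he y)) (abs_nonneg _)
  · refine Finset.sum_le_sum fun x _ => Finset.sum_le_sum fun y _ => ?_
    rw [abs_mul, abs_of_nonneg (Real.sqrt_nonneg _)]
    refine mul_le_mul_of_nonneg_right ?_ (abs_nonneg _)
    have h1 : e x * e y ≤ 1 := mul_le_one₀ (he1 x) (he y) (he1 y)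
    refine Real.le_sqrt_of_sq_le ?_
    nlinarith [mul_nonneg (he x) (he y)]

/-- A time at which a function of large average is not small and a function of small integral is
not large. -/
theorem exists_good_time {fr E : ℝ → ℝ} {t₀ n K : ℝ} (hn : 0 < n) (hK : 0 < K)
    (hE : ContinuousOn E (Icc (t₀ - n ^ 2) t₀)) (hE0 : ∀ t, 0 ≤ E t)
    (hEK : ∫ t in (t₀ - n ^ 2)..t₀, E t ≤ K * n ^ 2 / 32) (hfr : ∀ t, fr t ≤ 1)
    (h : 1 / 2 ≤ 1 / n ^ 2 * ∫ t in (t₀ - n ^ 2)..t₀, fr t) :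
    ∃ t ∈ Icc (t₀ - n ^ 2) (t₀ - n ^ 2 / 4), 1 / 4 ≤ fr t ∧ E t ≤ K := by
  by_contra! hc
  have hn2 : 0 < n ^ 2 := by positivity
  -- No measurability in time is assumed: were `fr` not integrable, its integral would be `0` by
  -- convention, against the lower bound.
  have hint : IntervalIntegrable fr volume (t₀ - n ^ 2) t₀ := by
    by_contra hni
    rw [intervalIntegral.integral_undef hni] at h
    norm_num at h
  have hEint : IntervalIntegrable E volume (t₀ - n ^ 2) t₀ :=
    hE.intervalIntegrable_of_Icc (by linarith)
  set a := t₀ - n ^ 2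
  set b := t₀ - n ^ 2 / 4 with hb
  have hab : a ≤ b := by simp only [a, b]; linarith
  have hbt : b ≤ t₀ := by simp only [b]; linarith
  have hs1 : uIcc a b ⊆ uIcc a t₀ := by
    rw [uIcc_of_le hab, uIcc_of_le (hab.trans hbt)]; exact Icc_subset_Icc_right hbt
  have hs2 : uIcc b t₀ ⊆ uIcc a t₀ := by
    rw [uIcc_of_le hbt, uIcc_of_le (hab.trans hbt)]; exact Icc_subset_Icc_left hab
  -- Without a good time, `fr ≤ 1 / 4 + E / K` on the first three quarters, while `fr ≤ 1` on the
  -- last. In units of `n ^ 2` the total is at most `3 / 16 + 1 / 32 + 1 / 4 = 15 / 32`, which is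
  -- less than `1 / 2`.
  have h1 : ∫ t in a..b, fr t ≤ ∫ t in a..b, (1 / 4 + K⁻¹ * E t) := by
    refine intervalIntegral.integral_mono_on hab (hint.mono_set hs1)
      (intervalIntegrable_const.add ((hEint.mono_set hs1).const_mul _)) fun t ht => ?_
    rcases lt_or_ge (fr t) (1 / 4) with hlt | hge
    · have := mul_nonneg (inv_nonneg.2 hK.le) (hE0 t)
      linarith
    · have h2 : 1 ≤ K⁻¹ * E t := by
        rw [← div_eq_inv_mul, one_le_div hK]
        exact (hc t ht hge).le
      linarith [hfr t]
  have h2 : ∫ t in b..t₀, fr t ≤ ∫ _t in b..t₀, (1 : ℝ) :=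
    intervalIntegral.integral_mono_on hbt (hint.mono_set hs2) intervalIntegrable_const
      fun t _ => hfr t
  have h3 : ∫ t in a..b, E t ≤ ∫ t in a..t₀, E t :=
    intervalIntegral.integral_mono_interval le_rfl hab hbt
      (by filter_upwards with t using hE0 t) hEint
  have h4 := intervalIntegral.integral_add_adjacent_intervals (hint.mono_set hs1)
    (hint.mono_set hs2)
  rw [intervalIntegral.integral_add intervalIntegrable_const ((hEint.mono_set hs1).const_mul _),
    intervalIntegral.integral_const, intervalIntegral.integral_const_mul, smul_eq_mul] at h1
  rw [intervalIntegral.integral_const, smul_eq_mul] at h2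
  have h5 : K⁻¹ * ∫ t in a..b, E t ≤ n ^ 2 / 32 := by
    rw [inv_mul_le_iff₀ hK]
    linarith
  rw [one_div_mul_eq_div, le_div_iff₀ hn2] at h
  simp only [a, b] at *
  linarith

/-- The choice of the truncation level and of the height of the logarithmic barrier. -/
theorem exists_height {A C r δ : ℝ} (hA : 0 < A) (hC : 0 < C) (hr : 1 < r) (hδ : 0 < δ) :
    ∃ T H : ℝ, 0 < T ∧ 0 < H ∧
      8 * A + C * T ^ 2 * √(H + 4) + 8 * A * T ^ (1 - r) * H ≤ δ * H := by
  have ht := tendsto_rpow_neg_atTop (y := r - 1) (by linarith)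
  have hev := (ht.eventually (gt_mem_nhds (by positivity : (0 : ℝ) < δ / (24 * A)))).and
    (Filter.eventually_gt_atTop (0 : ℝ))
  obtain ⟨T, hT1, hT0⟩ := hev.exists
  rw [neg_sub] at hT1
  -- `T` has made the coefficient of the term linear in `H` at most `δ / 3`. With `H = y ^ 2`, the
  -- summands of `y` make each of the other two terms at most `δ H / 3`, and `y ≥ 2` gives `√(H + 4)
  -- ≤ 2 y`.
  set y : ℝ := 2 + 24 * A / δ + 6 * C * T ^ 2 / δ with hy
  have h1 : 0 < 24 * A / δ := by positivity
  have h2 : 0 < 6 * C * T ^ 2 / δ := by positivity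
  have hy2 : 2 ≤ y := by linarith
  have hy1 : 24 * A ≤ δ * y := by
    have : 24 * A / δ ≤ y := by linarith
    rw [div_le_iff₀ hδ] at this; linarith
  have hy3 : 6 * C * T ^ 2 ≤ δ * y := by
    have : 6 * C * T ^ 2 / δ ≤ y := by linarith
    rw [div_le_iff₀ hδ] at this; linarith
  refine ⟨T, y ^ 2, hT0, by positivity, ?_⟩
  have hs : √(y ^ 2 + 4) ≤ 2 * y := Real.sqrt_le_iff.2 ⟨by linarith, by nlinarith⟩
  have h3 : 8 * A * T ^ (1 - r) ≤ δ / 3 := by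
    have := mul_le_mul_of_nonneg_left hT1.le (by positivity : 0 ≤ 8 * A)
    refine this.trans_eq ?_
    field_simp
    norm_num
  have h4 : C * T ^ 2 * √(y ^ 2 + 4) ≤ C * T ^ 2 * (2 * y) := by gcongr
  have h5 : 6 * C * T ^ 2 * y ≤ δ * y * y := mul_le_mul_of_nonneg_right hy3 (by linarith)
  have h6 : 24 * A ≤ δ * y * y := by
    have : δ * y * 1 ≤ δ * y * y := mul_le_mul_of_nonneg_left (by linarith) (by positivity)
    linarith
  have h7 : 8 * A * T ^ (1 - r) * y ^ 2 ≤ δ / 3 * y ^ 2 :=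
    mul_le_mul_of_nonneg_right h3 (sq_nonneg _)
  nlinarith

/-- With `y = exp (H / 2) > 1` the assumption reads `z ≥ 1 / (y - 1)`, and this is `(y + 1) / (y ^ 2
- 1) ≥ 2 / (y ^ 2 - 1)`. The factor `2` leaves room to subtract the shift `1 / (exp H - 1)` from
`z`. -/
theorem two_mul_le_of_logBarrier_le {H z : ℝ} (hH : 0 < H) (hz : 0 < z)
    (h : logBarrier z ≤ H / 2) : 2 * (1 / (Real.exp H - 1)) ≤ z := by
  have h1 : 1 + 1 / z ≤ Real.exp (H / 2) := by
    have := Real.exp_le_exp.2 h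
    rwa [logBarrier, Real.exp_log (by positivity)] at this
  set y := Real.exp (H / 2) with hy
  have hy1 : 1 < y := Real.one_lt_exp_iff.2 (by linarith)
  have he : Real.exp H = y ^ 2 := by
    rw [hy, ← Real.exp_nat_mul]; congr 1; push_cast; ring
  rw [he, mul_one_div, div_le_iff₀ (by nlinarith)]
  have h2 : 1 ≤ (y - 1) * z := by
    have h3 : 1 / z ≤ y - 1 := by linarith
    rwa [div_le_iff₀ hz] at h3
  nlinarith

theorem logBarrier_inv_exp {H : ℝ} : logBarrier (1 / (Real.exp H - 1)) = H := by
  rw [logBarrier, one_div_one_div, add_sub_cancel, Real.log_exp]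

/-- The `L¹`-bound for the logarithmic barrier of a positive caloric function which is at least
one on a set of large mass. -/
theorem exists_mass_bound {p q r A : ℝ} (h : AdmissibleExponents d p q r) (hA : 1 ≤ A) :
    ∃ C : ℝ, 0 < C ∧ ∀ (ω : Environment d) (ϑ : Lattice d → ℝ) (x₀ : Lattice d)
      (n t₀ H T : ℝ) (z : ℝ → Lattice d → ℝ), 32 ≤ n → VolumeBounds A p q r ω ϑ x₀ n →
      IsPositiveCaloric ω ϑ x₀ n (t₀ - n ^ 2) t₀ z → 0 < H → 0 < T →
      (∀ t ∈ Icc (t₀ - n ^ 2) t₀, ∀ x ∈ ballFinset x₀ n, logBarrier (z t x) ≤ H) →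
      ∀ S : ℝ → Set (Lattice d), (∀ t, ∀ x ∈ S t, 1 ≤ z t x) →
      1 / 2 ≤ 1 / n ^ 2 * ∫ t in (t₀ - n ^ 2)..t₀,
        weightedNorm (ballFinset x₀ n) (fun x => cutoff x₀ n x ^ 2 * ϑ x)
          (Set.indicator (S t) 1) →
      ∀ t ∈ Icc (t₀ - n ^ 2 / 4) t₀,
        ∑ x ∈ ballFinset x₀ n, ϑ x * cutoff x₀ n x ^ 2 * logBarrier (z t x)
          ≤ n ^ d * (8 * A + C * T ^ 2 * √(H + 4) + 8 * A * T ^ (1 - r) * H) := by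
  have hd0 : 0 < d := by have := h.two_le; omega
  have hd' : (0 : ℝ) < d := by exact_mod_cast hd0
  have hA0 : 0 < A := by linarith
  set c : ℝ := 1 / (4 * (4 * d) ^ (2 * d) * A) with hc
  have hc0 : 0 < c := by positivity
  set Cp : ℝ := d * 2 ^ (d + 1) * 5 ^ (d + 1) with hCp
  have hCp0 : 0 < Cp := by positivity
  refine ⟨48 * Cp * A / c, by positivity, ?_⟩
  intro ω ϑ x₀ n t₀ H T z hn hV hz hH hT hzH S hS hfrac
  have hn0 : 0 < n := by linarith
  have hn1 : 1 ≤ n := by linarith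
  have hnd : 0 < n ^ d := by positivity
  set B := ballFinset x₀ n with hB
  set η := cutoff x₀ n with hη
  have hη0 : ∀ x, 0 ≤ η x := cutoff_nonneg x₀ n
  have hη1 : ∀ x, η x ≤ 1 := fun x => cutoff_le_one x₀ x hn0
  have hη2 : ∀ x, η x ^ 2 ≤ 1 := fun x => pow_le_one₀ (hη0 x) (hη1 x)
  have hηS : ∀ x, η x ≠ 0 → x ∈ ballFinset x₀ (n - 1) := fun x hx => by
    have := dist_lt_of_cutoff_ne_zero hn0 hx
    rw [mem_ballFinset]; linarith
  have hL : ∀ x y, (latticeGraph d).Adj x y → (η x - η y) ^ 2 ≤ 4 / n ^ 2 := fun x y hxy => by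
    have := pow_le_pow_left₀ (abs_nonneg _) (abs_cutoff_sub_le (x₀ := x₀) hn0 hxy) 2
    rw [sq_abs, div_pow] at this
    norm_num at this
    exact this
  set M := ∑ x ∈ B, ϑ x * η x ^ 2 with hM
  have hMlow : c * n ^ d ≤ M := hV.le_cutoff_mass hd0 hA0 hn0
  have hMup : M ≤ A * n ^ d := hV.cutoff_mass_le hn0
  have hM0 : 0 < M := lt_of_lt_of_le (by positivity) hMlow
  set E := fun t => logEnergy ω B η (z t) with hE
  have hE0 : ∀ t, 0 ≤ E t := fun t => logEnergy_nonneg ω B hη0 _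
  have hEcont : ContinuousOn E (Icc (t₀ - n ^ 2) t₀) := hz.continuousOn_logEnergy η
  set m := fun t => ∑ x ∈ B, ϑ x * η x ^ 2 * logBarrier (z t x) with hm
  have hmnonneg : ∀ t ∈ Icc (t₀ - n ^ 2) t₀, 0 ≤ m t := fun t ht => Finset.sum_nonneg fun x hx =>
    mul_nonneg (mul_nonneg (hV.speed_pos x).le (sq_nonneg _)) (logBarrier_pos (hz.pos t ht x hx)).le
  have hlog : ∀ s ∈ Icc (t₀ - n ^ 2) t₀, ∀ t ∈ Icc s t₀,
      m t + 1 / 4 * ∫ τ in s..t, E τ ≤ m s + 4 * A * n ^ d := by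
    intro s hs t ht
    refine (hz.log_energy hV.speed_pos hη0 hηS hL hs ht).trans ?_
    have h1 : (t - s) * (4 / n ^ 2 * ∑ x ∈ B, muMeasure ω x)
        ≤ n ^ 2 * (4 / n ^ 2 * (A * n ^ d)) := by
      have h2 : 0 ≤ ∑ x ∈ B, muMeasure ω x := Finset.sum_nonneg fun x _ => muMeasure_nonneg ω x
      have h3 := hV.mu
      have h4 : t - s ≤ n ^ 2 := by linarith [hs.1, ht.2]
      gcongr
    have h5 : n ^ 2 * (4 / n ^ 2 * (A * n ^ d)) = 4 * A * n ^ d := by field_simp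
    linarith
  -- Chosen so that the bound `4 * A * n ^ d * (H + 4)` for the time integral of the energy equals
  -- `K * n ^ 2 / 32`, as `exists_good_time` requires.
  set K := 128 * A * (n ^ d / n ^ 2) * (H + 4) with hK
  have hK0 : 0 < K := by positivity
  have hleft : t₀ - n ^ 2 ∈ Icc (t₀ - n ^ 2) t₀ := left_mem_Icc.2 (by linarith [sq_nonneg n])
  have hright : t₀ ∈ Icc (t₀ - n ^ 2) t₀ := right_mem_Icc.2 (by linarith [sq_nonneg n])
  have hEK : ∫ t in (t₀ - n ^ 2)..t₀, E t ≤ K * n ^ 2 / 32 := by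
    have h1 := hlog _ hleft t₀ hright
    have h2 := hmnonneg t₀ hright
    have h3 : m (t₀ - n ^ 2) ≤ H * (A * n ^ d) := by
      calc m (t₀ - n ^ 2) ≤ ∑ x ∈ B, ϑ x * η x ^ 2 * H := Finset.sum_le_sum fun x hx =>
            mul_le_mul_of_nonneg_left (hzH _ hleft x hx)
              (mul_nonneg (hV.speed_pos x).le (sq_nonneg _))
        _ = H * M := by rw [← Finset.sum_mul, mul_comm]
        _ ≤ _ := mul_le_mul_of_nonneg_left hMup hH.le
    have h4 : K * n ^ 2 / 32 = 4 * (A * n ^ d * (H + 4)) := by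
      rw [hK]; field_simp; norm_num
    rw [h4]
    linarith
  classical
  set fr := fun t => weightedNorm B (fun x => η x ^ 2 * ϑ x) (Set.indicator (S t) 1) with hfr
  have hfr_eq : ∀ t, fr t * M = ∑ x ∈ B with x ∈ S t, ϑ x * η x ^ 2 := by
    intro t
    have e1 : ∑ x ∈ B, η x ^ 2 * ϑ x = M := Finset.sum_congr rfl fun x _ => mul_comm _ _
    have e2 : ∑ x ∈ B, |(S t).indicator (1 : Lattice d → ℝ) x| * (η x ^ 2 * ϑ x)
        = ∑ x ∈ B with x ∈ S t, ϑ x * η x ^ 2 := by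
      rw [Finset.sum_filter]
      refine Finset.sum_congr rfl fun x _ => ?_
      by_cases hx : x ∈ S t
      · simp [hx, mul_comm]
      · simp [hx]
    rw [hfr]
    simp only [weightedNorm, e1, e2]
    field_simp
  have hfr1 : ∀ t, fr t ≤ 1 := by
    intro t
    refine le_of_mul_le_mul_right ?_ hM0
    rw [hfr_eq, one_mul]
    exact Finset.sum_le_sum_of_subset_of_nonneg (Finset.filter_subset _ _) fun x _ _ =>
      mul_nonneg (hV.speed_pos x).le (sq_nonneg _)
  -- The good time lies before the last quarter, so the bound for the mass at `t₁` propagates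
  -- forward to every time at which the maximal inequality needs it, with an increase of at most `4
  -- * A * n ^ d`.
  obtain ⟨t₁, ht₁, hfr₁, hE₁⟩ := exists_good_time hn0 hK0 hEcont hE0 hEK hfr1 hfrac
  have ht₁' : t₁ ∈ Icc (t₀ - n ^ 2) t₀ := ⟨ht₁.1, ht₁.2.trans (by linarith [sq_nonneg n])⟩
  have hmt₁ : m t₁ ≤ n ^ d * (4 * A + 48 * Cp * A / c * T ^ 2 * √(H + 4)
      + 8 * A * T ^ (1 - r) * H) := by
    have hsum := sum_mass_mul_le B (ϑ := ϑ) (e := η) (f := fun x => logBarrier (z t₁ x))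
      (S := fun x => x ∈ S t₁) (ℓ := 1) (H := H) (T := T) hV.speed_pos hη2
      (fun x hx => (logBarrier_pos (hz.pos t₁ ht₁' x hx)).le) (fun x hx => hzH t₁ ht₁' x hx)
      zero_le_one (fun x _ hxS => by
        refine (logBarrier_anti one_pos (hS t₁ x hxS)).trans ?_
        rw [logBarrier]
        have := Real.log_le_sub_one_of_pos (by norm_num : (0 : ℝ) < 1 + 1 / 1)
        linarith) hM0
      (by
        rw [← hfr_eq]
        exact mul_le_mul_of_nonneg_right hfr₁ hM0.le)
    have htail : ∑ x ∈ B with T < ϑ x, ϑ x ≤ T ^ (1 - r) * (A * n ^ d) :=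
      (sum_tail_le B hV.speed_pos h.one_lt_r hT).trans
        (mul_le_mul_of_nonneg_left hV.speed_rpow (Real.rpow_nonneg hT.le _))
    set J := ∑ x ∈ B, ∑ y ∈ B with (latticeGraph d).Adj x y,
        η x * η y * |logBarrier (z t₁ y) - logBarrier (z t₁ x)| with hJ
    have hJ2 : J ^ 2 ≤ (A * n ^ d / n) ^ 2 * (128 * (H + 4)) := by
      calc J ^ 2 ≤ E t₁ * ∑ x ∈ B, nuMeasure ω x :=
            sq_sum_cutoff_grad_le hV.conductance_pos B hη0 hη1
        _ ≤ K * (A * n ^ d) := by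
            have h1 := hV.nu
            have h2 : 0 ≤ ∑ x ∈ B, nuMeasure ω x :=
              Finset.sum_nonneg fun x _ => nuMeasure_nonneg ω x
            gcongr
        _ = _ := by rw [hK]; field_simp
    have hJle : J ≤ A * n ^ d / n * (12 * √(H + 4)) := by
      refine (abs_le_of_sq_le_sq' ?_ (by positivity)).2
      rw [mul_pow, mul_pow, Real.sq_sqrt (by linarith)]
      refine hJ2.trans (mul_le_mul_of_nonneg_left ?_ (sq_nonneg _))
      linarith
    have hpoin := cutoff_poincare x₀ hn1 (fun x => logBarrier (z t₁ x))
    set V := ∑ x ∈ B, ∑ y ∈ B, η x ^ 2 * η y ^ 2 * |logBarrier (z t₁ x) - logBarrier (z t₁ y)|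
      with hVdef
    have hVle : V ≤ 12 * Cp * A * √(H + 4) * (n ^ d * n ^ d) := by
      calc V ≤ d * 2 ^ (d + 1) * (5 * n) ^ (d + 1) * J := hpoin
        _ ≤ d * 2 ^ (d + 1) * (5 * n) ^ (d + 1) * (A * n ^ d / n * (12 * √(H + 4))) := by gcongr
        _ = _ := by
            rw [hCp, mul_pow, pow_succ n d]
            field_simp
    have hV0 : 0 ≤ V := Finset.sum_nonneg fun x _ => Finset.sum_nonneg fun y _ => by positivity
    calc m t₁ ≤ _ := hsum
      _ ≤ 4 * 1 * (A * n ^ d) + 4 * T ^ 2 / (c * n ^ d)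
            * (12 * Cp * A * √(H + 4) * (n ^ d * n ^ d))
          + 8 * H * (T ^ (1 - r) * (A * n ^ d)) := by gcongr
      _ = _ := by field_simp; ring
  intro t ht
  have hfin := hlog t₁ ht₁' t ⟨ht₁.2.trans ht.1, ht.2⟩
  have hint : 0 ≤ ∫ τ in t₁..t, E τ :=
    intervalIntegral.integral_nonneg (ht₁.2.trans ht.1) fun τ _ => hE0 τ
  have hmt : m t ≤ m t₁ + 4 * A * n ^ d := by linarith
  calc m t ≤ _ := hmt
    _ ≤ n ^ d * (4 * A + 48 * Cp * A / c * T ^ 2 * √(H + 4) + 8 * A * T ^ (1 - r) * H)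
        + 4 * A * n ^ d := by linarith
    _ = _ := by ring

/-! ### The lower bound in a fixed environment -/

theorem le_of_sq_le_of_mass {P C H δ : ℝ} (hP : 0 < P) (hC : 0 < C) (hH : 0 < H)
    (hδ : δ = (1 / (4 * C)) ^ P / 16) {w : ℝ}
    (hw : w ^ 2 ≤ C * (H ^ (2 - 1 / P) * (16 * (δ * H)) ^ (1 / P))) : w ≤ H / 2 := by
  -- The value of `δ` is adjusted so that the whole bound for `w ^ 2` becomes exactly `(H / 2) ^ 2`.
  have e : (16 * (δ * H)) ^ (1 / P) = 1 / (4 * C) * H ^ (1 / P) := by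
    rw [hδ, show 16 * ((1 / (4 * C)) ^ P / 16 * H) = (1 / (4 * C)) ^ P * H by ring,
      Real.mul_rpow (by positivity) hH.le, ← Real.rpow_mul (by positivity),
      mul_one_div_cancel hP.ne', Real.rpow_one]
  have e2 : H ^ (2 - 1 / P) * H ^ (1 / P) = H ^ 2 := by
    rw [← Real.rpow_add hH, sub_add_cancel]
    exact Real.rpow_natCast H 2
  have h1 : w ^ 2 ≤ (H / 2) ^ 2 := by
    refine hw.trans_eq ?_
    rw [e]
    calc _ = C * (1 / (4 * C)) * (H ^ (2 - 1 / P) * H ^ (1 / P)) := by ring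
      _ = _ := by rw [e2]; field_simp; norm_num
  exact (abs_le_of_sq_le_sq' h1 (by positivity)).2

/-- The lower bound for caloric functions, for a fixed environment with bounded averages. -/
theorem exists_lower_bound {p q r A : ℝ} (h : AdmissibleExponents d p q r) (hA : 1 ≤ A) :
    ∃ c : ℝ, 0 < c ∧ ∀ (ω : Environment d) (ϑ : Lattice d → ℝ) (x₀ : Lattice d) (n t₀ : ℝ)
      (u : ℝ → Lattice d → ℝ), 32 ≤ n → VolumeBounds A p q r ω ϑ x₀ n →
      (∀ t ∈ Icc (t₀ - n ^ 2) t₀, ∀ x ∈ ball x₀ n, 0 < u t x) →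
      IsCaloricOn ω ϑ (Icc (t₀ - n ^ 2) t₀) (ball x₀ n) u →
      1 / 2 ≤ 1 / n ^ 2 * ∫ t in (t₀ - n ^ 2)..t₀,
        weightedNorm (ballFinset x₀ n) (fun x => cutoff x₀ n x ^ 2 * ϑ x)
          (Set.indicator {x | 1 ≤ u t x} 1) →
      ∀ t ∈ Icc (t₀ - n ^ 2 / 8) t₀, ∀ x ∈ ball x₀ (n / 4), c ≤ u t x := by
  obtain ⟨C₁, hC₁, hmass⟩ := exists_mass_bound h hA
  obtain ⟨C₂, hC₂, hmax⟩ := maximal_inequality h hA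
  set P := conjExp p with hP
  have hP1 : 1 < P := h.conj.symm.lt
  have hP0 : 0 < P := by linarith
  set δ : ℝ := (1 / (4 * C₂)) ^ P / 16 with hδ
  have hδ0 : 0 < δ := by positivity
  -- The order matters: `δ` depends only on the constant of the maximal inequality, and `H` is
  -- chosen afterwards.
  obtain ⟨T, H, hT, hH, hTH⟩ := exists_height (by linarith : 0 < A) hC₁ h.one_lt_r hδ0
  set c : ℝ := 1 / (Real.exp H - 1) with hc
  have hc0 : 0 < c := one_div_pos.2 (by linarith [Real.one_lt_exp_iff.2 hH])
  refine ⟨c, hc0, ?_⟩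
  intro ω ϑ x₀ n t₀ u hn hV hpos hcal hfrac t ht x hx
  have hn0 : 0 < n := by linarith
  have hnd : 0 < n ^ d := by positivity
  have hmem : ∀ {x : Lattice d} {R : ℝ}, x ∈ ballFinset x₀ R ↔ x ∈ ball x₀ R := by
    intro x R; exact mem_ballFinset
  -- Adding a constant keeps `z` caloric, and `z ≥ c` caps the barrier at height `H`.
  set z : ℝ → Lattice d → ℝ := fun t x => u t x + c with hz
  have hzcal : IsPositiveCaloric ω ϑ x₀ n (t₀ - n ^ 2) t₀ z :=
    { pos := fun t ht x hx => add_pos (hpos t ht x (hmem.1 hx)) hc0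
      deriv := fun t ht x hx => by
        have := (hcal t ht x (hmem.1 hx)).add_const c
        have e : generator ω ϑ (z t) x = generator ω ϑ (u t) x := by
          simp only [generator, hz, add_sub_add_right_eq_sub]
        rw [e]
        exact this }
  have hzH : ∀ t ∈ Icc (t₀ - n ^ 2) t₀, ∀ x ∈ ballFinset x₀ n, logBarrier (z t x) ≤ H := by
    intro t ht x hx
    rw [← logBarrier_inv_exp (H := H)]
    exact logBarrier_anti hc0 (by
      have := hpos t ht x (hmem.1 hx)
      simp only [hz]; linarith)
  have hm := hmass ω ϑ x₀ n t₀ H T z hn hV hzcal hH hT hzH (fun t => {x | 1 ≤ u t x})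
    (fun t x hx => by
      have : 1 ≤ u t x := hx
      simp only [hz]; linarith) hfrac
  have hsub : IsSubcaloric ω ϑ x₀ (3 / 8 * n) (t₀ - n ^ 2 / 4) t₀ _ _ :=
    hzcal.isSubcaloric hV.speed_pos (by linarith) (by linarith [sq_nonneg n])
  have hX := hmax ω ϑ x₀ n t₀ _ _ hn hV hsub t ht x (hmem.2 hx)
  set b : ℝ := H ^ (2 - 1 / P) * (16 * (δ * H)) ^ (1 / P) with hb
  -- Of the power `2 * P` of the barrier all but one factor is bounded by `H`, so only the mass is
  -- left. On `B(x₀, 3 n / 8)` the cut-off is at least `1 / 4`, whence the factor `16`.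
  have hY : ∀ s ∈ Icc (t₀ - n ^ 2 / 4) t₀, (∑ x ∈ ballFinset x₀ (3 / 8 * n),
      ϑ x * (logBarrier (z s x) ^ 2) ^ P) ^ (1 / P) ≤ b * n ^ ((d : ℝ) / P) := by
    intro s hs
    have hs' : s ∈ Icc (t₀ - n ^ 2) t₀ := ⟨by linarith [hs.1, sq_nonneg n], hs.2⟩
    have h1 : ∑ x ∈ ballFinset x₀ (3 / 8 * n), ϑ x * (logBarrier (z s x) ^ 2) ^ P
        ≤ H ^ (2 * P - 1) * (16 * (n ^ d * (δ * H))) := by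
      calc _ ≤ ∑ x ∈ ballFinset x₀ (3 / 8 * n),
            H ^ (2 * P - 1) * (16 * (ϑ x * cutoff x₀ n x ^ 2 * logBarrier (z s x))) := by
            refine Finset.sum_le_sum fun x hx => ?_
            have hxn : x ∈ ballFinset x₀ n := ballFinset_mono _ (by linarith) hx
            have hw := logBarrier_pos (hzcal.pos s hs' x hxn)
            have hcut : 1 / 4 ≤ cutoff x₀ n x := le_cutoff hn0 (by
              rw [mem_ballFinset] at hx
              linarith)
            have hcut2 : 1 ≤ 16 * cutoff x₀ n x ^ 2 := by nlinarith
            have e1 : (logBarrier (z s x) ^ 2) ^ P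
                = logBarrier (z s x) ^ (2 * P - 1) * logBarrier (z s x) := by
              rw [← Real.rpow_natCast, ← Real.rpow_mul hw.le]
              conv_rhs => rw [← Real.rpow_add_one hw.ne']
              congr 1
              push_cast; ring
            have h2 : logBarrier (z s x) ^ (2 * P - 1) ≤ H ^ (2 * P - 1) :=
              Real.rpow_le_rpow hw.le (hzH s hs' x hxn) (by linarith)
            have hϑ := hV.speed_pos x
            rw [e1]
            calc ϑ x * (logBarrier (z s x) ^ (2 * P - 1) * logBarrier (z s x))
                ≤ ϑ x * (H ^ (2 * P - 1) * logBarrier (z s x)) * 1 := by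
                  rw [mul_one]; gcongr
              _ ≤ ϑ x * (H ^ (2 * P - 1) * logBarrier (z s x)) * (16 * cutoff x₀ n x ^ 2) := by
                  gcongr
              _ = _ := by ring
        _ = H ^ (2 * P - 1) * (16 * ∑ x ∈ ballFinset x₀ (3 / 8 * n),
            ϑ x * cutoff x₀ n x ^ 2 * logBarrier (z s x)) := by
            rw [Finset.mul_sum, Finset.mul_sum]
        _ ≤ _ := by
            have h3 : ∑ x ∈ ballFinset x₀ (3 / 8 * n),
                ϑ x * cutoff x₀ n x ^ 2 * logBarrier (z s x) ≤ n ^ d * (δ * H) := by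
              refine le_trans ?_ ((hm s hs).trans (mul_le_mul_of_nonneg_left hTH hnd.le))
              exact Finset.sum_le_sum_of_subset_of_nonneg (ballFinset_mono _ (by linarith))
                fun x hx _ => mul_nonneg (mul_nonneg (hV.speed_pos x).le (sq_nonneg _))
                  (logBarrier_pos (hzcal.pos s hs' x hx)).le
            gcongr
    refine (Real.rpow_le_rpow (Finset.sum_nonneg fun x _ => mul_nonneg (hV.speed_pos x).le
      (Real.rpow_nonneg (sq_nonneg _) _)) h1 (by positivity)).trans_eq ?_
    rw [show H ^ (2 * P - 1) * (16 * (n ^ d * (δ * H)))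
      = H ^ (2 * P - 1) * (16 * (δ * H)) * n ^ d by ring,
      Real.mul_rpow (by positivity) (by positivity), Real.mul_rpow (by positivity) (by positivity),
      ← Real.rpow_mul hH.le, ← Real.rpow_natCast, ← Real.rpow_mul hn0.le, hb]
    congr 3
    · field_simp
    · field_simp
  have hint : (∫ s in (t₀ - n ^ 2 / 4)..t₀, (∑ x ∈ ballFinset x₀ (3 / 8 * n),
      ϑ x * (logBarrier (z s x) ^ 2) ^ P) ^ (1 / P)) / n ^ (2 + d / P) ≤ b := by
    have hb0 : 0 ≤ b := by positivity
    have hle : t₀ - n ^ 2 / 4 ≤ t₀ := by linarith [sq_nonneg n]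
    have h1 : ∫ s in (t₀ - n ^ 2 / 4)..t₀, (∑ x ∈ ballFinset x₀ (3 / 8 * n),
        ϑ x * (logBarrier (z s x) ^ 2) ^ P) ^ (1 / P)
        ≤ ∫ _s in (t₀ - n ^ 2 / 4)..t₀, b * n ^ ((d : ℝ) / P) := by
      refine intervalIntegral.integral_mono_on hle ?_ intervalIntegrable_const hY
      refine ContinuousOn.intervalIntegrable_of_Icc hle (ContinuousOn.rpow_const ?_
        fun _ _ => Or.inr (by positivity))
      exact continuousOn_finsetSum _ fun x hx => continuousOn_const.mul
        (((hsub.cont x hx).pow 2).rpow_const fun _ _ => Or.inr hP0.le)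
    rw [intervalIntegral.integral_const, smul_eq_mul] at h1
    rw [div_le_iff₀ (by positivity), Real.rpow_add hn0]
    refine h1.trans ?_
    have e : n ^ (2 : ℝ) = n ^ 2 := Real.rpow_natCast n 2
    rw [e]
    have h2 : 0 ≤ b * n ^ ((d : ℝ) / P) := by positivity
    nlinarith [mul_nonneg h2 (sq_nonneg n)]
  have hw : logBarrier (z t x) ≤ H / 2 := le_of_sq_le_of_mass hP0 hC₂ hH hδ
    (hX.trans (mul_le_mul_of_nonneg_left hint hC₂.le))
  have hzpos : 0 < z t x := hzcal.pos t ⟨by linarith [ht.1, sq_nonneg n], ht.2⟩ x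
    (ballFinset_mono _ (by linarith) (hmem.2 hx))
  have := two_mul_le_of_logBarrier_le hH hzpos hw
  simp only [hz] at this
  linarith

/-! ### Almost sure bounds for averages from stationarity and ergodicity -/

theorem shift_shift (y z : Lattice d) (ω : Environment d) :
    shift y (shift z ω) = shift (y + z) ω := by
  funext e
  refine congrArg ω (Subtype.ext ?_)
  simp only [shiftEdge, Sym2.map_map]
  congr 1
  funext x
  simp [add_assoc]

theorem shift_zero (ω : Environment d) : shift 0 ω = ω := by
  funext e
  refine congrArg ω (Subtype.ext ?_)
  simp [shiftEdge]

theorem mem_closedBall_iff_mem_box {x y : Lattice d} {k : ℕ} :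
    y ∈ Metric.closedBall x (k : ℝ) ↔ y ∈ box x k := by
  rw [Metric.mem_closedBall, dist_pi_le_iff (by positivity), mem_box]
  refine forall_congr' fun i => ?_
  rw [Int.dist_eq]
  exact_mod_cast Iff.rfl

theorem sum_box_zero_shift (f : Environment d → ℝ≥0∞) (z : Lattice d) (k : ℕ)
    (ω : Environment d) :
    ∑ y ∈ box 0 k, f (shift y (shift z ω)) = ∑ y ∈ box z k, f (shift y ω) := by
  refine Finset.sum_bij' (i := fun y _ => y + z) (j := fun y _ => y - z) ?_ ?_ ?_ ?_ ?_
  · intro y hy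
    rw [mem_box] at *
    simpa using hy
  · intro y hy
    rw [mem_box] at *
    simpa using hy
  · simp
  · simp
  · intro y _
    rw [shift_shift]

/-- The covering argument for the maximal inequality. -/
theorem card_mul_le_of_box_sum {g : Lattice d → ℝ≥0∞} {c : ℝ≥0∞} {S : Finset (Lattice d)}
    {L K : ℕ} (hS : S ⊆ box 0 L)
    (h : ∀ x ∈ S, ∃ k ≤ K, c * (2 * k + 1 : ℕ) ^ d ≤ ∑ y ∈ box x k, g y) :
    c * S.card ≤ 5 ^ d * ∑ y ∈ box 0 (L + K), g y := by
  classical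
  choose! k hkK hk using h
  -- Boxes are closed balls of the sup metric, so the Vitali lemma gives a disjoint subfamily whose
  -- fivefold enlargements cover `S`.
  obtain ⟨u, huS, hdisj, hcov⟩ := Vitali.exists_disjoint_subfamily_covering_enlargement_closedBall
    (S : Set (Lattice d)) id (fun x => (k x : ℝ)) K
    (fun x hx => by exact_mod_cast hkK x hx) 5 (by norm_num)
  have hufin : u.Finite := S.finite_toSet.subset huS
  set U := hufin.toFinset with hU
  have hUS : U ⊆ S := fun x hx => huS (hufin.mem_toFinset.1 hx)
  have hsub : S ⊆ U.biUnion fun b => box b (5 * k b) := by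
    intro a ha
    obtain ⟨b, hb, hab⟩ := hcov a ha
    refine Finset.mem_biUnion.2 ⟨b, hufin.mem_toFinset.2 hb, ?_⟩
    have := hab (Metric.mem_closedBall_self (by positivity))
    rw [← mem_closedBall_iff_mem_box]
    push_cast
    exact this
  have hcard : S.card ≤ ∑ b ∈ U, 5 ^ d * (2 * k b + 1) ^ d := by
    refine (Finset.card_le_card hsub).trans (Finset.card_biUnion_le.trans ?_)
    refine Finset.sum_le_sum fun b _ => ?_
    rw [card_box, ← mul_pow]
    exact Nat.pow_le_pow_left (by omega) d
  have hdisjU : (U : Set (Lattice d)).PairwiseDisjoint fun b => box b (k b) := by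
    intro a ha b hb hab
    have h1 := hdisj (hufin.mem_toFinset.1 ha) (hufin.mem_toFinset.1 hb) hab
    rw [Function.onFun, Finset.disjoint_left]
    intro y hya hyb
    exact Set.disjoint_left.1 h1 (mem_closedBall_iff_mem_box.2 hya)
      (mem_closedBall_iff_mem_box.2 hyb)
  calc c * S.card ≤ c * ((∑ b ∈ U, 5 ^ d * (2 * k b + 1) ^ d : ℕ) : ℝ≥0∞) := by
        gcongr
    _ = 5 ^ d * ∑ b ∈ U, c * (2 * k b + 1 : ℕ) ^ d := by
        push_cast
        rw [Finset.mul_sum, Finset.mul_sum]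
        exact Finset.sum_congr rfl fun b _ => by ring
    _ ≤ 5 ^ d * ∑ b ∈ U, ∑ y ∈ box b (k b), g y := by
        gcongr with b hb
        exact hk b (hUS hb)
    _ = 5 ^ d * ∑ y ∈ U.biUnion fun b => box b (k b), g y := by
        rw [Finset.sum_biUnion hdisjU]
    _ ≤ 5 ^ d * ∑ y ∈ box 0 (L + K), g y := by
        gcongr
        intro y hy
        obtain ⟨b, hb, hyb⟩ := Finset.mem_biUnion.1 hy
        have h1 := hS (hUS hb)
        have h2 := hkK b (hUS hb)
        rw [mem_box] at *
        intro i
        have h3 := h1 i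
        have h4 := hyb i
        rw [abs_le] at *
        simp only [Pi.zero_apply, sub_zero] at *
        push_cast
        omega

/-- The maximal inequality for averages over boxes. -/
theorem measure_exists_box_sum_le {P : Measure (Environment d)}
    (hP : ∀ z : Lattice d, MeasurePreserving (shift z) P P) {f : Environment d → ℝ≥0∞}
    (hf : Measurable f) (c : ℝ≥0∞) (K : ℕ) :
    c * P {ω | ∃ k ≤ K, c * (2 * k + 1 : ℕ) ^ d < ∑ y ∈ box 0 k, f (shift y ω)}
      ≤ 10 ^ d * ∫⁻ ω, f ω ∂P := by
  classical
  set A := {ω | ∃ k ≤ K, c * (2 * k + 1 : ℕ) ^ d < ∑ y ∈ box 0 k, f (shift y ω)} with hA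
  have hmeas : MeasurableSet A := by
    have : A = ⋃ k : ℕ, ⋃ _ : k ≤ K,
        {ω | c * (2 * k + 1 : ℕ) ^ d < ∑ y ∈ box 0 k, f (shift y ω)} := by
      ext ω; simp [hA]
    rw [this]
    refine MeasurableSet.iUnion fun k => MeasurableSet.iUnion fun _ => ?_
    exact measurableSet_lt measurable_const
      (Finset.measurable_fun_sum _ fun y _ => hf.comp (hP y).measurable)
  -- Transference: the covering argument is applied along the orbit of a single `ω`. Integrating and
  -- using stationarity turns the count of bad translates into a probability; the ratio of the
  -- volumes of the two boxes supplies the extra `2 ^ d`.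
  have hpt : ∀ ω, c * ∑ x ∈ box 0 K, A.indicator 1 (shift x ω)
      ≤ 5 ^ d * ∑ y ∈ box 0 (K + K), f (shift y ω) := by
    intro ω
    have h1 := card_mul_le_of_box_sum (g := fun y => f (shift y ω)) (c := c)
      (S := {x ∈ box 0 K | shift x ω ∈ A}) (L := K) (K := K) (Finset.filter_subset _ _) (by
        intro x hx
        obtain ⟨k, hkK, hk⟩ := (Finset.mem_filter.1 hx).2
        refine ⟨k, hkK, ?_⟩
        rw [← sum_box_zero_shift]
        exact hk.le)
    refine le_trans (le_of_eq ?_) h1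
    congr 1
    rw [Finset.card_filter]
    push_cast
    exact Finset.sum_congr rfl fun x _ => by simp [Set.indicator_apply]
  have hint := lintegral_mono (μ := P) hpt
  have hAmeas : Measurable (A.indicator (1 : Environment d → ℝ≥0∞)) :=
    measurable_one.indicator hmeas
  have m1 : ∀ x : Lattice d,
      Measurable fun ω => A.indicator (1 : Environment d → ℝ≥0∞) (shift x ω) := fun x =>
    hAmeas.comp (hP x).measurable
  have m2 : ∀ y : Lattice d, Measurable fun ω => f (shift y ω) := fun y =>
    hf.comp (hP y).measurable
  rw [lintegral_const_mul _ (Finset.measurable_fun_sum _ fun x _ => m1 x),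
    lintegral_const_mul _ (Finset.measurable_fun_sum _ fun y _ => m2 y),
    lintegral_finsetSum _ fun x _ => m1 x, lintegral_finsetSum _ fun y _ => m2 y] at hint
  have e1 : ∀ x : Lattice d, ∫⁻ ω, A.indicator 1 (shift x ω) ∂P = P A := fun x => by
    rw [(hP x).lintegral_comp hAmeas, lintegral_indicator_one hmeas]
  have e2 : ∀ y : Lattice d, ∫⁻ ω, f (shift y ω) ∂P = ∫⁻ ω, f ω ∂P := fun y =>
    (hP y).lintegral_comp hf
  simp only [e1, e2, Finset.sum_const, card_box, nsmul_eq_mul] at hint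
  have hN0 : (((2 * K + 1) ^ d : ℕ) : ℝ≥0∞) ≠ 0 := by
    exact_mod_cast (by positivity : (2 * K + 1) ^ d ≠ 0)
  have hNtop : (((2 * K + 1) ^ d : ℕ) : ℝ≥0∞) ≠ ∞ := ENNReal.natCast_ne_top _
  refine (ENNReal.mul_le_mul_iff_right hN0 hNtop).1 ?_
  calc (((2 * K + 1) ^ d : ℕ) : ℝ≥0∞) * (c * P A)
      = c * ((((2 * K + 1) ^ d : ℕ) : ℝ≥0∞) * P A) := by ring
    _ ≤ 5 ^ d * ((((2 * (K + K) + 1) ^ d : ℕ) : ℝ≥0∞) * ∫⁻ ω, f ω ∂P) := hint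
    _ ≤ 5 ^ d * (((2 ^ d * (2 * K + 1) ^ d : ℕ) : ℝ≥0∞) * ∫⁻ ω, f ω ∂P) := by
        gcongr
        rw [← mul_pow]
        exact Nat.pow_le_pow_left (by omega) d
    _ = _ := by
        push_cast
        rw [show (10 : ℝ≥0∞) = 5 * 2 by norm_num, mul_pow]
        ring

/-- Ergodicity upgrades the maximal inequality to an almost sure bound. -/
theorem ae_exists_box_sum_le {P : Measure (Environment d)} [IsProbabilityMeasure P]
    (hP : ∀ z : Lattice d, MeasurePreserving (shift z) P P)
    (herg : ∀ A : Set (Environment d), MeasurableSet A →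
      (∀ z : Lattice d, shift z ⁻¹' A = A) → P A = 0 ∨ P A = 1)
    {f : Environment d → ℝ≥0∞} (hf : Measurable f) (hfin : ∫⁻ ω, f ω ∂P ≠ ∞) :
    ∃ c : ℝ≥0∞, c ≠ ∞ ∧ ∀ᵐ ω ∂P, ∃ z : Lattice d, ∀ k : ℕ,
      ∑ y ∈ box z k, f (shift y ω) ≤ c * (2 * k + 1 : ℕ) ^ d := by
  set I := ∫⁻ ω, f ω ∂P with hI
  -- Twice the weak-type constant makes the bad event have probability at most `1 / 2`; the summand
  -- `1` keeps `c` nonzero even when the integral vanishes.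
  set c : ℝ≥0∞ := 2 * (10 ^ d * I) + 1 with hc
  have hI10 : 10 ^ d * I ≠ ∞ := ENNReal.mul_ne_top (by simp) hfin
  have hctop : c ≠ ∞ := ENNReal.add_ne_top.2 ⟨ENNReal.mul_ne_top (by simp) hI10, by simp⟩
  have hc0 : c ≠ 0 := by simp [hc]
  refine ⟨c, hctop, ?_⟩
  set A : ℕ → Set (Environment d) := fun K =>
    {ω | ∃ k ≤ K, c * (2 * k + 1 : ℕ) ^ d < ∑ y ∈ box 0 k, f (shift y ω)} with hA
  set G : Set (Environment d) :=
    {ω | ∀ k : ℕ, ∑ y ∈ box 0 k, f (shift y ω) ≤ c * (2 * k + 1 : ℕ) ^ d} with hG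
  have hGmeas : MeasurableSet G := by
    have : G = ⋂ k : ℕ, {ω | ∑ y ∈ box 0 k, f (shift y ω) ≤ c * (2 * k + 1 : ℕ) ^ d} := by
      ext ω; simp [hG]
    rw [this]
    exact MeasurableSet.iInter fun k => measurableSet_le
      (Finset.measurable_fun_sum _ fun y _ => hf.comp (hP y).measurable) measurable_const
  have hGA : Gᶜ = ⋃ K, A K := by
    ext ω
    simp only [hG, hA, mem_compl_iff, mem_ofPred_eq, not_forall, not_le, mem_iUnion]
    exact ⟨fun ⟨k, hk⟩ => ⟨k, k, le_rfl, hk⟩, fun ⟨_, k, _, hk⟩ => ⟨k, hk⟩⟩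
  have hAmono : Monotone A := fun K L hKL ω ⟨k, hk, h⟩ => ⟨k, hk.trans hKL, h⟩
  have hAle : ∀ K, P (A K) ≤ 1 / 2 := by
    intro K
    have h1 := measure_exists_box_sum_le hP hf c K
    rw [ENNReal.le_div_iff_mul_le (by simp) (by simp)]
    refine (ENNReal.mul_le_mul_iff_right hc0 hctop).1 ?_
    calc c * (P (A K) * 2) = 2 * (c * P (A K)) := by ring
      _ ≤ 2 * (10 ^ d * I) := by gcongr
      _ ≤ c * 1 := by rw [mul_one, hc]; exact le_self_add
  have hGc : P Gᶜ ≤ 1 / 2 := by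
    rw [hGA, hAmono.measure_iUnion]
    exact iSup_le hAle
  have hGpos : P G ≠ 0 := by
    intro h0
    have h1 := prob_compl_eq_one_sub hGmeas (μ := P)
    rw [h0, tsub_zero] at h1
    rw [h1] at hGc
    norm_num at hGc
  -- `G` itself is not invariant, but the event that some translate of the environment lies in `G`
  -- is. It contains `G`, so its probability is positive and therefore one.
  set D : Set (Environment d) := ⋃ z : Lattice d, shift z ⁻¹' G with hD
  have hDmeas : MeasurableSet D := MeasurableSet.iUnion fun z => (hP z).measurable hGmeas
  have hDinv : ∀ w : Lattice d, shift w ⁻¹' D = D := by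
    intro w
    ext ω
    simp only [hD, mem_preimage, mem_iUnion, shift_shift]
    exact ⟨fun ⟨z, hz⟩ => ⟨z + w, hz⟩, fun ⟨z, hz⟩ => ⟨z - w, by simpa using hz⟩⟩
  have hGD : G ⊆ D := fun ω hω => mem_iUnion.2 ⟨0, by simpa [shift_zero] using hω⟩
  have hD1 : P D = 1 := (herg D hDmeas hDinv).resolve_left fun h0 =>
    hGpos (measure_mono_null hGD h0)
  have hae : ∀ᵐ ω ∂P, ω ∈ D := by
    rwa [← prob_compl_eq_zero_iff hDmeas] at hD1
  filter_upwards [hae] with ω hω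
  obtain ⟨z, hz⟩ := mem_iUnion.1 hω
  refine ⟨z, fun k => ?_⟩
  rw [← sum_box_zero_shift]
  exact hz k

theorem ofReal_sum_le {ι : Type*} (s : Finset ι) (f : ι → ℝ) :
    ENNReal.ofReal (∑ i ∈ s, f i) ≤ ∑ i ∈ s, ENNReal.ofReal (f i) := by
  classical
  induction s using Finset.induction_on with
  | empty => simp
  | insert a s ha ih =>
    rw [Finset.sum_insert ha, Finset.sum_insert ha]
    exact ENNReal.ofReal_add_le.trans (by gcongr)

/-- Averages of a stationary integrable function over large balls are almost surely bounded by a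
deterministic constant. -/
theorem ae_sum_ball_le {P : Measure (Environment d)} [IsProbabilityMeasure P]
    (hP : ∀ z : Lattice d, MeasurePreserving (shift z) P P)
    (herg : ∀ A : Set (Environment d), MeasurableSet A →
      (∀ z : Lattice d, shift z ⁻¹' A = A) → P A = 0 ∨ P A = 1)
    {F : Environment d → ℝ} (hF : Integrable F P) :
    ∃ A : ℝ, ∀ᵐ ω ∂P, ∀ x₀ : Lattice d, ∃ N : ℕ, ∀ n : ℝ, (N : ℝ) ≤ n →
      ∑ x ∈ ballFinset x₀ n, F (shift x ω) ≤ A * n ^ d := by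
  -- The maximal inequality needs a measurable function; by stationarity the modification agrees
  -- with `F` along almost every orbit, as there are countably many translations.
  set F' := hF.1.mk F with hF'
  have hF'm : Measurable F' := hF.1.stronglyMeasurable_mk.measurable
  have hFF' : F =ᵐ[P] F' := hF.1.ae_eq_mk
  have hfm : Measurable fun ω => ENNReal.ofReal (F' ω) := ENNReal.measurable_ofReal.comp hF'm
  have hfin : ∫⁻ ω, ENNReal.ofReal (F' ω) ∂P ≠ ∞ := by
    have hi : Integrable F' P := hF.congr hFF'
    exact (lt_of_le_of_lt (lintegral_mono fun ω => Real.ofReal_le_enorm (F' ω)) hi.2).ne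
  obtain ⟨c, hc, hae⟩ := ae_exists_box_sum_le hP herg hfm hfin
  have heq : ∀ᵐ ω ∂P, ∀ x : Lattice d, F (shift x ω) = F' (shift x ω) :=
    ae_all_iff.2 fun x => (hP x).quasiMeasurePreserving.ae hFF'
  refine ⟨c.toReal * 5 ^ d, ?_⟩
  filter_upwards [hae, heq] with ω hω hωF x₀
  obtain ⟨z, hz⟩ := hω
  obtain ⟨m, hm⟩ : ∃ m : ℕ, ∀ i, |x₀ i - z i| ≤ m := by
    refine ⟨∑ i, (x₀ i - z i).natAbs, fun i => ?_⟩
    rw [Int.abs_eq_natAbs]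
    exact_mod_cast Finset.single_le_sum (f := fun i => (x₀ i - z i).natAbs)
      (fun _ _ => Nat.zero_le _) (Finset.mem_univ i)
  -- From this radius on, a box around `z` containing `B(x₀, n)` has side at most `5 n`, so the
  -- random centre `z` affects only the threshold and not the constant.
  refine ⟨2 * m + 3, fun n hn => ?_⟩
  push_cast at hn
  have hn0 : 0 ≤ n := by have : (0 : ℝ) ≤ m := by positivity
                         linarith
  set k := ⌈n⌉₊ + m with hk
  have hsub : ballFinset x₀ n ⊆ box z k := by
    refine (ballFinset_subset_box x₀ (Nat.le_ceil n)).trans fun y hy => ?_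
    rw [mem_box] at *
    intro i
    calc |y i - z i| ≤ |y i - x₀ i| + |x₀ i - z i| := abs_sub_le _ _ _
      _ ≤ (⌈n⌉₊ : ℤ) + m := add_le_add (hy i) (hm i)
      _ = k := by rw [hk]; push_cast; rfl
  have hle : ENNReal.ofReal (∑ x ∈ ballFinset x₀ n, F (shift x ω))
      ≤ ENNReal.ofReal (c.toReal * 5 ^ d * n ^ d) := by
    calc ENNReal.ofReal (∑ x ∈ ballFinset x₀ n, F (shift x ω))
        ≤ ∑ x ∈ ballFinset x₀ n, ENNReal.ofReal (F' (shift x ω)) := by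
          simp only [hωF]
          exact ofReal_sum_le _ _
      _ ≤ ∑ x ∈ box z k, ENNReal.ofReal (F' (shift x ω)) := Finset.sum_le_sum_of_subset hsub
      _ ≤ c * (2 * k + 1 : ℕ) ^ d := hz k
      _ = ENNReal.ofReal (c.toReal * (2 * k + 1 : ℕ) ^ d) := by
          rw [ENNReal.ofReal_mul ENNReal.toReal_nonneg, ENNReal.ofReal_toReal hc,
            ENNReal.ofReal_pow (by positivity), ENNReal.ofReal_natCast]
      _ ≤ _ := by
          refine ENNReal.ofReal_le_ofReal ?_
          rw [mul_assoc, ← mul_pow]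
          have h1 : ((2 * k + 1 : ℕ) : ℝ) ≤ 5 * n := by
            have := Nat.ceil_lt_add_one hn0
            rw [hk]; push_cast
            linarith
          gcongr
  exact (ENNReal.ofReal_le_ofReal_iff (by positivity)).1 hle

/-! ### From the moment assumption to the volume bounds -/

/-- Translation of the neighbours of the origin to the neighbours of `x`. -/
def neighborEquiv (x : Lattice d) :
    (latticeGraph d).neighborSet 0 ≃ (latticeGraph d).neighborSet x where
  toFun y := ⟨(y : Lattice d) + x, by
    have := latticeGraph_adj.1 y.2
    refine latticeGraph_adj.2 ?_
    simpa using this⟩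
  invFun y := ⟨(y : Lattice d) - x, by
    have := latticeGraph_adj.1 y.2
    refine latticeGraph_adj.2 ?_
    simpa [abs_sub_comm] using this⟩
  left_inv y := by simp
  right_inv y := by simp

theorem conductance_shift (ω : Environment d) (x : Lattice d)
    (y : (latticeGraph d).neighborSet 0) :
    conductance (shift x ω) 0 y = conductance ω x (neighborEquiv x y) := by
  unfold conductance shift
  congr 2
  refine Subtype.ext ?_
  simp [shiftEdge, neighborEquiv]

theorem muMeasure_shift (ω : Environment d) (x : Lattice d) :
    muMeasure (shift x ω) 0 = muMeasure ω x :=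
  Fintype.sum_equiv (neighborEquiv x) _ _ fun y => conductance_shift ω x y

theorem nuMeasure_shift (ω : Environment d) (x : Lattice d) :
    nuMeasure (shift x ω) 0 = nuMeasure ω x :=
  Fintype.sum_equiv (neighborEquiv x) _ _ fun y => by rw [conductance_shift]

/-- Finite exponents below `p, q, r` which satisfy the same conditions. -/
theorem exists_admissibleExponents (hd : 2 ≤ d) {p q r : ℝ≥0∞} (hp : 1 < p) (hq : 1 < q)
    (hr : 1 < r) (h : r⁻¹ + p⁻¹ * (1 - r⁻¹) + q⁻¹ < 2 / (d : ℝ≥0∞)) :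
    ∃ p' q' r' : ℝ, AdmissibleExponents d p' q' r' ∧ ENNReal.ofReal p' ≤ p ∧
      ENNReal.ofReal q' ≤ q ∧ ENNReal.ofReal r' ≤ r := by
  have hinv : ∀ {s : ℝ≥0∞}, 1 < s → ∃ a : ℝ, 0 ≤ a ∧ a < 1 ∧ s⁻¹ = ENNReal.ofReal a := by
    intro s hs
    have h1 : s⁻¹ < 1 := ENNReal.inv_lt_one.2 hs
    refine ⟨s⁻¹.toReal, ENNReal.toReal_nonneg, ?_, (ENNReal.ofReal_toReal (h1.trans (by simp)).ne).symm⟩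
    simpa using (ENNReal.toReal_lt_toReal (h1.trans (by simp)).ne (by simp)).2 h1
  have hle : ∀ {s : ℝ≥0∞} {a b : ℝ}, s⁻¹ = ENNReal.ofReal a → a ≤ b → 0 < b →
      ENNReal.ofReal (1 / b) ≤ s := by
    intro s a b hs hab hb
    rw [one_div, ENNReal.ofReal_inv_of_pos hb, ENNReal.inv_le_iff_inv_le, hs]
    exact ENNReal.ofReal_le_ofReal hab
  obtain ⟨a, ha0, ha1, ha⟩ := hinv hp
  obtain ⟨b, hb0, hb1, hb⟩ := hinv hq
  obtain ⟨c, hc0, hc1, hc⟩ := hinv hr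
  have hd' : (0 : ℝ) < d := by exact_mod_cast (by omega : 0 < d)
  have hreal : c + a * (1 - c) + b < 2 / d := by
    have h1c : (0 : ℝ) ≤ 1 - c := by linarith
    have e1 : (1 : ℝ≥0∞) - ENNReal.ofReal c = ENNReal.ofReal (1 - c) := by
      rw [ENNReal.ofReal_sub _ hc0, ENNReal.ofReal_one]
    have e2 : (2 : ℝ≥0∞) / (d : ℝ≥0∞) = ENNReal.ofReal (2 / d) := by
      rw [ENNReal.ofReal_div_of_pos hd', ENNReal.ofReal_natCast]
      simp
    rw [ha, hb, hc, e1, e2, ← ENNReal.ofReal_mul ha0, ← ENNReal.ofReal_add hc0 (by positivity),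
      ← ENNReal.ofReal_add (by positivity) hb0] at h
    exact (ENNReal.ofReal_lt_ofReal_iff (by positivity)).1 h
  -- Raising the reciprocals of the exponents to at least `δ` makes the exponents finite while they
  -- stay above one. The left side of the condition grows by at most `3 δ`, less than the slack,
  -- which is at least `4 δ`.
  set δ := min (1 / 2) ((2 / d - (c + a * (1 - c) + b)) / 4) with hδ
  have hδ0 : 0 < δ := lt_min (by norm_num) (by linarith)
  have hδ1 : δ ≤ 1 / 2 := min_le_left _ _
  have hδ2 : δ ≤ (2 / d - (c + a * (1 - c) + b)) / 4 := min_le_right _ _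
  have key : ∀ {a : ℝ}, 0 ≤ a → a < 1 → 0 < max a δ ∧ max a δ < 1 ∧ max a δ ≤ a + δ := fun ha ha1 =>
    ⟨lt_max_of_lt_right hδ0, max_lt ha1 (by linarith), max_le (by linarith) (by linarith)⟩
  obtain ⟨a1, a2, a3⟩ := key ha0 ha1
  obtain ⟨b1, b2, b3⟩ := key hb0 hb1
  obtain ⟨c1, c2, c3⟩ := key hc0 hc1
  refine ⟨1 / max a δ, 1 / max b δ, 1 / max c δ, ⟨hd, ?_, ?_, ?_, ?_⟩,
    hle ha (le_max_left _ _) a1, hle hb (le_max_left _ _) b1, hle hc (le_max_left _ _) c1⟩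
  · exact (one_lt_div a1).2 a2
  · exact (one_lt_div b1).2 b2
  · exact (one_lt_div c1).2 c2
  · simp only [one_div_one_div]
    nlinarith [mul_nonneg (sub_nonneg.2 a3) (sub_nonneg.2 c2.le),
      mul_nonneg (sub_nonneg.2 c3) (sub_nonneg.2 ha1.le), mul_nonneg hδ0.le hc0,
      mul_nonneg hδ0.le ha0, mul_nonneg hδ0.le c1.le]

theorem integrable_rpow_of_memLp {Ω : Type*} [MeasurableSpace Ω] {μ : Measure Ω}
    [IsFiniteMeasure μ] {f : Ω → ℝ} {p : ℝ≥0∞} (hf : MemLp f p μ) {s : ℝ} (hs : 0 < s)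
    (hsp : ENNReal.ofReal s ≤ p) : Integrable (fun ω => |f ω| ^ s) μ := by
  have h := (hf.mono_exponent hsp).integrable_norm_rpow (by simpa using hs) (by simp)
  simpa only [ENNReal.toReal_ofReal hs.le, Real.norm_eq_abs] using h

/-- Under the assumptions on the environment, all the sums over balls which enter the estimates
are almost surely of the order of the volume, eventually. -/
theorem ae_volumeBounds {P : Measure (Environment d)} [IsProbabilityMeasure P]
    {θ : Environment d → Lattice d → ℝ} (hE : ErgodicityAssumption P θ) {p q r : ℝ≥0∞}
    (hM : MomentAssumption P θ p q r) {p' q' r' : ℝ} (h : AdmissibleExponents d p' q' r')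
    (hp : ENNReal.ofReal p' ≤ p) (hq : ENNReal.ofReal q' ≤ q) (hr : ENNReal.ofReal r' ≤ r) :
    ∃ A : ℝ, 1 ≤ A ∧ ∀ᵐ ω ∂P, ∀ x₀ : Lattice d, ∃ N : ℕ, ∀ n : ℝ, (N : ℝ) ≤ n →
      VolumeBounds A p' q' r' ω (θ ω) x₀ n := by
  have hp0 : 0 < p' := one_pos.trans h.one_lt_p
  have hq0 : 0 < q' := one_pos.trans h.one_lt_q
  have hr0 : 0 < r' := one_pos.trans h.one_lt_r
  have hpos0 : ∀ᵐ ω ∂P, 0 < θ ω 0 := hE.speed_pos.mono fun ω hω => hω 0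
  have i1 : Integrable (fun ω => θ ω 0) P := hE.speed_integrable
  have i2 : Integrable (fun ω : Environment d => muMeasure ω 0) P :=
    integrable_finsetSum _ fun y _ => hE.conductance_integrable _
  have i3 : Integrable (fun ω : Environment d => nuMeasure ω 0) P :=
    hM.nu.integrable hM.one_lt_q.le
  -- The moment of `μ / θ` is taken under the measure with density `θ(0)`; unfolding the density
  -- puts the factor `θ` in front of the power.
  have i4 : Integrable (fun ω => θ ω 0 * (muMeasure ω 0 / θ ω 0) ^ p') P := by
    have hfin : IsFiniteMeasure (P.withDensity fun ω => ENNReal.ofReal (θ ω 0)) :=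
      isFiniteMeasure_withDensity_ofReal i1.2
    have h1 := integrable_rpow_of_memLp hM.mu_div_speed hp0 hp
    rw [integrable_withDensity_iff_integrable_smul₀' i1.1.aemeasurable.ennreal_ofReal
      (ae_of_all _ fun _ => ENNReal.ofReal_lt_top)] at h1
    refine h1.congr ?_
    filter_upwards [hpos0] with ω hω
    rw [ENNReal.toReal_ofReal hω.le, smul_eq_mul,
      abs_of_nonneg (div_nonneg (muMeasure_nonneg ω 0) hω.le)]
  have i5 : Integrable (fun ω : Environment d => nuMeasure ω 0 ^ q') P :=
    (integrable_rpow_of_memLp hM.nu hq0 hq).congr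
      (ae_of_all _ fun ω => by simp only [abs_of_nonneg (nuMeasure_nonneg ω 0)])
  have i6 : Integrable (fun ω => (θ ω 0)⁻¹) P := hM.inv_speed
  have i7 : Integrable (fun ω => θ ω 0 ^ r') P :=
    (integrable_rpow_of_memLp hM.speed hr0 hr).congr
      (hpos0.mono fun ω hω => by simp only [abs_of_pos hω])
  obtain ⟨A1, h1⟩ := ae_sum_ball_le hE.stationary hE.ergodic i1
  obtain ⟨A2, h2⟩ := ae_sum_ball_le hE.stationary hE.ergodic i2
  obtain ⟨A3, h3⟩ := ae_sum_ball_le hE.stationary hE.ergodic i3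
  obtain ⟨A4, h4⟩ := ae_sum_ball_le hE.stationary hE.ergodic i4
  obtain ⟨A5, h5⟩ := ae_sum_ball_le hE.stationary hE.ergodic i5
  obtain ⟨A6, h6⟩ := ae_sum_ball_le hE.stationary hE.ergodic i6
  obtain ⟨A7, h7⟩ := ae_sum_ball_le hE.stationary hE.ergodic i7
  obtain ⟨A, hA⟩ := ({1, A1, A2, A3, A4, A5, A6, A7} : Finset ℝ).exists_le
  simp only [Finset.mem_insert, Finset.mem_singleton, forall_eq_or_imp, forall_eq] at hA
  obtain ⟨hA0, hA1, hA2, hA3, hA4, hA5, hA6, hA7⟩ := hA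
  refine ⟨A, hA0, ?_⟩
  have hθ : ∀ᵐ ω ∂P, ∀ x : Lattice d, θ (shift x ω) 0 = θ ω x := ae_all_iff.2 fun x =>
    (hE.speed_stationary 0 x).mono fun ω hω => by rw [← hω, zero_add]
  filter_upwards [h1, h2, h3, h4, h5, h6, h7, hθ, hE.speed_pos,
    ae_all_iff.2 hE.conductance_pos] with ω k1 k2 k3 k4 k5 k6 k7 hωθ hωpos hωc x₀
  obtain ⟨N1, k1⟩ := k1 x₀
  obtain ⟨N2, k2⟩ := k2 x₀
  obtain ⟨N3, k3⟩ := k3 x₀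
  obtain ⟨N4, k4⟩ := k4 x₀
  obtain ⟨N5, k5⟩ := k5 x₀
  obtain ⟨N6, k6⟩ := k6 x₀
  obtain ⟨N7, k7⟩ := k7 x₀
  simp only [hωθ, muMeasure_shift, nuMeasure_shift] at k1 k2 k3 k4 k5 k6 k7
  refine ⟨N1 + N2 + N3 + N4 + N5 + N6 + N7, fun n hn => ?_⟩
  push_cast at hn
  have c1 : (0 : ℝ) ≤ N1 := by positivity
  have c2 : (0 : ℝ) ≤ N2 := by positivity
  have c3 : (0 : ℝ) ≤ N3 := by positivity
  have c4 : (0 : ℝ) ≤ N4 := by positivity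
  have c5 : (0 : ℝ) ≤ N5 := by positivity
  have c6 : (0 : ℝ) ≤ N6 := by positivity
  have c7 : (0 : ℝ) ≤ N7 := by positivity
  have hn0 : 0 ≤ n := by linarith
  have up : ∀ {B S : ℝ}, S ≤ B * n ^ d → B ≤ A → S ≤ A * n ^ d := fun hS hB =>
    hS.trans (by gcongr)
  exact
    { conductance_pos := hωc
      speed_pos := hωpos
      speed := up (k1 n (by linarith)) hA1
      mu := up (k2 n (by linarith)) hA2
      nu := up (k3 n (by linarith)) hA3
      mu_div_speed := up (k4 n (by linarith)) hA4
      nu_rpow := up (k5 n (by linarith)) hA5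
      inv_speed := up (k6 n (by linarith)) hA6
      speed_rpow := up (k7 n (by linarith)) hA7 }

/-! ### Scaling and conclusion -/

theorem IsCaloricOn.div_const {ω : Environment d} {ϑ : Lattice d → ℝ} {I : Set ℝ}
    {B : Set (Lattice d)} {u : ℝ → Lattice d → ℝ} (h : IsCaloricOn ω ϑ I B u) (ε : ℝ) :
    IsCaloricOn ω ϑ I B fun t x => u t x / ε := by
  intro t ht x hx
  refine ((h t ht x hx).div_const ε).congr_deriv ?_
  simp only [generator, ← sub_div, ← mul_div_assoc, ← Finset.sum_div]

end RCM

theorem proposition2 {d : ℕ} (hd : 2 ≤ d)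
    (P : MeasureTheory.Measure (RCM.Environment d)) [MeasureTheory.IsProbabilityMeasure P]
    (θ : RCM.Environment d → RCM.Lattice d → ℝ)
    (hergodic : RCM.ErgodicityAssumption P θ)
    (p q r : ℝ≥0∞) (hmoment : RCM.MomentAssumption P θ p q r) :
    ∃ γ : ℝ → ℝ, (∀ ε : ℝ, 0 < ε → 0 < γ ε) ∧
      ∀ x₀ : RCM.Lattice d, ∀ᵐ ω ∂P, ∃ N : ℕ, ∀ n : ℝ, (N : ℝ) ≤ n →
        ∀ (t₀ : ℝ) (u : ℝ → RCM.Lattice d → ℝ),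
          (∀ t ∈ Set.Icc (t₀ - n ^ 2) t₀, ∀ x ∈ RCM.ball x₀ n, 0 < u t x) →
          RCM.IsCaloricOn ω (θ ω) (Set.Icc (t₀ - n ^ 2) t₀) (RCM.ball x₀ n) u →
          ∀ ε : ℝ, 0 < ε →
            1 / 2 ≤ 1 / n ^ 2 * ∫ t in (t₀ - n ^ 2)..t₀,
              RCM.weightedNorm (RCM.ballFinset x₀ n)
                (fun x => RCM.cutoff x₀ n x ^ 2 * θ ω x)
                (Set.indicator {x | ε ≤ u t x} 1) →
            ∀ t ∈ Set.Icc (t₀ - n ^ 2 / 8) t₀, ∀ x ∈ RCM.ball x₀ (n / 4), γ ε ≤ u t x := by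
  obtain ⟨p', q', r', h, hp, hq, hr⟩ := RCM.exists_admissibleExponents hd hmoment.one_lt_p
    hmoment.one_lt_q hmoment.one_lt_r hmoment.exponents
  obtain ⟨A, hA, hae⟩ := RCM.ae_volumeBounds hergodic hmoment h hp hq hr
  obtain ⟨c, hc, hbound⟩ := RCM.exists_lower_bound h hA
  -- By linearity `u / ε` satisfies the hypotheses at level one. The random threshold comes from the
  -- volume bounds alone, so it is fixed before `t₀`, `u` and `ε` are introduced.
  refine ⟨fun ε => ε * c, fun ε hε => mul_pos hε hc, fun x₀ => ?_⟩
  filter_upwards [hae] with ω hω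
  obtain ⟨N, hN⟩ := hω x₀
  refine ⟨N + 32, fun n hn t₀ u hpos hcal ε hε hhalf t ht x hx => ?_⟩
  push_cast at hn
  have hN0 : (0 : ℝ) ≤ N := by positivity
  have hset : ∀ s : ℝ, {x : RCM.Lattice d | 1 ≤ u s x / ε} = {x | ε ≤ u s x} := fun s => by
    ext y
    exact one_le_div hε
  have hres := hbound ω (θ ω) x₀ n t₀ (fun t x => u t x / ε) (by linarith)
    (hN n (by linarith)) (fun s hs y hy => div_pos (hpos s hs y hy) hε) (hcal.div_const ε)
    (by simpa only [hset] using hhalf) t ht x hx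
  rwa [le_div_iff₀ hε, mul_comm] at hres
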